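/- Write $[X]=\{1,2,\dots,X\}$ for a positive integer $X$, $\mathbb{T}=\mathbb{R}/\mathbb{Z}$, $\|\theta\|_{\mathbb{T}}$ for the distance from $\theta$ to the nearest integer, $e(\theta)=e^{2\pi i\theta}$, and $\mathbb{E}_{x\in S}=\frac{1}{|S|}\sum_{x\in S}$. For finitely supported $f:\mathbb{Z}\to\mathbb{C}$ put $\Delta_h f(x)=f(x)\overline{f(x+h)}$, $\Delta_{h_1,\dots,h_s}f=\Delta_{h_1}\cdots\Delta_{h_s}f$ and $$\|f\|_{U^s(\mathbb{Z})}=\Big(\sum_{x,h_1,\dots,h_s\in\mathbb{Z}}\Delta_{h_1,\dots,h_s}f(x)\Big)^{1/2^s}.$$ For a positive integer $N$ let $\mu_N(d)=\frac1N\max\{1-\frac{|d|}{N},0\}$ for $d\in\mathbb{Z}$. **Lemma (Degree lowering).** For every integer $s\ge 2$ there are constants $C>0$ and $k\in\mathbb{N}$, depending only on $s$, such that the following holds. Let $N$ be a positive integer and let $f_0,f_1:\mathbb{Z}^2\to\mathbb{C}$ satisfy $|f_0|,|f_1|\le 1$, $\mathrm{supp}(f_0)\subset[N]\times[N^2]$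 and $\mathrm{supp}(f_1)\subset([-N,2N]\cap\mathbb{Z})\times[N^2]$. Define the dual function $$F_x(y)=F(x,y)=\sum_{d\in\mathbb{Z}}\mu_N(d)f_0(x,y-d^2)f_1(x+d,y-d^2).$$ Then $|F|\le 1$ and $F$ is supported on $[N]\times[2N^2]$. Moreover, if $\delta>0$ and $$\mathbb{E}_{x\in[N]}\|F_x\|_{U^s(\mathbb{Z})}^{2^s}\ \ge\ \delta\,\|1_{[2N^2]}\|_{U^s(\mathbb{Z})}^{2^s},$$ then either $N\le C\delta^{-k}$, or there exist $\alpha\in\mathbb{T}$ and a positive integer $q\le C\delta^{-k}$ such that $\|q\alpha\|_{\mathbb{T}}\le C\delta^{-k}/N^2$ and $$\mathbb{E}_{x\in[N]}\mathbb{E}_{y\in[N^2]}\Big|\sum_{d\in\mathbb{Z}}\mu_N(d)f_1(x+d,y)e(\alpha d^2)\Big|\ \ge\ C^{-1}\delta^{k}.$$ -/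

import Mathlib

open scoped BigOperators ComplexConjugate

namespace DegreeLowering

noncomputable section

/-- The normalised Fejér kernel `μ_N(d) = (1/N) (1 - |d|/N)_+` on the integers. -/
def fejer (N : ℕ) (d : ℤ) : ℝ :=
  (1 / (N : ℝ)) * max (1 - |(d : ℝ)| / (N : ℝ)) 0

/-- The difference function `Δ_h f (x) = f(x) * conj (f(x+h))`. -/
def diffFun (h : ℤ) (f : ℤ → ℂ) : ℤ → ℂ :=
  fun x => f x * conj (f (x + h))

/-- The iterated difference function `Δ_{h₁,…,h_s} f = Δ_{h₁} ⋯ Δ_{h_s} f`. -/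
def iterDiffFun : (s : ℕ) → (Fin s → ℤ) → (ℤ → ℂ) → (ℤ → ℂ)
  | 0, _, f => f
  | s + 1, h, f => diffFun (h 0) (iterDiffFun s (Fin.tail h) f)

/-- The Gowers norm `‖f‖_{U^s(ℤ)} = (∑_{x,h₁,…,h_s} Δ_{h₁,…,h_s} f(x))^{1/2^s}` with respect to
counting measure, for finitely supported `f` and `s ≥ 1`. The sum is then a nonnegative real
number, so it equals its modulus, which is how the complex sum is read as a real number. -/
def gowersNorm (s : ℕ) (f : ℤ → ℂ) : ℝ :=
  ‖∑' p : ℤ × (Fin s → ℤ), iterDiffFun s p.2 f p.1‖ ^ (1 / (2 : ℝ) ^ s)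

/-- The indicator function of `{a, …, b}` in the integers. -/
def intervalIndicator (a b : ℤ) : ℤ → ℂ :=
  Set.indicator (Set.Icc a b) (fun _ => 1)

/-- The dual function `F(x,y) = ∑_d μ_N(d) f₀(x, y-d²) f₁(x+d, y-d²)`. -/
def dualFun (N : ℕ) (f₀ f₁ : ℤ × ℤ → ℂ) : ℤ × ℤ → ℂ :=
  fun p => ∑' d : ℤ, (fejer N d : ℂ) * f₀ (p.1, p.2 - d ^ 2) * f₁ (p.1 + d, p.2 - d ^ 2)

/-- The character `e(θ) = exp(2πiθ)` on `𝕋 = ℝ/ℤ`. -/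
def e (θ : UnitAddCircle) : ℂ := (AddCircle.toCircle θ : ℂ)

end

end DegreeLowering

namespace DegreeLowering

/-! ### Elementary inequalities for finite sums -/

/-! The proof lowers the degree of the Gowers norm one step at a time until $U^2$ is reached, where
Fourier analysis yields the conclusion. Suppose the $U^{m+2}$ norm of $F_x$ is large on average. The
$U^2$ inverse theorem (`IsBddOn.exists_fourier`), applied to $m$-fold derivatives, gives frequencies
$\phi_x(h)$ with which $\Delta_h F_x$ correlates for many $(x,h)$. Nothing is known about $\phi_x$ a
priori; the point is to show that it is of lower order in $h$.

To this end $F_x$ is replaced, at the top vertex of the cube only, by its definition as an average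
over $d$. Every other factor ignores some $h_i$ and disappears under a box form of Cauchy–Schwarz
(`dual_difference_interchange`). There remains a sum over $d$ and $y$ twisted by the alternating sum
$\partial\phi_x(u,v)$ of frequencies over the vertices of a box. Translating $y$ by $d^2$ turns the
linear phase in $y$ into a quadratic phase in $d$, and $f_0$, which no longer sees $d$, drops out
(`IsAdmissible.norm_sum_constituent_le`). So a derivative of $f_1(x+d,y)$ correlates with
$e(d^2\,\partial\phi_x)$ for many $x$. As $f_1$ sees only $x+d$, two values of $x$ can be compared
(`card_large_pairSum`), and Weyl differencing puts $\partial\phi_x-\partial\phi_{x'}$ in a major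
arc. Pigeonholing makes the phase nearly independent of $x$, and a second comparison puts the phase
itself in a major arc (`exists_many_major`).

The major arcs are covered by few short arcs, so $\partial\phi_x(u,v)\approx\alpha$ for a fixed $v$
and many $(x,u)$. Every vertex of the box other than $u$ shares a coordinate with $v$, hence
$\phi_x(u)\approx\alpha+\sum_i\psi_i(u)$ with $\psi_i$ independent of $u_i$
(`exists_lower_order_phase`). A further Cauchy–Schwarz argument removes the $\psi_i$
(`norm_sum_twisted_le`) and shows that the $U^{m+1}$ norm is large. When $m=0$ there are no
$\psi_i$: the Fourier coefficients of $F_x$ at a single major arc frequency $\alpha$ are large, and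
the same translation by $d^2$ bounds them by the desired correlation of $f_1$
(`IsAdmissible.le_quadCorr`). -/

/-- The cube `I^m`. -/
abbrev cube (m : ℕ) (I : Finset ℤ) : Finset (Fin m → ℤ) := Fintype.piFinset fun _ => I

theorem sum_cube_succ {A : Type*} [AddCommMonoid A] {m : ℕ} (I : Finset ℤ)
    (F : (Fin (m + 1) → ℤ) → A) :
    ∑ h ∈ cube (m + 1) I, F h = ∑ a ∈ I, ∑ h ∈ cube m I, F (Fin.cons a h) := by
  rw [← Finset.sum_product']
  refine Finset.sum_bij' (fun h _ => (h 0, Fin.tail h)) (fun p _ => Fin.cons p.1 p.2) ?_ ?_ ?_ ?_ ?_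
  · intro h hh
    simp only [Fintype.mem_piFinset] at hh
    simp [Fin.tail, hh]
  · rintro ⟨a, h⟩ hh
    simp only [Finset.mem_product, Fintype.mem_piFinset] at hh
    simp only [Fintype.mem_piFinset]
    intro i
    refine Fin.cases ?_ (fun i => ?_) i
    · simpa using hh.1
    · simpa using hh.2 i
  · intro h _
    simp
  · rintro ⟨a, h⟩ _
    simp
  · intro h _
    simp

theorem sum_cube_zero {A : Type*} [AddCommMonoid A] (I : Finset ℤ) (F : (Fin 0 → ℤ) → A) :
    ∑ h ∈ cube 0 I, F h = F ![] := by
  rw [cube, Fintype.piFinset_of_isEmpty, Finset.univ_unique, Finset.sum_singleton]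
  exact congrArg F (Subsingleton.elim _ _)

theorem card_cube (m : ℕ) (I : Finset ℤ) : (cube m I).card = I.card ^ m := by
  simp [cube]

/-- If a function with values at most `B` has average at least `ε B`, then it is at least
`ε² B` on a proportion `ε²` of the points, when `ε ≤ 1 / 2`. -/
theorem card_popular {ι : Type*} (A : Finset ι) (f : ι → ℝ) {B ε : ℝ} (hB : 0 < B)
    (hε : 0 < ε) (hε' : ε ≤ 1 / 2) (hf : ∀ i ∈ A, f i ≤ B)
    (h : ε * A.card * B ≤ ∑ i ∈ A, f i) :
    ε ^ 2 * A.card ≤ (A.filter fun i => ε ^ 2 * B ≤ f i).card := by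
  classical
  have h1 : ∑ i ∈ A, f i ≤ (A.filter fun i => ε ^ 2 * B ≤ f i).card * B
      + A.card * (ε ^ 2 * B) := by
    rw [← Finset.sum_filter_add_sum_filter_not A (fun i => ε ^ 2 * B ≤ f i)]
    have ha : ∑ i ∈ A.filter (fun i => ε ^ 2 * B ≤ f i), f i ≤
        (A.filter fun i => ε ^ 2 * B ≤ f i).card * B := by
      rw [← nsmul_eq_mul]
      exact Finset.sum_le_card_nsmul _ _ _ fun i hi => hf i (Finset.mem_filter.1 hi).1
    have hb : ∑ i ∈ A.filter (fun i => ¬ ε ^ 2 * B ≤ f i), f i ≤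
        (A.filter fun i => ¬ ε ^ 2 * B ≤ f i).card * (ε ^ 2 * B) := by
      rw [← nsmul_eq_mul]
      exact Finset.sum_le_card_nsmul _ _ _ fun i hi => (not_le.1 (Finset.mem_filter.1 hi).2).le
    have hc : ((A.filter fun i => ¬ ε ^ 2 * B ≤ f i).card : ℝ) * (ε ^ 2 * B) ≤
        A.card * (ε ^ 2 * B) := by
      gcongr
      exact Finset.filter_subset _ _
    linarith
  have h2 : (ε ^ 2 * A.card) * B ≤ (A.filter fun i => ε ^ 2 * B ≤ f i).card * B := by
    have h3 : (2 * ε ^ 2) * (A.card * B) ≤ ε * (A.card * B) := by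
      gcongr
      nlinarith
    nlinarith
  exact le_of_mul_le_mul_right h2 hB

/-- The power mean inequality, cleared of denominators so that the empty set needs no exception. -/
theorem pow_sum_mul_card_le {ι : Type*} (s : Finset ι) (f : ι → ℝ) (hf : ∀ i ∈ s, 0 ≤ f i)
    {p : ℕ} (hp : p ≠ 0) : (∑ i ∈ s, f i) ^ p * s.card ≤ s.card ^ p * ∑ i ∈ s, f i ^ p := by
  obtain ⟨p, rfl⟩ := Nat.exists_eq_succ_of_ne_zero hp
  rcases s.eq_empty_or_nonempty with rfl | hs
  · simp
  have hc : (0 : ℝ) < s.card := by exact_mod_cast hs.card_pos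
  have := pow_sum_div_card_le_sum_pow hf p
  rw [div_le_iff₀ (by positivity)] at this
  calc (∑ i ∈ s, f i) ^ (p + 1) * s.card ≤ ((∑ i ∈ s, f i ^ (p + 1)) * s.card ^ p) * s.card := by
        gcongr
    _ = _ := by rw [Nat.succ_eq_add_one]; ring

/-- The form of Cauchy–Schwarz used throughout: a bounded weight of which nothing else is known is
discarded. -/
theorem norm_sum_mul_sq_le {ι : Type*} (s : Finset ι) (b X : ι → ℂ) (hb : ∀ i, ‖b i‖ ≤ 1) :
    ‖∑ i ∈ s, b i * X i‖ ^ 2 ≤ s.card * ∑ i ∈ s, ‖X i‖ ^ 2 := by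
  have h : ‖∑ i ∈ s, b i * X i‖ ≤ ∑ i ∈ s, ‖X i‖ := by
    refine (norm_sum_le _ _).trans (Finset.sum_le_sum fun i _ => ?_)
    rw [norm_mul]
    exact mul_le_of_le_one_left (norm_nonneg _) (hb i)
  calc _ ≤ (∑ i ∈ s, ‖X i‖) ^ 2 := by gcongr
    _ ≤ _ := sq_sum_le_card_mul_sum_sq

theorem norm_sum_sq_eq {ι : Type*} (s : Finset ι) (X : ι → ℂ) :
    ((‖∑ i ∈ s, X i‖ ^ 2 : ℝ) : ℂ) = ∑ i ∈ s, ∑ j ∈ s, X i * conj (X j) := by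
  push_cast
  rw [← Complex.mul_conj', map_sum, Finset.sum_mul_sum]

/-- A unimodular number rotating `z` to its modulus. -/
theorem exists_phase (z : ℂ) : ∃ c : ℂ, ‖c‖ = 1 ∧ c * z = ‖z‖ := by
  rcases eq_or_ne z 0 with rfl | hz
  · exact ⟨1, by simp⟩
  · refine ⟨conj z / ‖z‖, ?_, ?_⟩
    · simp [hz]
    · have : (‖z‖ : ℂ) ≠ 0 := by simpa using hz
      field_simp
      rw [mul_comm, Complex.mul_conj']

/-! ### The additive character -/

theorem e_add (a b : UnitAddCircle) : e (a + b) = e a * e b := by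
  simp [e, AddCircle.toCircle_add]

@[simp] theorem e_zero : e 0 = 1 := by simp [e]

@[simp] theorem norm_e (a : UnitAddCircle) : ‖e a‖ = 1 := Circle.norm_coe _

theorem e_neg (a : UnitAddCircle) : e (-a) = conj (e a) := by
  rw [e, AddCircle.toCircle_neg, Circle.coe_inv_eq_conj, e]

theorem e_sub (a b : UnitAddCircle) : e (a - b) = e a * conj (e b) := by
  rw [sub_eq_add_neg, e_add, e_neg]

theorem e_sum {ι : Type*} (s : Finset ι) (f : ι → UnitAddCircle) :
    e (∑ i ∈ s, f i) = ∏ i ∈ s, e (f i) := by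
  classical
  induction s using Finset.induction_on with
  | empty => simp
  | insert a s ha ih => rw [Finset.sum_insert ha, Finset.prod_insert ha, e_add, ih]

theorem exists_coe_eq (θ : UnitAddCircle) : ∃ r : ℝ, (r : UnitAddCircle) = θ ∧ |r| = ‖θ‖ := by
  obtain ⟨t, rfl⟩ := QuotientAddGroup.mk_surjective θ
  refine ⟨t - round t, ?_, ?_⟩
  · have : ((round t : ℝ) : UnitAddCircle) = 0 := by
      rw [AddCircle.coe_eq_zero_iff]
      exact ⟨round t, by simp⟩
    rw [AddCircle.coe_sub, this, sub_zero]
  · exact UnitAddCircle.norm_eq.symm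

theorem e_coe (r : ℝ) : e (r : UnitAddCircle) = Complex.exp ((2 * Real.pi * r : ℝ) * Complex.I) := by
  simp [e, AddCircle.toCircle_apply_mk, Circle.coe_exp]

theorem norm_e_coe_sub_one (r : ℝ) : ‖e (r : UnitAddCircle) - 1‖ = 2 * |Real.sin (Real.pi * r)| := by
  rw [e_coe, mul_comm _ Complex.I, Complex.norm_exp_I_mul_ofReal_sub_one]
  rw [norm_mul, Real.norm_eq_abs, Real.norm_eq_abs]
  norm_num
  congr 2
  ring

theorem norm_e_sub_one_le (θ : UnitAddCircle) : ‖e θ - 1‖ ≤ 7 * ‖θ‖ := by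
  obtain ⟨r, rfl, hr⟩ := exists_coe_eq θ
  rw [norm_e_coe_sub_one, ← hr]
  have := Real.abs_sin_le_abs (x := Real.pi * r)
  rw [abs_mul, abs_of_pos Real.pi_pos] at this
  -- The constant 7 only has to exceed $2\pi$.
  nlinarith [Real.pi_lt_d2, abs_nonneg r]

theorem four_mul_norm_le (θ : UnitAddCircle) : 4 * ‖θ‖ ≤ ‖e θ - 1‖ := by
  obtain ⟨r, rfl, hr⟩ := exists_coe_eq θ
  rw [norm_e_coe_sub_one, ← hr]
  have h1 : |r| ≤ 1 / 2 := by
    rw [hr]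
    simpa using AddCircle.norm_le_half_period (p := (1 : ℝ)) (x := (r : UnitAddCircle)) one_ne_zero
  have h2 := Real.mul_abs_le_abs_sin (x := Real.pi * r) (by
    rw [abs_mul, abs_of_pos Real.pi_pos]
    nlinarith [Real.pi_pos])
  rw [abs_mul, abs_of_pos Real.pi_pos] at h2
  have : 2 / Real.pi * (Real.pi * |r|) = 2 * |r| := by
    field_simp
  linarith

theorem norm_e_sub_e_le (a b : UnitAddCircle) : ‖e a - e b‖ ≤ 7 * ‖a - b‖ := by
  have : e a - e b = e b * (e (a - b) - 1) := by
    rw [mul_sub, ← e_add]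
    simp
  rw [this, norm_mul, norm_e, one_mul]
  exact norm_e_sub_one_le _

theorem norm_zsmul_le_abs (n : ℤ) (θ : UnitAddCircle) : ‖n • θ‖ ≤ |(n : ℝ)| * ‖θ‖ := by
  simpa [Int.norm_eq_abs] using norm_zsmul_le (n := n) (a := θ)

/-! ### Difference functions -/

theorem diffFun_comm (a b : ℤ) (f : ℤ → ℂ) :
    diffFun a (diffFun b f) = diffFun b (diffFun a f) := by
  funext x
  simp only [diffFun, map_mul, Complex.conj_conj, add_right_comm x a b]
  ring

theorem iterDiffFun_diffFun (m : ℕ) (h : Fin m → ℤ) (a : ℤ) (f : ℤ → ℂ) :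
    iterDiffFun m h (diffFun a f) = diffFun a (iterDiffFun m h f) := by
  induction m with
  | zero => rfl
  | succ m ih => simp only [iterDiffFun, ih, diffFun_comm a]

theorem iterDiffFun_cons (m : ℕ) (a : ℤ) (h : Fin m → ℤ) (f : ℤ → ℂ) :
    iterDiffFun (m + 1) (Fin.cons a h : Fin (m + 1) → ℤ) f = iterDiffFun m h (diffFun a f) := by
  rw [iterDiffFun_diffFun]
  simp [iterDiffFun]

theorem iterDiffFun_translate (m : ℕ) (h : Fin m → ℤ) (f : ℤ → ℂ) (a : ℤ) :
    iterDiffFun m h (fun z => f (z + a)) = fun z => iterDiffFun m h f (z + a) := by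
  induction m with
  | zero => rfl
  | succ m ih =>
    funext z
    simp only [iterDiffFun, ih, diffFun, add_right_comm z a]

theorem iterDiffFun_mul (m : ℕ) (h : Fin m → ℤ) (f g : ℤ → ℂ) :
    iterDiffFun m h (fun z => f z * g z) = fun z => iterDiffFun m h f z * iterDiffFun m h g z := by
  induction m with
  | zero => rfl
  | succ m ih =>
    funext z
    simp only [iterDiffFun, ih, diffFun, map_mul]
    ring

theorem norm_diffFun_le {f : ℤ → ℂ} (hf : ∀ y, ‖f y‖ ≤ 1) (k : ℤ) (y : ℤ) :
    ‖diffFun k f y‖ ≤ 1 := by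
  rw [diffFun, norm_mul, RCLike.norm_conj]
  exact mul_le_one₀ (hf _) (norm_nonneg _) (hf _)

theorem norm_iterDiffFun_le {f : ℤ → ℂ} (hf : ∀ y, ‖f y‖ ≤ 1) (m : ℕ) (h : Fin m → ℤ) (y : ℤ) :
    ‖iterDiffFun m h f y‖ ≤ 1 := by
  induction m generalizing y with
  | zero => exact hf y
  | succ m ih => exact norm_diffFun_le (ih _) _ _

theorem iterDiffFun_eq_zero {f : ℤ → ℂ} {y : ℤ} (hf : f y = 0) (m : ℕ) (h : Fin m → ℤ) :
    iterDiffFun m h f y = 0 := by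
  induction m with
  | zero => exact hf
  | succ m ih => simp [iterDiffFun, diffFun, ih]

theorem iterDiffFun_eq_zero_of_add {f : ℤ → ℂ} {m : ℕ} {h : Fin m → ℤ} {y : ℤ} (i : Fin m)
    (hf : f (y + h i) = 0) : iterDiffFun m h f y = 0 := by
  induction m with
  | zero => exact i.elim0
  | succ m ih =>
    revert hf
    refine Fin.cases ?_ (fun i => ?_) i
    · intro hf
      simp [iterDiffFun, diffFun, iterDiffFun_eq_zero hf]
    · intro hf
      simp [iterDiffFun, diffFun, ih (h := Fin.tail h) i hf]

/-! ### Major arcs -/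

/-- `θ` lies in a major arc: some `q ≤ K` satisfies `‖q θ‖ ≤ K / N²`. -/
def IsMajor (K : ℝ) (N : ℕ) (θ : UnitAddCircle) : Prop :=
  ∃ q : ℕ, 1 ≤ q ∧ (q : ℝ) ≤ K ∧ ‖q • θ‖ ≤ K / (N : ℝ) ^ 2

theorem IsMajor.mono {K K' : ℝ} {N : ℕ} {θ : UnitAddCircle} (h : IsMajor K N θ) (hK : K ≤ K') :
    IsMajor K' N θ := by
  obtain ⟨q, h1, h2, h3⟩ := h
  exact ⟨q, h1, h2.trans hK, h3.trans (by gcongr)⟩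

/-- Since $q(2\theta)=(2q)\theta$, only the denominator doubles. -/
theorem IsMajor.of_two_zsmul {K : ℝ} {N : ℕ} {θ : UnitAddCircle} (hK : 0 ≤ K)
    (h : IsMajor K N ((2 : ℤ) • θ)) : IsMajor (2 * K) N θ := by
  obtain ⟨q, h1, h2, h3⟩ := h
  refine ⟨q * 2, by omega, by push_cast; linarith, ?_⟩
  rw [mul_nsmul']
  refine le_trans ?_ (h3.trans (by gcongr; linarith))
  rw [ofNat_zsmul]

theorem IsMajor.of_close {K : ℝ} {N : ℕ} {θ θ' : UnitAddCircle} (h : IsMajor K N θ)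
    (hθ : ‖θ - θ'‖ ≤ 1 / (N : ℝ) ^ 2) : IsMajor (2 * K) N θ' := by
  obtain ⟨q, h1, h2, h3⟩ := h
  have h0 : (0 : ℝ) ≤ q := by positivity
  refine ⟨q, h1, by linarith, ?_⟩
  have : q • θ' = q • θ - q • (θ - θ') := by
    rw [← nsmul_sub]
    simp
  rw [this]
  refine (norm_sub_le _ _).trans ?_
  have h4 : ‖q • (θ - θ')‖ ≤ q * ‖θ - θ'‖ := norm_nsmul_le
  have hK : 0 ≤ K := h0.trans h2
  have h5 : (q : ℝ) * ‖θ - θ'‖ ≤ K * (1 / (N : ℝ) ^ 2) := by gcongr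
  calc _ ≤ K / (N : ℝ) ^ 2 + K * (1 / (N : ℝ) ^ 2) := by linarith
    _ = _ := by ring

/-- Counts the blocks of length $r$ that meet $[-2N,2N]$, the block of $h$ being labelled `h / r`.
-/
theorem card_Icc_ediv_le (N r : ℕ) (hr : 0 < r) :
    ((Finset.Icc (-(2 * N : ℤ) / r) (2 * N / r)).card : ℝ) ≤ 4 * N / r + 2 := by
  have hr' : (0 : ℝ) < r := by exact_mod_cast hr
  have h1 : ((2 * N / r : ℤ) : ℝ) ≤ 2 * N / r := by
    rw [le_div_iff₀ hr']
    exact_mod_cast Int.ediv_mul_le (2 * N : ℤ) (by omega : (r : ℤ) ≠ 0)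
  have h2 : -(2 * N / r : ℝ) - 1 ≤ ((-(2 * N : ℤ) / r : ℤ) : ℝ) := by
    have := Int.lt_ediv_add_one_mul_self (-(2 * N) : ℤ) (by omega : (0 : ℤ) < r)
    have h3 : -(2 * N : ℝ) < (((-(2 * N : ℤ) / r : ℤ) : ℝ) + 1) * r := by exact_mod_cast this
    have h4 : -(2 * N : ℝ) / r < (((-(2 * N : ℤ) / r : ℤ) : ℝ) + 1) := by
      rwa [div_lt_iff₀ hr']
    rw [neg_div] at h4
    linarith
  have h5 : (-(2 * N : ℤ) / r) ≤ 2 * N / r :=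
    Int.ediv_le_ediv (by omega) (by omega)
  rw [Int.card_Icc]
  have h6 : (((2 * N / r + 1 - -(2 * N : ℤ) / r).toNat : ℤ) : ℝ)
      = ((2 * N / r : ℤ) : ℝ) + 1 - ((-(2 * N : ℤ) / r : ℤ) : ℝ) := by
    rw [Int.toNat_of_nonneg (by linarith)]
    push_cast
    ring
  rw [Int.cast_natCast] at h6
  rw [h6]
  have : (4 * N / r : ℝ) = 2 * N / r + 2 * N / r := by ring
  linarith

/-- Pigeonhole into blocks of length $r=\lceil 8/\kappa\rceil$: there are at most $\kappa
N/2+2<\kappa N$ of them, so two elements share a block and differ by at most $r-1$. -/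
theorem exists_close_pair {N : ℕ} {κ : ℝ} (hκ : 0 < κ) (hκ' : κ ≤ 1 / 2)
    (hN : 4 * κ⁻¹ < N) (S : Finset ℤ) (hS : ∀ h ∈ S, -(2 * N : ℤ) ≤ h ∧ h ≤ 2 * N)
    (hcard : κ * N ≤ S.card) :
    ∃ a ∈ S, ∃ b ∈ S, ∃ q : ℕ, 1 ≤ q ∧ (q : ℝ) ≤ 8 * κ⁻¹ ∧ b = a + q := by
  have hK : 2 ≤ κ⁻¹ := by
    rw [le_inv_comm₀ (by norm_num) hκ]; linarith
  have hκK : κ * κ⁻¹ = 1 := mul_inv_cancel₀ hκ.ne'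
  set r : ℕ := ⌈8 * κ⁻¹⌉₊ with hr
  have hr1 : 8 * κ⁻¹ ≤ r := Nat.le_ceil _
  have hr2 : (r : ℝ) < 8 * κ⁻¹ + 1 := Nat.ceil_lt_add_one (by positivity)
  have hr0 : (0 : ℝ) < r := by linarith
  have hr0' : 0 < r := by exact_mod_cast hr0
  have hlt : (Finset.Icc (-(2 * N : ℤ) / r) (2 * N / r)).card < S.card := by
    have h1 := card_Icc_ediv_le N r hr0'
    have h2 : (4 * N / r : ℝ) ≤ κ * N / 2 := by
      rw [div_le_iff₀ hr0]
      have : κ * N * (8 * κ⁻¹) ≤ κ * N * r := by gcongr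
      nlinarith
    have h3 : 4 < κ * N := by
      have := mul_lt_mul_of_pos_left hN hκ
      nlinarith
    have : ((Finset.Icc (-(2 * N : ℤ) / r) (2 * N / r)).card : ℝ) < S.card := by linarith
    exact_mod_cast this
  obtain ⟨a, ha, b, hb, hab, heq⟩ := Finset.exists_ne_map_eq_of_card_lt_of_maps_to hlt
    (f := fun h => h / (r : ℤ)) (fun h hh => by
      rw [Finset.mem_coe, Finset.mem_Icc]
      exact ⟨Int.ediv_le_ediv (by omega) (hS h hh).1, Int.ediv_le_ediv (by omega) (hS h hh).2⟩)
  have key : ∀ a ∈ S, ∀ b ∈ S, a < b → a / (r : ℤ) = b / (r : ℤ) →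
      ∃ a ∈ S, ∃ b ∈ S, ∃ q : ℕ, 1 ≤ q ∧ (q : ℝ) ≤ 8 * κ⁻¹ ∧ b = a + q := by
    intro a ha b hb hlt heq
    refine ⟨a, ha, b, hb, (b - a).toNat, by omega, ?_, by omega⟩
    have h1 := Int.emod_add_mul_ediv a r
    have h2 := Int.emod_add_mul_ediv b r
    have h3 := Int.emod_nonneg a (by omega : (r : ℤ) ≠ 0)
    have h4 := Int.emod_lt_of_pos b (by omega : (0 : ℤ) < r)
    rw [heq] at h1
    have h5 : (b - a).toNat + 1 ≤ r := by omega
    have h6 : (((b - a).toNat : ℝ)) + 1 ≤ r := by exact_mod_cast h5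
    linarith
  rcases lt_or_gt_of_ne hab with h | h
  · exact key a ha b hb h heq
  · exact key b hb a ha h heq.symm

/-- An arithmetic progression with difference `q`, long and contained in a short interval, whose
end points lie in a given dense set. -/
theorem exists_progression {N : ℕ} {κ : ℝ} (hκ : 0 < κ) (hκ' : κ ≤ 1 / 2)
    {q : ℕ} (hq : 1 ≤ q) (hN : 16 * κ⁻¹ ≤ N) (hN' : 130 * κ⁻¹ ^ 2 * q ≤ N)
    (S : Finset ℤ) (hS : ∀ h ∈ S, -(2 * N : ℤ) ≤ h ∧ h ≤ 2 * N) (hcard : κ * N ≤ S.card) :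
    ∃ a ∈ S, ∃ b ∈ S, ∃ j : ℕ, b = a + q * j ∧ (N : ℝ) ≤ 130 * κ⁻¹ ^ 2 * q * j ∧
      (q * j : ℝ) ≤ κ * N / 8 := by
  have hK : 2 ≤ κ⁻¹ := by
    rw [le_inv_comm₀ (by norm_num) hκ]; linarith
  have hκK : κ * κ⁻¹ = 1 := mul_inv_cancel₀ hκ.ne'
  have hκN : 16 ≤ κ * N := by
    have := mul_le_mul_of_nonneg_left hN hκ.le
    nlinarith
  have hq0 : (1 : ℝ) ≤ q := by exact_mod_cast hq
  -- The block length caps the span of the progression; the cap $\kappa N/8$ is what later prevents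
  -- wrap-around modulo 1.
  set l : ℕ := ⌊κ * N / 8⌋₊ with hl
  have hl1 : (l : ℝ) ≤ κ * N / 8 := Nat.floor_le (by positivity)
  have hl2 : κ * N / 8 < l + 1 := Nat.lt_floor_add_one _
  have hl3 : κ * N / 16 ≤ l := by linarith
  have hl0 : (0 : ℝ) < l := by linarith
  have hl0' : 0 < l := by exact_mod_cast hl0
  -- Elements are classified by block and by residue modulo $q$. The least and greatest elements of
  -- a populous class are the end points sought, since all its elements lie in one progression
  -- between them.
  set t : Finset (ℤ × ℤ) := Finset.Icc (-(2 * N : ℤ) / l) (2 * N / l) ×ˢ Finset.Ico (0 : ℤ) q with ht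
  have htc : (t.card : ℝ) ≤ 65 * κ⁻¹ * q := by
    rw [ht, Finset.card_product, Int.card_Ico]
    push_cast
    have h1 := card_Icc_ediv_le N l hl0'
    have h2 : (4 * N / l : ℝ) ≤ 64 * κ⁻¹ := by
      rw [div_le_iff₀ hl0]
      have : 64 * κ⁻¹ * (κ * N / 16) ≤ 64 * κ⁻¹ * l := by gcongr
      nlinarith
    have h3 : (((q : ℤ) - 0).toNat : ℝ) = q := by simp
    rw [h3]
    gcongr
    linarith
  have hmap : ∀ h ∈ S, (h / (l : ℤ), h % (q : ℤ)) ∈ t := by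
    intro h hh
    rw [ht, Finset.mem_product, Finset.mem_Icc, Finset.mem_Ico]
    exact ⟨⟨Int.ediv_le_ediv (by omega) (hS h hh).1, Int.ediv_le_ediv (by omega) (hS h hh).2⟩,
      Int.emod_nonneg _ (by omega), Int.emod_lt_of_pos _ (by omega)⟩
  have hSne : S.Nonempty := by
    rw [← Finset.card_pos]
    have : (0 : ℝ) < S.card := by linarith
    exact_mod_cast this
  have htne : t.Nonempty := ⟨_, hmap _ hSne.choose_spec⟩
  set B : ℝ := κ * N / (65 * κ⁻¹ * q) with hB
  obtain ⟨⟨y1, y2⟩, -, hy⟩ := Finset.exists_le_card_fiber_of_nsmul_le_card_of_maps_to hmap htne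
    (b := B) (by
      rw [nsmul_eq_mul]
      refine le_trans ?_ hcard
      calc (t.card : ℝ) * B ≤ (65 * κ⁻¹ * q) * B := by gcongr
        _ = κ * N := by rw [hB]; field_simp)
  set T := S.filter (fun h => (h / (l : ℤ), h % (q : ℤ)) = (y1, y2)) with hT
  have hB2 : 2 ≤ B := by
    rw [hB, le_div_iff₀ (by positivity)]
    have := mul_le_mul_of_nonneg_left hN' hκ.le
    have h2 : κ * (130 * κ⁻¹ ^ 2 * q) = 130 * κ⁻¹ * q := by field_simp
    linarith
  have hTne : T.Nonempty := by
    rw [← Finset.card_pos]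
    have : (0 : ℝ) < T.card := by linarith
    exact_mod_cast this
  have hmem : ∀ h ∈ T, h ∈ S ∧ h / (l : ℤ) = y1 ∧ h % (q : ℤ) = y2 := by
    intro h hh
    rw [hT, Finset.mem_filter, Prod.mk.injEq] at hh
    exact hh
  obtain ⟨haS, ha1, ha2⟩ := hmem _ (T.min'_mem hTne)
  obtain ⟨hbS, hb1, hb2⟩ := hmem _ (T.max'_mem hTne)
  set a := T.min' hTne with hadef
  set b := T.max' hTne with hbdef
  have hab : a ≤ b := T.min'_le _ (T.max'_mem hTne)
  have hdvd : ∀ h ∈ T, ∃ i : ℕ, h = a + q * i := by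
    intro h hh
    have h1 : (q : ℤ) ∣ h - a := by
      refine Int.ModEq.dvd ?_
      rw [Int.ModEq, ha2, (hmem h hh).2.2]
    obtain ⟨i, hi⟩ := h1
    have h2 : a ≤ h := T.min'_le _ hh
    have h3 : 0 ≤ i := by
      by_contra hneg
      push Not at hneg
      nlinarith
    exact ⟨i.toNat, by rw [Int.toNat_of_nonneg h3]; omega⟩
  obtain ⟨j, hj⟩ := hdvd b (T.max'_mem hTne)
  have hTcard : T.card ≤ j + 1 := by
    have hsub : T ⊆ (Finset.range (j + 1)).image (fun i : ℕ => a + q * (i : ℤ)) := by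
      intro h hh
      obtain ⟨i, hi⟩ := hdvd h hh
      rw [Finset.mem_image]
      refine ⟨i, ?_, hi.symm⟩
      have h2 : h ≤ b := T.le_max' _ hh
      rw [Finset.mem_range]
      have h3 : (q : ℤ) * i ≤ q * j := by omega
      have h4 : (i : ℤ) ≤ j := le_of_mul_le_mul_left h3 (by omega)
      omega
    exact (Finset.card_le_card hsub).trans (Finset.card_image_le.trans (by simp))
  refine ⟨a, haS, b, hbS, j, hj, ?_, ?_⟩
  · have h1 : B ≤ (j : ℝ) + 1 := hy.trans (by exact_mod_cast hTcard)
    have h2 : B ≤ 2 * j := by linarith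
    rw [hB, div_le_iff₀ (by positivity)] at h2
    have h3 := mul_le_mul_of_nonneg_left h2 (by positivity : (0 : ℝ) ≤ κ⁻¹)
    have h4 : κ⁻¹ * (κ * N) = N := by field_simp
    rw [h4] at h3
    linarith
  · refine le_trans ?_ hl1
    have h1 := Int.emod_add_mul_ediv a l
    have h2 := Int.emod_add_mul_ediv b l
    have h3 := Int.emod_nonneg a (by omega : (l : ℤ) ≠ 0)
    have h4 := Int.emod_lt_of_pos b (by omega : (0 : ℤ) < l)
    rw [ha1] at h1
    rw [hb1] at h2
    have h5 : (q * j : ℤ) ≤ l := by omega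
    exact_mod_cast h5

/-- If `‖hθ‖` is of order `1 / N` for a positive proportion of the `h = O(N)`, then `θ` lies in a
major arc. -/
theorem isMajor_of_many_small {N : ℕ} {κ : ℝ} (hκ : 0 < κ) (hκ' : κ ≤ 1 / 2)
    (hN : κ⁻¹ ^ 16 < N) (θ : UnitAddCircle) (S : Finset ℤ)
    (hS : ∀ h ∈ S, -(2 * N : ℤ) ≤ h ∧ h ≤ 2 * N) (hcard : κ * N ≤ S.card)
    (hθ : ∀ h ∈ S, ‖h • θ‖ ≤ κ⁻¹ / N) : IsMajor (κ⁻¹ ^ 16) N θ := by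
  have hK : 2 ≤ κ⁻¹ := by
    rw [le_inv_comm₀ (by norm_num) hκ]; linarith
  have hKpow : ∀ k : ℕ, (2 : ℝ) ^ k ≤ κ⁻¹ ^ k := fun k => by gcongr
  set K := κ⁻¹ with hKdef
  have hκK : κ * K = 1 := mul_inv_cancel₀ hκ.ne'
  have hK0 : 0 < K := by linarith
  have hbig : ∀ k : ℕ, ∀ j : ℕ, k + j = 16 → (2 : ℝ) ^ k * K ^ j ≤ K ^ 16 := by
    intro k j hkj
    rw [← hkj, pow_add]
    gcongr
  have hN0 : (0 : ℝ) < N := lt_trans (by positivity) hN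
  have c1 := hbig 15 1 rfl
  have c2 := hbig 13 3 rfl
  have c3 := hbig 12 4 rfl
  norm_num at c1 c2 c3
  obtain ⟨a, ha, b, hb, q, hq1, hq2, hab⟩ := exists_close_pair hκ hκ' (by linarith) S hS hcard
  have hqN : 130 * K ^ 2 * q ≤ N := by
    calc 130 * K ^ 2 * q ≤ 130 * K ^ 2 * (8 * K) := by gcongr
      _ = 1040 * K ^ 3 := by ring
      _ ≤ N := by nlinarith [pow_pos hK0 3]
  obtain ⟨a', ha', b', hb', j, hj, hj1, hj2⟩ :=
    exists_progression hκ hκ' hq1 (by linarith) hqN S hS hcard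
  have hdiff : ∀ a ∈ S, ∀ b ∈ S, ‖(b - a) • θ‖ ≤ 2 * K / N := by
    intro a ha b hb
    rw [sub_smul]
    refine (norm_sub_le (b • θ) (a • θ)).trans ?_
    have := hθ a ha
    have := hθ b hb
    have h2 : 2 * K / N = K / N + K / N := by ring
    linarith
  obtain ⟨r, hr1, hr2⟩ := exists_coe_eq (q • θ)
  have hqθ : |r| ≤ 2 * K / N := by
    rw [hr2]
    have := hdiff a ha b hb
    rwa [hab, add_sub_cancel_left, natCast_zsmul] at this
  -- Here $r$ represents $q\theta$. As $j|r|\le 1/2$, the distance of $jq\theta$ to the nearest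
  -- integer is exactly $j|r|$, so its bound $2K/N$ can be divided by $j$. Since $j\gg N/(K^2q)$
  -- this gains the second factor $1/N$.
  have hjr : |j * r| ≤ 1 / 2 := by
    rw [abs_mul, Nat.abs_cast]
    have hq0 : (1 : ℝ) ≤ q := by exact_mod_cast hq1
    have h1 : (j : ℝ) ≤ κ * N / 8 := by nlinarith [(Nat.cast_nonneg j : (0 : ℝ) ≤ j)]
    calc (j : ℝ) * |r| ≤ (κ * N / 8) * (2 * K / N) := by gcongr
      _ = (κ * K) / 4 := by field_simp; norm_num
      _ ≤ 1 / 2 := by rw [hκK]; norm_num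
  have hjr2 : |j * r| ≤ 2 * K / N := by
    have h1 := (AddCircle.norm_coe_eq_abs_iff (p := (1 : ℝ)) (x := j * r) one_ne_zero).2
      (by simpa using hjr)
    rw [← h1]
    have h2 : ((j * r : ℝ) : UnitAddCircle) = (b' - a') • θ := by
      rw [hj, add_sub_cancel_left, mul_comm (q : ℤ), mul_smul, natCast_zsmul, natCast_zsmul, ← hr1,
        ← nsmul_eq_mul, AddCircle.coe_nsmul]
    rw [h2]
    exact hdiff a' ha' b' hb'
  refine ⟨q, hq1, by linarith, ?_⟩
  rw [← hr2, le_div_iff₀ (by positivity)]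
  rw [abs_mul, Nat.abs_cast, le_div_iff₀ hN0] at hjr2
  calc |r| * (N : ℝ) ^ 2 = (|r| * N) * N := by ring
    _ ≤ (|r| * N) * (130 * K ^ 2 * q * j) := by gcongr
    _ = (130 * K ^ 2 * q) * (j * |r| * N) := by ring
    _ ≤ (130 * K ^ 2 * (8 * K)) * (2 * K) := by gcongr
    _ = 2080 * K ^ 4 := by ring
    _ ≤ K ^ 16 := by nlinarith [pow_pos hK0 4]

/-- A finite net of the major arcs. -/
theorem exists_major_net {K ρ : ℝ} (hK : 2 ≤ K) (hρ : K⁻¹ ≤ ρ) {N : ℕ} (hN : 1 ≤ N) :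
    ∃ A : Finset UnitAddCircle, (A.card : ℝ) ≤ K ^ 7 ∧
      ∀ θ, IsMajor K N θ → ∃ α ∈ A, ‖θ - α‖ ≤ ρ / (N : ℝ) ^ 2 := by
  classical
  have hK0 : 0 < K := by linarith
  have hρ0 : 0 < ρ := lt_of_lt_of_le (by positivity) hρ
  set n : ℕ := ⌊K⌋₊ with hn
  set J : ℕ := ⌈K ^ 2⌉₊ with hJ
  have hn1 : (n : ℝ) ≤ K := Nat.floor_le hK0.le
  have hJ1 : (J : ℝ) ≤ K ^ 2 + 1 := (Nat.ceil_lt_add_one (by positivity)).le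
  -- The net consists of the points $a/q+j\rho/N^2$. A major arc reaches $K/N^2$ from its rational
  -- and the mesh is at least $K^{-1}/N^2$, so $|j|\le\lceil K^2\rceil$ suffices.
  set P : Finset (ℕ × ℤ × ℤ) :=
    Finset.Icc 1 n ×ˢ Finset.Icc (0 : ℤ) n ×ˢ Finset.Icc (-(J : ℤ)) J with hP
  refine ⟨P.image fun p => (((p.2.1 : ℝ) / p.1 + p.2.2 * (ρ / (N : ℝ) ^ 2) : ℝ) : UnitAddCircle),
    ?_, ?_⟩
  · have h1 : (P.card : ℝ) ≤ K * (K + 1) * (2 * (K ^ 2 + 1) + 1) := by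
      rw [hP, Finset.card_product, Finset.card_product, Nat.card_Icc, Int.card_Icc, Int.card_Icc]
      have e1 : ((n : ℤ) + 1 - 0).toNat = n + 1 := by omega
      have e2 : ((J : ℤ) + 1 - -J).toNat = 2 * J + 1 := by omega
      rw [e1, e2, ← mul_assoc]
      push_cast
      gcongr
    refine (Nat.cast_le.2 Finset.card_image_le).trans (h1.trans ?_)
    have h2 : K + 1 ≤ K ^ 2 := by nlinarith
    have h3 : 2 * (K ^ 2 + 1) + 1 ≤ K ^ 4 := by nlinarith [sq_nonneg (K ^ 2 - 4)]
    calc _ ≤ K * K ^ 2 * K ^ 4 := by gcongr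
      _ = K ^ 7 := by ring
  · rintro θ ⟨q, hq1, hq2, hq3⟩
    have hq0 : (1 : ℝ) ≤ q := by exact_mod_cast hq1
    have hN0 : (0 : ℝ) < N := by exact_mod_cast hN
    obtain ⟨t, ht, rfl⟩ : ∃ t : ℝ, t ∈ Set.Ico (0 : ℝ) 1 ∧ (t : UnitAddCircle) = θ := by
      have := (AddCircle.coe_image_Ico_eq (1 : ℝ) 0)
      have h2 : θ ∈ (QuotientAddGroup.mk '' Set.Ico (0 : ℝ) (0 + 1) : Set (AddCircle (1 : ℝ))) := by
        rw [this]; trivial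
      simpa using h2
    rw [← AddCircle.coe_nsmul, UnitAddCircle.norm_eq, nsmul_eq_mul] at hq3
    set a := round (q * t) with ha
    have ha0 : 0 ≤ a := by
      rw [ha, round_eq, Int.floor_nonneg]
      have := ht.1
      positivity
    have ha1 : a ≤ n := by
      have h1 : a ≤ q := by
        have : round (q * t) ≤ round ((q : ℝ)) := by
          rw [round_eq, round_eq]
          apply Int.floor_mono
          have : q * t ≤ q * 1 := by gcongr; exact ht.2.le
          linarith
        rwa [round_natCast] at this
      have h2 : q ≤ n := Nat.le_floor hq2
      omega
    set γ : ℝ := (q * t - a) / q with hγ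
    have hγ1 : |γ| ≤ K / (N : ℝ) ^ 2 := by
      rw [hγ, abs_div, Nat.abs_cast]
      exact (div_le_self (abs_nonneg _) hq0).trans hq3
    set j := round (γ / (ρ / (N : ℝ) ^ 2)) with hj
    have hjabs : |(j : ℝ) - γ / (ρ / (N : ℝ) ^ 2)| ≤ 1 / 2 := by
      rw [abs_sub_comm]
      exact abs_sub_round _
    have hγ2 : |γ / (ρ / (N : ℝ) ^ 2)| ≤ K ^ 2 := by
      rw [abs_div, abs_of_pos (by positivity : 0 < ρ / (N : ℝ) ^ 2), div_le_iff₀ (by positivity)]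
      refine hγ1.trans ?_
      rw [← mul_div_assoc]
      gcongr
      have : K ^ 2 * K⁻¹ ≤ K ^ 2 * ρ := by gcongr
      have h2 : K ^ 2 * K⁻¹ = K := by field_simp
      linarith
    have hjJ : |j| ≤ (J : ℤ) := by
      have h1 : K ^ 2 ≤ J := Nat.le_ceil _
      have h2 : |(j : ℝ)| ≤ J + 1 / 2 := by
        have := abs_sub_abs_le_abs_sub (j : ℝ) (γ / (ρ / (N : ℝ) ^ 2))
        linarith
      have h3 : ((|j| : ℤ) : ℝ) < ((J + 1 : ℤ) : ℝ) := by push_cast; linarith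
      have h4 : |j| < J + 1 := by exact_mod_cast h3
      omega
    refine ⟨_, Finset.mem_image.2 ⟨(q, a, j), ?_, rfl⟩, ?_⟩
    · rw [hP, Finset.mem_product, Finset.mem_product, Finset.mem_Icc, Finset.mem_Icc,
        Finset.mem_Icc]
      have := abs_le.1 hjJ
      exact ⟨⟨hq1, Nat.le_floor hq2⟩, ⟨ha0, ha1⟩, this.1, this.2⟩
    · rw [← AddCircle.coe_sub]
      have h1 : t - (a / q + j * (ρ / (N : ℝ) ^ 2)) = γ - j * (ρ / (N : ℝ) ^ 2) := by
        rw [hγ]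
        field_simp
        ring
      have h2 : |t - (a / q + j * (ρ / (N : ℝ) ^ 2))| ≤ ρ / (N : ℝ) ^ 2 := by
        rw [h1]
        have h3 : γ - j * (ρ / (N : ℝ) ^ 2) =
            -((j - γ / (ρ / (N : ℝ) ^ 2)) * (ρ / (N : ℝ) ^ 2)) := by
          field_simp
          ring
        have hpos : 0 < ρ / (N : ℝ) ^ 2 := by positivity
        rw [h3, abs_neg, abs_mul, abs_of_pos hpos]
        nlinarith
      refine le_trans ?_ h2
      rw [UnitAddCircle.norm_eq]
      simpa using round_le (t - (a / q + j * (ρ / (N : ℝ) ^ 2))) 0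

/-! ### The Fejér kernel -/

/-- The unnormalised Fejér kernel `(1 - |d| / N)₊`. -/
noncomputable def hat (N : ℕ) (d : ℤ) : ℝ := max (1 - |(d : ℝ)| / (N : ℝ)) 0

theorem fejer_eq (N : ℕ) (d : ℤ) : fejer N d = 1 / (N : ℝ) * hat N d := rfl

theorem hat_nonneg (N : ℕ) (d : ℤ) : 0 ≤ hat N d := le_max_right _ _

theorem hat_le_one (N : ℕ) (d : ℤ) : hat N d ≤ 1 :=
  max_le (sub_le_self _ (by positivity)) zero_le_one

theorem abs_hat_le_one (N : ℕ) (d : ℤ) : |hat N d| ≤ 1 := by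
  rw [abs_of_nonneg (hat_nonneg N d)]
  exact hat_le_one N d

theorem hat_eq_zero {N : ℕ} (hN : 1 ≤ N) {d : ℤ} (hd : (N : ℤ) ≤ |d|) : hat N d = 0 := by
  have hN0 : (0 : ℝ) < N := by exact_mod_cast hN
  refine max_eq_right ?_
  rw [sub_nonpos, le_div_iff₀ hN0, one_mul]
  exact_mod_cast hd

theorem abs_hat_sub_le (N : ℕ) (c d : ℤ) : |hat N c - hat N d| ≤ |(c : ℝ) - d| / N := by
  refine (abs_max_sub_max_le_abs _ _ _).trans ?_
  have : 1 - |(c : ℝ)| / N - (1 - |(d : ℝ)| / N) = (|(d : ℝ)| - |(c : ℝ)|) / N := by ring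
  rw [this, abs_div, Nat.abs_cast, abs_sub_comm (c : ℝ)]
  exact div_le_div_of_nonneg_right (abs_abs_sub_abs_le (d : ℝ) c) (by positivity)

theorem sum_Icc_neg_abs (n : ℕ) : ∑ d ∈ Finset.Icc (-(n : ℤ)) n, |d| = n * (n + 1) := by
  induction n with
  | zero => simp
  | succ n ih =>
    have h : Finset.Icc (-((n + 1 : ℕ) : ℤ)) (n + 1 : ℕ) =
        insert (-((n + 1 : ℕ) : ℤ)) (insert ((n + 1 : ℕ) : ℤ) (Finset.Icc (-(n : ℤ)) n)) := by
      ext x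
      simp only [Finset.mem_Icc, Finset.mem_insert]
      omega
    rw [h, Finset.sum_insert, Finset.sum_insert, ih]
    · rw [abs_neg, Nat.abs_cast]
      push_cast
      ring
    · simp only [Finset.mem_Icc]
      omega
    · simp only [Finset.mem_Icc, Finset.mem_insert]
      omega

theorem sum_hat {N : ℕ} (hN : 1 ≤ N) : ∑ d ∈ Finset.Icc (-(N : ℤ)) N, hat N d = N := by
  have hN0 : (0 : ℝ) < N := by exact_mod_cast hN
  have h1 : ∀ d ∈ Finset.Icc (-(N : ℤ)) N, hat N d = 1 - |(d : ℝ)| / N := by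
    intro d hd
    refine max_eq_left ?_
    rw [sub_nonneg, div_le_one hN0]
    have : |d| ≤ N := abs_le.2 (Finset.mem_Icc.1 hd)
    exact_mod_cast this
  rw [Finset.sum_congr rfl h1, Finset.sum_sub_distrib, ← Finset.sum_div]
  have h2 : ∑ d ∈ Finset.Icc (-(N : ℤ)) N, |(d : ℝ)| = N * (N + 1) := by
    exact_mod_cast congrArg (Int.cast : ℤ → ℝ) (sum_Icc_neg_abs N)
  rw [h2, Finset.sum_const, Int.card_Icc]
  have h3 : ((N : ℤ) + 1 - -N).toNat = 2 * N + 1 := by omega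
  rw [h3]
  field_simp
  simp
  ring

theorem sum_fejer {N : ℕ} (hN : 1 ≤ N) : ∑ d ∈ Finset.Icc (-(N : ℤ)) N, fejer N d = 1 := by
  have hN0 : (0 : ℝ) < N := by exact_mod_cast hN
  simp only [fejer_eq]
  rw [← Finset.mul_sum, sum_hat hN]
  field_simp

theorem fejer_nonneg (N : ℕ) (d : ℤ) : 0 ≤ fejer N d := by
  rw [fejer_eq]
  exact mul_nonneg (by positivity) (hat_nonneg N d)

theorem norm_sum_fejer_mul_le {N : ℕ} (hN : 1 ≤ N) (u : ℤ → ℂ) {B : ℝ}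
    (hu : ∀ d ∈ Finset.Icc (-(N : ℤ)) N, ‖u d‖ ≤ B) :
    ‖∑ d ∈ Finset.Icc (-(N : ℤ)) N, (fejer N d : ℂ) * u d‖ ≤ B := by
  calc _ ≤ ∑ d ∈ Finset.Icc (-(N : ℤ)) N, fejer N d * B := by
        refine (norm_sum_le _ _).trans (Finset.sum_le_sum fun d hd => ?_)
        rw [norm_mul, Complex.norm_real, Real.norm_eq_abs, abs_of_nonneg (fejer_nonneg N d)]
        exact mul_le_mul_of_nonneg_left (hu d hd) (fejer_nonneg N d)
    _ = B := by rw [← Finset.sum_mul, sum_fejer hN, one_mul]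

/-! ### Exponential sums -/

theorem sum_Icc_shift {A : Type*} [AddCommMonoid A] (F : ℤ → A) (a b c : ℤ) :
    ∑ z ∈ Finset.Icc a b, F (z + c) = ∑ z ∈ Finset.Icc (a + c) (b + c), F z := by
  refine Finset.sum_bij' (fun z _ => z + c) (fun z _ => z - c) ?_ ?_ ?_ ?_ ?_ <;>
    simp only [Finset.mem_Icc, implies_true, add_sub_cancel_right, sub_add_cancel] <;> omega

/-- Linear exponential sums with a Lipschitz weight. -/
theorem norm_sum_lipschitz_le (w : ℤ → ℝ) {a b : ℤ} (hab : a ≤ b) {Λ : ℝ}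
    (hw : ∀ z, z ∉ Finset.Icc a b → w z = 0) (hΛ : ∀ z, |w (z - 1) - w z| ≤ Λ)
    (θ : UnitAddCircle) :
    ‖∑ z ∈ Finset.Icc a b, (w z : ℂ) * e (z • θ)‖ * (4 * ‖θ‖) ≤ Λ * (b - a + 2) := by
  -- Summation by parts. Because the weight vanishes off $[a,b]$ there are no boundary terms, at the
  -- price of one more summand at $b+1$.
  have h1 : (∑ z ∈ Finset.Icc a b, (w z : ℂ) * e (z • θ)) * (e θ - 1) =
      ∑ z ∈ Finset.Icc a (b + 1), ((w (z - 1) - w z : ℝ) : ℂ) * e (z • θ) := by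
    have h2 : ∑ z ∈ Finset.Icc a (b + 1), (w z : ℂ) * e (z • θ) =
        ∑ z ∈ Finset.Icc a b, (w z : ℂ) * e (z • θ) := by
      symm
      refine Finset.sum_subset (Finset.Icc_subset_Icc_right (by omega)) fun z _ hz => ?_
      simp [hw z hz]
    have h3 : ∑ z ∈ Finset.Icc a (b + 1), (w (z - 1) : ℂ) * e (z • θ) =
        ∑ z ∈ Finset.Icc a b, (w z : ℂ) * e ((z + 1) • θ) := by
      have h4 := sum_Icc_shift (fun z => (w (z - 1) : ℂ) * e (z • θ)) a b 1
      simp only [add_sub_cancel_right] at h4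
      rw [h4]
      symm
      refine Finset.sum_subset (Finset.Icc_subset_Icc_left (by omega)) fun z hz hz' => ?_
      rw [hw (z - 1), Complex.ofReal_zero, zero_mul]
      rw [Finset.mem_Icc] at hz hz' ⊢
      omega
    simp only [Complex.ofReal_sub, sub_mul]
    rw [Finset.sum_sub_distrib, h2, h3, mul_sub, mul_one, Finset.sum_mul]
    congr 1
    refine Finset.sum_congr rfl fun z _ => ?_
    rw [add_smul, one_smul, e_add, mul_assoc]
  have h5 : ‖∑ z ∈ Finset.Icc a (b + 1), ((w (z - 1) - w z : ℝ) : ℂ) * e (z • θ)‖ ≤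
      Λ * (b - a + 2) := by
    refine (norm_sum_le _ _).trans ?_
    calc _ ≤ ∑ z ∈ Finset.Icc a (b + 1), Λ := by
          refine Finset.sum_le_sum fun z _ => ?_
          rw [norm_mul, norm_e, mul_one, Complex.norm_real]
          exact hΛ z
      _ = Λ * (b - a + 2) := by
          rw [Finset.sum_const, Int.card_Icc, nsmul_eq_mul]
          have : ((b + 1 + 1 - a).toNat : ℝ) = ((b + 1 + 1 - a : ℤ) : ℝ) := by
            rw [← Int.cast_natCast, Int.toNat_of_nonneg (by omega)]
          rw [this]
          push_cast
          ring
  rw [← h1, norm_mul] at h5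
  refine le_trans ?_ h5
  gcongr
  exact four_mul_norm_le θ

/-- Keeps weights Lipschitz when two bounded Lipschitz weights are multiplied. -/
theorem abs_mul_sub_mul_le {u v u' v' A B : ℝ} (hu : |u| ≤ 1) (hv' : |v'| ≤ 1)
    (h1 : |u - u'| ≤ A) (h2 : |v - v'| ≤ B) : |u * v - u' * v'| ≤ A + B := by
  have : u * v - u' * v' = u * (v - v') + (u - u') * v' := by ring
  rw [this]
  refine (abs_add_le _ _).trans ?_
  rw [abs_mul, abs_mul]
  have := mul_le_mul hu h2 (abs_nonneg _) zero_le_one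
  have := mul_le_mul h1 hv' (abs_nonneg _) ((abs_nonneg _).trans h1)
  linarith

theorem inv_pow_le_of_le {η : ℝ} (hη : 0 < η) (hη' : η ≤ 1 / 2) {a b : ℕ} (hab : a ≤ b) :
    η⁻¹ ^ a ≤ η⁻¹ ^ b := by
  have : 1 ≤ η⁻¹ := by
    rw [one_le_inv₀ hη]; linarith
  exact pow_le_pow_right₀ this hab

theorem two_mul_inv_pow_le {η : ℝ} (hη : 0 < η) (hη' : η ≤ 1 / 2) (a : ℕ) :
    2 * η⁻¹ ^ a ≤ η⁻¹ ^ (a + 1) := by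
  have : 2 ≤ η⁻¹ := by
    rw [le_inv_comm₀ (by norm_num) hη]; linarith
  rw [pow_succ, mul_comm]
  gcongr

/-- Weyl differencing for a quadratic phase with a Lipschitz weight. -/
theorem norm_sq_quadratic_le {N : ℕ} (w : ℤ → ℝ) {a b : ℤ} (hab' : b - a ≤ 2 * N)
    (hw : ∀ z, z ∉ Finset.Icc a b → w z = 0) (θ β γ : UnitAddCircle) :
    ‖∑ z ∈ Finset.Icc a b, (w z : ℂ) * e (z ^ 2 • θ + z • β + γ)‖ ^ 2 ≤
      ∑ h ∈ Finset.Icc (-(2 * N : ℤ)) (2 * N),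
        ‖∑ z ∈ Finset.Icc a b, ((w z * w (z + h) : ℝ) : ℂ) * e (z • ((-2 * h) • θ))‖ := by
  set f : ℤ → ℂ := fun z => (w z : ℂ) * e (z ^ 2 • θ + z • β + γ) with hf
  have h1 : ((‖∑ z ∈ Finset.Icc a b, f z‖ ^ 2 : ℝ) : ℂ) =
      ∑ h ∈ Finset.Icc (-(2 * N : ℤ)) (2 * N), ∑ z ∈ Finset.Icc a b, f z * conj (f (z + h)) := by
    rw [norm_sum_sq_eq, Finset.sum_comm (s := Finset.Icc (-(2 * N : ℤ)) (2 * N))]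
    refine Finset.sum_congr rfl fun z hz => ?_
    simp only [add_comm z]
    rw [sum_Icc_shift (fun y => f z * conj (f y))]
    refine Finset.sum_subset ?_ fun y _ hy => ?_
    · rw [Finset.mem_Icc] at hz
      exact Finset.Icc_subset_Icc (by omega) (by omega)
    · simp [hf, hw y hy]
  have h2 : ∀ h, ‖∑ z ∈ Finset.Icc a b, f z * conj (f (z + h))‖ =
      ‖∑ z ∈ Finset.Icc a b, ((w z * w (z + h) : ℝ) : ℂ) * e (z • ((-2 * h) • θ))‖ := by
    intro h
    -- Differencing cancels $\gamma$, and $\beta$ survives only in a unimodular factor free of $z$;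
    -- the remaining phase is linear with frequency $-2h\theta$.
    have : ∀ z, f z * conj (f (z + h)) = e (-(h ^ 2 • θ + h • β)) *
        (((w z * w (z + h) : ℝ) : ℂ) * e (z • ((-2 * h) • θ))) := by
      intro z
      simp only [hf, map_mul, Complex.conj_ofReal]
      rw [← e_neg]
      push_cast
      have h3 : e (z ^ 2 • θ + z • β + γ) * e (-((z + h) ^ 2 • θ + (z + h) • β + γ)) =
          e (-(h ^ 2 • θ + h • β)) * e (z • (-2 * h) • θ) := by
        rw [← e_add, ← e_add]
        congr 1
        module
      linear_combination (w z * w (z + h) : ℂ) * h3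
    simp only [this]
    rw [← Finset.mul_sum, norm_mul, norm_e, one_mul]
  calc _ = ‖((‖∑ z ∈ Finset.Icc a b, f z‖ ^ 2 : ℝ) : ℂ)‖ := by
        rw [Complex.norm_real, Real.norm_of_nonneg (by positivity)]
    _ ≤ _ := by
        rw [h1]
        refine (norm_sum_le _ _).trans (Finset.sum_le_sum fun h _ => (h2 h).le)

/-- A large quadratic exponential sum with a Lipschitz weight has its leading coefficient in a
major arc. -/
theorem isMajor_of_large_quadratic {N : ℕ} (hN1 : 1 ≤ N) {ε : ℝ} (hε : 0 < ε) (hε' : ε ≤ 1 / 2)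
    (hN : ε⁻¹ ^ 208 < N) (w : ℤ → ℝ) {a b : ℤ} (hab : a ≤ b) (hab' : b - a ≤ 2 * N)
    (hw : ∀ z, z ∉ Finset.Icc a b → w z = 0) (hw1 : ∀ z, |w z| ≤ 1)
    (hΛ : ∀ z, |w (z - 1) - w z| ≤ 2 / N) (θ β γ : UnitAddCircle)
    (h : ε * N ≤ ‖∑ z ∈ Finset.Icc a b, (w z : ℂ) * e (z ^ 2 • θ + z • β + γ)‖) :
    IsMajor (ε⁻¹ ^ 209) N θ := by
  have hN0 : (1 : ℝ) ≤ N := by exact_mod_cast hN1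
  have hE : ε * ε⁻¹ = 1 := mul_inv_cancel₀ hε.ne'
  set G : ℤ → ℝ := fun h =>
    ‖∑ z ∈ Finset.Icc a b, ((w z * w (z + h) : ℝ) : ℂ) * e (z • ((-2 * h) • θ))‖ with hG
  set A := Finset.Icc (-(2 * N : ℤ)) (2 * N) with hA
  have hAc : (A.card : ℝ) = 4 * N + 1 := by
    rw [hA, Int.card_Icc]
    have : ((2 * N : ℤ) + 1 - -(2 * N)).toNat = 4 * N + 1 := by omega
    rw [this]
    push_cast
    ring
  have hb1 : ((b : ℝ) - a) ≤ 2 * N := by exact_mod_cast hab'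
  have hGB : ∀ h ∈ A, G h ≤ 3 * N := by
    intro h _
    refine (norm_sum_le _ _).trans ?_
    calc _ ≤ ∑ z ∈ Finset.Icc a b, (1 : ℝ) := by
          refine Finset.sum_le_sum fun z _ => ?_
          rw [norm_mul, norm_e, mul_one, Complex.norm_real, Real.norm_eq_abs, abs_mul]
          exact mul_le_one₀ (hw1 _) (abs_nonneg _) (hw1 _)
      _ ≤ 3 * N := by
          rw [Finset.sum_const, Int.card_Icc, nsmul_eq_mul, mul_one]
          have : ((b + 1 - a).toNat : ℝ) = ((b + 1 - a : ℤ) : ℝ) := by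
            rw [← Int.cast_natCast, Int.toNat_of_nonneg (by omega)]
          rw [this]
          push_cast
          linarith
  -- Four spare powers of $\varepsilon\le 1/2$ pay for $(4N+1)\cdot 3N\le 15N^2$.
  have hsum : ε ^ 6 * A.card * (3 * N) ≤ ∑ h ∈ A, G h := by
    refine le_trans ?_ (norm_sq_quadratic_le w hab' hw θ β γ)
    have h1 : (ε * N) ^ 2 ≤ ‖∑ z ∈ Finset.Icc a b, (w z : ℂ) * e (z ^ 2 • θ + z • β + γ)‖ ^ 2 := by
      gcongr
    refine le_trans ?_ h1
    have h2 : ε ^ 4 ≤ (1 / 2) ^ 4 := by gcongr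
    rw [hAc]
    calc ε ^ 6 * (4 * N + 1) * (3 * N) = ε ^ 4 * (ε ^ 2 * ((4 * N + 1) * (3 * N))) := by ring
      _ ≤ (1 / 2) ^ 4 * (ε ^ 2 * ((5 * N) * (3 * N))) := by gcongr; linarith
      _ ≤ (ε * N) ^ 2 := by nlinarith [sq_nonneg (ε * N)]
  have hpop := card_popular A G (by positivity : (0 : ℝ) < 3 * N) (pow_pos hε 6)
    ((pow_le_of_le_one hε.le (by linarith) (by norm_num)).trans hε') hGB hsum
  set S := A.filter fun h => (ε ^ 6) ^ 2 * (3 * N) ≤ G h with hS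
  -- For a popular $h$ the differenced sum is at least $3\varepsilon^{12}N$, while its weight has
  -- Lipschitz constant $4/N$; the linear bound then makes $\|2h\theta\|$ of order $1/N$.
  have hsmall : ∀ h ∈ S, ‖h • ((2 : ℤ) • θ)‖ ≤ (ε ^ 13)⁻¹ / N := by
    intro h hh
    have hGh : (ε ^ 6) ^ 2 * (3 * N) ≤ G h := (Finset.mem_filter.1 hh).2
    have key := norm_sum_lipschitz_le (fun z => w z * w (z + h)) hab (Λ := 2 / N + 2 / N)
      (fun z hz => by simp [hw z hz])
      (fun z => abs_mul_sub_mul_le (hw1 _) (hw1 _) (hΛ z) (by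
        have := hΛ (z + h)
        rwa [add_sub_right_comm] at this)) ((-2 * h) • θ)
    have hnorm : ‖(-2 * h) • θ‖ = ‖h • ((2 : ℤ) • θ)‖ := by
      rw [← norm_neg]
      congr 1
      module
    rw [hnorm] at key
    have h3 : (2 / N + 2 / N : ℝ) * (b - a + 2) ≤ 16 := by
      have : (2 / N + 2 / N : ℝ) * (b - a + 2) ≤ (2 / N + 2 / N : ℝ) * (4 * N) := by
        gcongr
        linarith
      refine this.trans (le_of_eq ?_)
      field_simp
      norm_num
    have h4 : (ε ^ 6) ^ 2 * (3 * N) * (4 * ‖h • ((2 : ℤ) • θ)‖) ≤ 16 :=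
      (mul_le_mul_of_nonneg_right hGh (by positivity)).trans (key.trans h3)
    rw [le_div_iff₀ (by positivity), inv_eq_one_div, le_div_iff₀ (by positivity)]
    have h5 : 0 ≤ ‖h • ((2 : ℤ) • θ)‖ * N * ε ^ 12 := by positivity
    calc ‖h • ((2 : ℤ) • θ)‖ * N * ε ^ 13 = (‖h • ((2 : ℤ) • θ)‖ * N * ε ^ 12) * ε := by ring
      _ ≤ (‖h • ((2 : ℤ) • θ)‖ * N * ε ^ 12) * (1 / 2) := by gcongr
      _ ≤ 1 := by nlinarith
  have hcard : ε ^ 13 * N ≤ S.card := by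
    refine le_trans ?_ hpop
    rw [hAc]
    calc ε ^ 13 * (N : ℝ) = ε ^ 12 * (ε * N) := by ring
      _ ≤ ε ^ 12 * (4 * N + 1) := by gcongr; nlinarith
      _ = _ := by ring
  -- With density $\varepsilon^{13}$ the exponent is $13\cdot 16=208$; passing from $2\theta$ to
  -- $\theta$ uses one more power.
  have hmaj := isMajor_of_many_small (pow_pos hε 13)
    ((pow_le_of_le_one hε.le (by linarith) (by norm_num)).trans hε')
    (by rw [← inv_pow, ← pow_mul]; exact hN) ((2 : ℤ) • θ) S
    (fun h hh => by
      have := Finset.mem_Icc.1 (Finset.mem_filter.1 hh).1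
      exact this) hcard hsmall
  rw [← inv_pow, ← pow_mul] at hmaj
  have hle := two_mul_inv_pow_le hε hε' 208
  exact (hmaj.of_two_zsmul (by positivity)).mono hle

/-! ### Major arc information for a phase varying with `x` -/

/-- The correlation of the quadratic phases attached to two points. -/
noncomputable def pairSum (N : ℕ) (φ : ℤ → UnitAddCircle) (x x' : ℤ) : ℂ :=
  ∑ z ∈ Finset.Icc (-(N : ℤ)) (2 * N), ((hat N (z - x) * hat N (z - x') : ℝ) : ℂ) *
    e ((z - x) ^ 2 • φ x - (z - x') ^ 2 • φ x')

/-- Substituting $z=x+d$ gives a range of summation common to all $x$; the added terms vanish with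
the kernel. -/
theorem sum_hat_shift {N : ℕ} (hN : 1 ≤ N) {x : ℤ} (hx : x ∈ Finset.Icc (1 : ℤ) N) {A : Type*}
    [AddCommMonoid A] (F : ℤ → A) (hF : ∀ d, hat N d = 0 → F d = 0) :
    ∑ d ∈ Finset.Icc (-(N : ℤ)) N, F d = ∑ z ∈ Finset.Icc (-(N : ℤ)) (2 * N), F (z - x) := by
  simp only [sub_eq_add_neg _ x]
  rw [sum_Icc_shift]
  rw [Finset.mem_Icc] at hx
  refine Finset.sum_subset (Finset.Icc_subset_Icc (by omega) (by omega)) fun d _ hd => hF d ?_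
  refine hat_eq_zero hN ?_
  rw [Finset.mem_Icc, ← abs_le, not_le] at hd
  exact hd.le

theorem norm_pairSum_le {N : ℕ} (hN : 1 ≤ N) (φ : ℤ → UnitAddCircle) {x : ℤ}
    (hx : x ∈ Finset.Icc (1 : ℤ) N) (x' : ℤ) : ‖pairSum N φ x x'‖ ≤ N := by
  calc _ ≤ ∑ z ∈ Finset.Icc (-(N : ℤ)) (2 * N), hat N (z - x) := by
        refine (norm_sum_le _ _).trans (Finset.sum_le_sum fun z _ => ?_)
        rw [norm_mul, norm_e, mul_one, Complex.norm_real,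
          Real.norm_of_nonneg (mul_nonneg (hat_nonneg _ _) (hat_nonneg _ _))]
        exact mul_le_of_le_one_right (hat_nonneg _ _) (hat_le_one _ _)
    _ = N := by
        rw [← sum_hat_shift hN hx (fun d => hat N d) fun _ h => h, sum_hat hN]

/-- In the variable $z=x+d$ the factor $g(z)$ does not depend on $x$. After rotating each inner sum
to its modulus and exchanging sums, Cauchy–Schwarz in $z$ removes $g$, and the square over $x$ opens
into the pair sums. -/
theorem card_large_pairSum {N : ℕ} (hN : 1 ≤ N) {η : ℝ} (hη : 0 < η) (hη' : η ≤ 1 / 2)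
    (X : Finset ℤ) (hX : X ⊆ Finset.Icc (1 : ℤ) N) (g : ℤ → ℂ) (hg : ∀ z, ‖g z‖ ≤ 1)
    (φ : ℤ → UnitAddCircle)
    (h : η * X.card ≤ ∑ x ∈ X,
      ‖∑ d ∈ Finset.Icc (-(N : ℤ)) N, (fejer N d : ℂ) * g (x + d) * e (d ^ 2 • φ x)‖) :
    η ^ 8 * (X.card : ℝ) ^ 2 ≤
      ((X ×ˢ X).filter fun p => η ^ 8 * N ≤ ‖pairSum N φ p.1 p.2‖).card := by
  have hN0 : (1 : ℝ) ≤ N := by exact_mod_cast hN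
  set T : ℤ → ℂ := fun x => ∑ d ∈ Finset.Icc (-(N : ℤ)) N,
    (fejer N d : ℂ) * g (x + d) * e (d ^ 2 • φ x) with hT
  choose c hc1 hc2 using fun x => exists_phase (T x)
  set Y : ℤ → ℂ := fun z => ∑ x ∈ X, c x * (hat N (z - x) : ℂ) * e ((z - x) ^ 2 • φ x) with hY
  have hTx : ∀ x ∈ X, (N : ℂ) * T x = ∑ z ∈ Finset.Icc (-(N : ℤ)) (2 * N),
      (hat N (z - x) : ℂ) * g z * e ((z - x) ^ 2 • φ x) := by
    intro x hx
    have h1 := sum_hat_shift hN (hX hx) (fun d => (hat N d : ℂ) * g (x + d) * e (d ^ 2 • φ x))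
      (fun d hd => by simp [hd])
    simp only [add_sub_cancel] at h1
    rw [← h1, hT, Finset.mul_sum]
    refine Finset.sum_congr rfl fun d _ => ?_
    rw [fejer_eq]
    have : (N : ℂ) ≠ 0 := by exact_mod_cast (by linarith : (N : ℝ) ≠ 0)
    push_cast
    field_simp
  have h1 : (((N : ℝ) * ∑ x ∈ X, ‖T x‖ : ℝ) : ℂ) = ∑ z ∈ Finset.Icc (-(N : ℤ)) (2 * N), g z * Y z := by
    push_cast
    simp only [← hc2, hY, Finset.mul_sum]
    rw [Finset.sum_comm]
    refine Finset.sum_congr rfl fun x hx => ?_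
    rw [mul_left_comm, hTx x hx, Finset.mul_sum]
    refine Finset.sum_congr rfl fun z _ => ?_
    ring
  have h2 : ((∑ z ∈ Finset.Icc (-(N : ℤ)) (2 * N), ‖Y z‖ ^ 2 : ℝ) : ℂ) =
      ∑ p ∈ X ×ˢ X, c p.1 * conj (c p.2) * pairSum N φ p.1 p.2 := by
    push_cast
    simp_rw [← Complex.ofReal_pow, hY, norm_sum_sq_eq]
    rw [Finset.sum_product, Finset.sum_comm]
    refine Finset.sum_congr rfl fun x _ => ?_
    rw [Finset.sum_comm]
    refine Finset.sum_congr rfl fun x' _ => ?_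
    rw [pairSum, Finset.mul_sum]
    refine Finset.sum_congr rfl fun z _ => ?_
    rw [e_sub, map_mul, map_mul, Complex.conj_ofReal]
    push_cast
    ring
  have h3 : ∑ z ∈ Finset.Icc (-(N : ℤ)) (2 * N), ‖Y z‖ ^ 2 ≤
      ∑ p ∈ X ×ˢ X, ‖pairSum N φ p.1 p.2‖ := by
    calc _ = ‖((∑ z ∈ Finset.Icc (-(N : ℤ)) (2 * N), ‖Y z‖ ^ 2 : ℝ) : ℂ)‖ := by
          rw [Complex.norm_real, Real.norm_of_nonneg (by positivity)]
      _ ≤ _ := by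
          rw [h2]
          refine (norm_sum_le _ _).trans (Finset.sum_le_sum fun p _ => ?_)
          rw [norm_mul, norm_mul, RCLike.norm_conj, hc1, hc1, one_mul, one_mul]
  have hcard : ((Finset.Icc (-(N : ℤ)) (2 * N)).card : ℝ) ≤ 4 * N := by
    rw [Int.card_Icc]
    have : ((2 * N : ℤ) + 1 - -N).toNat = 3 * N + 1 := by omega
    rw [this]
    push_cast
    linarith
  have h4 : ((N : ℝ) * ∑ x ∈ X, ‖T x‖) ^ 2 ≤ 4 * N * ∑ p ∈ X ×ˢ X, ‖pairSum N φ p.1 p.2‖ := by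
    have h5 := norm_sum_mul_sq_le (Finset.Icc (-(N : ℤ)) (2 * N)) g Y hg
    rw [← h1, Complex.norm_real, Real.norm_of_nonneg (by positivity)] at h5
    exact h5.trans (mul_le_mul hcard h3 (by positivity) (by positivity))
  have h6 : η ^ 4 * (X ×ˢ X).card * N ≤ ∑ p ∈ X ×ˢ X, ‖pairSum N φ p.1 p.2‖ := by
    have h7 : ((N : ℝ) * (η * X.card)) ^ 2 ≤ ((N : ℝ) * ∑ x ∈ X, ‖T x‖) ^ 2 := by gcongr
    have h8 := h7.trans h4
    have h9 : η ^ 2 ≤ (1 / 2) ^ 2 := by gcongr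
    rw [Finset.card_product]
    push_cast
    refine le_of_mul_le_mul_left ?_ (by positivity : (0 : ℝ) < 4 * N)
    refine le_trans ?_ h8
    calc 4 * N * (η ^ 4 * (X.card * X.card) * N)
        = η ^ 2 * (4 * (N * (η * X.card)) ^ 2) := by ring
      _ ≤ (1 / 2) ^ 2 * (4 * (N * (η * X.card)) ^ 2) := by gcongr
      _ = _ := by ring
  have h10 := card_popular (X ×ˢ X) (fun p => ‖pairSum N φ p.1 p.2‖) (by linarith) (pow_pos hη 4)
    ((pow_le_of_le_one hη.le (by linarith) (by norm_num)).trans hη')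
    (fun p hp => norm_pairSum_le hN φ (hX (Finset.mem_product.1 hp).1) p.2) h6
  rw [← pow_mul, Finset.card_product] at h10
  push_cast at h10
  rwa [← pow_two] at h10

theorem exists_fiber_of_card_product {X : Finset ℤ} (hX : X.Nonempty) (P : ℤ → ℤ → Prop)
    [DecidableRel P] {c : ℝ}
    (h : c * (X.card : ℝ) ^ 2 ≤ ((X ×ˢ X).filter fun p => P p.1 p.2).card) :
    ∃ x' ∈ X, c * X.card ≤ (X.filter fun x => P x x').card := by
  by_contra hcon
  push Not at hcon
  have h1 : (((X ×ˢ X).filter fun p => P p.1 p.2).card : ℝ) =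
      ∑ x' ∈ X, ((X.filter fun x => P x x').card : ℝ) := by
    simp only [Finset.card_filter]
    rw [Finset.sum_product_right]
    push_cast
    rfl
  have h2 := Finset.sum_lt_sum_of_nonempty hX hcon
  rw [Finset.sum_const, nsmul_eq_mul] at h2
  rw [h1] at h
  nlinarith

theorem exists_slice {N : ℕ} (hN : 1 ≤ N) (X : Finset ℤ) (G : ℤ → ℤ → ℝ) {η : ℝ}
    (h : ∀ x ∈ X, η * (N : ℝ) ^ 2 ≤ ∑ y ∈ Finset.Icc (1 : ℤ) (N ^ 2), G x y) :
    ∃ y, η * X.card ≤ ∑ x ∈ X, G x y := by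
  have hc : (Finset.Icc (1 : ℤ) (N ^ 2)).card = N ^ 2 := by
    rw [Int.card_Icc]
    have : ((N : ℤ) ^ 2 + 1 - 1) = ((N ^ 2 : ℕ) : ℤ) := by push_cast; ring
    rw [this, Int.toNat_natCast]
  have hne : (Finset.Icc (1 : ℤ) (N ^ 2)).Nonempty := by
    rw [← Finset.card_pos, hc]
    positivity
  by_contra hcon
  push Not at hcon
  have h1 := Finset.sum_lt_sum_of_nonempty hne fun y _ => hcon y
  rw [Finset.sum_const, hc, Finset.sum_comm, nsmul_eq_mul] at h1
  have h2 := Finset.sum_le_sum h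
  rw [Finset.sum_const, nsmul_eq_mul] at h2
  push_cast at h1
  nlinarith

theorem abs_hat_shift_sub_le (N : ℕ) (x z : ℤ) : |hat N (z - 1 - x) - hat N (z - x)| ≤ 1 / N := by
  refine (abs_hat_sub_le N _ _).trans (le_of_eq ?_)
  push_cast
  congr 1
  rw [show (z : ℝ) - 1 - x - (z - x) = -1 by ring]
  norm_num

theorem abs_hat_mul_sub_le (N : ℕ) (x x' z : ℤ) :
    |hat N (z - 1 - x) * hat N (z - 1 - x') - hat N (z - x) * hat N (z - x')| ≤ 2 / N := by
  refine (abs_mul_sub_mul_le (abs_hat_le_one _ _) (abs_hat_le_one _ _) (abs_hat_shift_sub_le N x z)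
    (abs_hat_shift_sub_le N x' z)).trans (le_of_eq ?_)
  ring

theorem pairSum_eq {N : ℕ} (hN : 1 ≤ N) (φ : ℤ → UnitAddCircle) {x : ℤ}
    (hx : x ∈ Finset.Icc (1 : ℤ) N) (x' : ℤ) :
    pairSum N φ x x' = ∑ z ∈ Finset.Icc (x - N) (x + N),
      ((hat N (z - x) * hat N (z - x') : ℝ) : ℂ) * e ((z - x) ^ 2 • φ x - (z - x') ^ 2 • φ x') := by
  symm
  rw [Finset.mem_Icc] at hx
  refine Finset.sum_subset (Finset.Icc_subset_Icc (by omega) (by omega)) fun z _ hz => ?_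
  rw [hat_eq_zero hN, zero_mul, Complex.ofReal_zero, zero_mul]
  rw [Finset.mem_Icc] at hz
  by_contra hcon
  push Not at hcon
  rw [abs_lt] at hcon
  omega

/-- As a polynomial in $z$ the phase of the pair sum has leading coefficient
$\varphi(x)-\varphi(x')$. -/
theorem isMajor_sub_of_large_pairSum {N : ℕ} (hN1 : 1 ≤ N) {ε : ℝ} (hε : 0 < ε) (hε' : ε ≤ 1 / 2)
    (hN : ε⁻¹ ^ 208 < N) (φ : ℤ → UnitAddCircle) {x : ℤ} (hx : x ∈ Finset.Icc (1 : ℤ) N) (x' : ℤ)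
    (h : ε * N ≤ ‖pairSum N φ x x'‖) : IsMajor (ε⁻¹ ^ 209) N (φ x - φ x') := by
  rw [pairSum_eq hN1 φ hx] at h
  refine isMajor_of_large_quadratic hN1 hε hε' hN (fun z => hat N (z - x) * hat N (z - x'))
    (a := x - N) (b := x + N) (by omega) (by omega) ?_ ?_ (abs_hat_mul_sub_le N x x') _
    ((-2 * x) • φ x - (-2 * x') • φ x') (x ^ 2 • φ x - x' ^ 2 • φ x') ?_
  · intro z hz
    rw [hat_eq_zero hN1, zero_mul]
    rw [Finset.mem_Icc] at hz
    by_contra hcon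
    push Not at hcon
    rw [abs_lt] at hcon
    omega
  · intro z
    rw [abs_mul]
    exact mul_le_one₀ (abs_hat_le_one _ _) (abs_nonneg _) (abs_hat_le_one _ _)
  · refine h.trans (le_of_eq ?_)
    congr 1
    refine Finset.sum_congr rfl fun z _ => ?_
    congr 2
    module

/-- For a constant phase the $z^2$ terms cancel and the pair sum is linear, of frequency
$-2(x-x')\varphi$. -/
theorem norm_le_of_large_pairSum_const {N : ℕ} (hN : 1 ≤ N) {ε : ℝ} (hε : 0 < ε)
    (φ : UnitAddCircle) {x : ℤ} (hx : x ∈ Finset.Icc (1 : ℤ) N) (x' : ℤ)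
    (h : ε * N ≤ ‖pairSum N (fun _ => φ) x x'‖) :
    ‖(x - x') • ((2 : ℤ) • φ)‖ ≤ 2 * ε⁻¹ / N := by
  have hN0 : (1 : ℝ) ≤ N := by exact_mod_cast hN
  have h1 : ‖pairSum N (fun _ => φ) x x'‖ = ‖∑ z ∈ Finset.Icc (x - N) (x + N),
      ((hat N (z - x) * hat N (z - x') : ℝ) : ℂ) * e (z • ((-2 * (x - x')) • φ))‖ := by
    rw [pairSum_eq hN _ hx]
    have : ∀ z : ℤ, e ((z - x) ^ 2 • φ - (z - x') ^ 2 • φ) =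
        e ((x ^ 2 - x' ^ 2) • φ) * e (z • ((-2 * (x - x')) • φ)) := by
      intro z
      rw [← e_add]
      congr 1
      module
    simp only [this, mul_left_comm _ (e ((x ^ 2 - x' ^ 2) • φ))]
    rw [← Finset.mul_sum, norm_mul, norm_e, one_mul]
  have h2 := norm_sum_lipschitz_le (fun z => hat N (z - x) * hat N (z - x'))
    (a := x - N) (b := x + N) (by omega) (fun z hz => by
      rw [hat_eq_zero hN, zero_mul]
      rw [Finset.mem_Icc] at hz
      by_contra hcon
      push Not at hcon
      rw [abs_lt] at hcon
      omega) (abs_hat_mul_sub_le N x x') ((-2 * (x - x')) • φ)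
  have hnorm : ‖(-2 * (x - x')) • φ‖ = ‖(x - x') • ((2 : ℤ) • φ)‖ := by
    rw [← norm_neg]
    congr 1
    module
  rw [← h1, hnorm] at h2
  have h3 : (2 / N : ℝ) * (((x + N : ℤ) : ℝ) - ((x - N : ℤ) : ℝ) + 2) ≤ 8 := by
    push_cast
    calc (2 / N : ℝ) * (x + N - (x - N) + 2) ≤ (2 / N : ℝ) * (4 * N) := by
          gcongr
          linarith
      _ = 8 := by field_simp; norm_num
  have h4 : ε * N * (4 * ‖(x - x') • ((2 : ℤ) • φ)‖) ≤ 8 :=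
    (mul_le_mul_of_nonneg_right h (by positivity)).trans (h2.trans h3)
  rw [le_div_iff₀ (by linarith), mul_comm 2, inv_mul_eq_div, le_div_iff₀ hε]
  linarith

theorem pow_le_half {η : ℝ} (hη : 0 < η) (hη' : η ≤ 1 / 2) {k : ℕ} (hk : k ≠ 0) :
    η ^ k ≤ 1 / 2 :=
  (pow_le_of_le_one hη.le (by linarith) hk).trans hη'

theorem pow_anti {η : ℝ} (hη : 0 < η) (hη' : η ≤ 1 / 2) {a b : ℕ} (hab : a ≤ b) :
    η ^ b ≤ η ^ a :=
  pow_le_pow_of_le_one hη.le (by linarith) hab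

/-- Pigeonhole for a map into a finite net. -/
theorem exists_large_fiber {ι κ : Type*} [DecidableEq κ] (Y : Finset ι) (A : Finset κ) (f : ι → κ)
    (hf : ∀ i ∈ Y, f i ∈ A) {K : ℝ} (hK : 0 < K) (hA : (A.card : ℝ) ≤ K) (hY : Y.Nonempty) :
    ∃ α ∈ A, K⁻¹ * Y.card ≤ (Y.filter fun i => f i = α).card := by
  obtain ⟨i, hi⟩ := hY
  refine Finset.exists_le_card_fiber_of_nsmul_le_card_of_maps_to hf ⟨_, hf i hi⟩ ?_
  rw [nsmul_eq_mul, ← mul_assoc]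
  have : A.card * K⁻¹ ≤ 1 := by
    rw [← div_eq_mul_inv, div_le_one hK]
    exact hA
  exact mul_le_of_le_one_left (by positivity) this

/-- The phases are almost constant on a large set of `x`. -/
theorem exists_almost_constant {N : ℕ} (hN : 1 ≤ N) {η : ℝ} (hη : 0 < η) (hη' : η ≤ 1 / 2)
    {a : ℕ} (ha : a = 8 * 209) (hNη : η⁻¹ ^ a < N)
    (X : Finset ℤ) (hX : X ⊆ Finset.Icc (1 : ℤ) N) (hXne : X.Nonempty)
    (g : ℤ → ℂ) (hg : ∀ z, ‖g z‖ ≤ 1) (φ : ℤ → UnitAddCircle)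
    (h : η * X.card ≤ ∑ x ∈ X,
      ‖∑ d ∈ Finset.Icc (-(N : ℤ)) N, (fejer N d : ℂ) * g (x + d) * e (d ^ 2 • φ x)‖) :
    ∃ φ₀, ∃ X' ⊆ X, η ^ (8 + a * 7) * X.card ≤ X'.card ∧
      ∀ x ∈ X', ‖φ x - φ₀‖ ≤ η ^ 4 / (N : ℝ) ^ 2 := by
  classical
  have h1 := card_large_pairSum hN hη hη' X hX g hg φ h
  -- With $x'$ fixed, each remaining $\varphi(x)$ is the constant $\varphi(x')$ plus a point of a
  -- major arc, hence near one of few points.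
  obtain ⟨x', hx', h2⟩ := exists_fiber_of_card_product hXne
    (fun x x' => η ^ 8 * N ≤ ‖pairSum N φ x x'‖) h1
  set Y := X.filter fun x => η ^ 8 * N ≤ ‖pairSum N φ x x'‖ with hY
  have hYmaj : ∀ x ∈ Y, IsMajor (η⁻¹ ^ a) N (φ x - φ x') := by
    intro x hx
    have hx1 := Finset.mem_filter.1 hx
    have := isMajor_sub_of_large_pairSum hN (pow_pos hη 8) (pow_le_half hη hη' (by norm_num))
      (lt_of_le_of_lt (by
        rw [← inv_pow, ← pow_mul, ha]
        exact inv_pow_le_of_le hη hη' (by norm_num)) hNη) φ (hX hx1.1) x' hx1.2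
    rwa [← inv_pow, ← pow_mul, ← ha] at this
  have hK2 : 2 ≤ η⁻¹ ^ a := by
    have h3 : 2 * η⁻¹ ^ 0 ≤ η⁻¹ ^ a :=
      (two_mul_inv_pow_le hη hη' 0).trans (inv_pow_le_of_le hη hη' (by omega))
    simpa using h3
  -- The mesh $\eta^4/N^2$ is fine enough for $e(d^2\varphi)$, $|d|\le N$, to change by at most
  -- $7\eta^4$, which is less than $\eta$.
  obtain ⟨A, hA, hA'⟩ := exists_major_net (ρ := η ^ 4) hK2
    (by rw [← inv_pow, inv_inv]; exact pow_anti hη hη' (by omega)) hN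
  have hXpos : (0 : ℝ) < X.card := by exact_mod_cast hXne.card_pos
  have hYne : Y.Nonempty := by
    rw [← Finset.card_pos]
    have : (0 : ℝ) < Y.card := lt_of_lt_of_le (by positivity) h2
    exact_mod_cast this
  have hex : ∀ x, ∃ α, x ∈ Y → α ∈ A ∧ ‖φ x - φ x' - α‖ ≤ η ^ 4 / (N : ℝ) ^ 2 := by
    intro x
    by_cases hx : x ∈ Y
    · obtain ⟨α, h3, h4⟩ := hA' _ (hYmaj x hx)
      exact ⟨α, fun _ => ⟨h3, h4⟩⟩
    · exact ⟨0, fun h => absurd h hx⟩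
  choose f hf using hex
  obtain ⟨α, -, hα⟩ := exists_large_fiber Y A f (fun x hx => (hf x hx).1)
    (by positivity : (0 : ℝ) < (η⁻¹ ^ a) ^ 7) hA hYne
  refine ⟨φ x' + α, Y.filter fun x => f x = α, (Finset.filter_subset _ _).trans
    (Finset.filter_subset _ _), ?_, ?_⟩
  · refine le_trans ?_ hα
    calc η ^ (8 + a * 7) * (X.card : ℝ) = ((η⁻¹ ^ a) ^ 7)⁻¹ * (η ^ 8 * X.card) := by
          rw [← inv_pow, ← inv_pow, inv_inv]
          ring
      _ ≤ _ := by gcongr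
  · intro x hx
    obtain ⟨h3, h4⟩ := Finset.mem_filter.1 hx
    have := (hf x h3).2
    rwa [h4, sub_sub] at this

/-- A constant phase with large correlations lies in a major arc. -/
theorem isMajor_of_constant {N : ℕ} (hN : 1 ≤ N) {η : ℝ} (hη : 0 < η) (hη' : η ≤ 1 / 2)
    (hNη : η⁻¹ ^ 144 < N) (X : Finset ℤ) (hX : X ⊆ Finset.Icc (1 : ℤ) N)
    (hXc : η * N ≤ X.card) (g : ℤ → ℂ) (hg : ∀ z, ‖g z‖ ≤ 1) (φ : UnitAddCircle)
    (h : η * X.card ≤ ∑ x ∈ X,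
      ‖∑ d ∈ Finset.Icc (-(N : ℤ)) N, (fejer N d : ℂ) * g (x + d) * e (d ^ 2 • φ)‖) :
    IsMajor (η⁻¹ ^ 145) N φ := by
  classical
  have hN0 : (1 : ℝ) ≤ N := by exact_mod_cast hN
  have hXne : X.Nonempty := by
    rw [← Finset.card_pos]
    have : (0 : ℝ) < X.card := lt_of_lt_of_le (by positivity) hXc
    exact_mod_cast this
  have h1 := card_large_pairSum hN hη hη' X hX g hg (fun _ => φ) h
  obtain ⟨x', hx', h2⟩ := exists_fiber_of_card_product hXne
    (fun x x' => η ^ 8 * N ≤ ‖pairSum N (fun _ => φ) x x'‖) h1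
  set Y := X.filter fun x => η ^ 8 * N ≤ ‖pairSum N (fun _ => φ) x x'‖ with hY
  -- As $x'$ is fixed, the differences $x-x'$ are as numerous as the $x$, and each makes
  -- $(x-x')\cdot 2\varphi$ small modulo 1.
  set S := Y.image fun x => x - x' with hS
  have hSc : S.card = Y.card := Finset.card_image_of_injective _ sub_left_injective
  have hmaj := isMajor_of_many_small (N := N) (pow_pos hη 9) (pow_le_half hη hη' (by norm_num))
    (by rw [← inv_pow, ← pow_mul]; exact hNη) ((2 : ℤ) • φ) S ?_ ?_ ?_
  · rw [← inv_pow, ← pow_mul] at hmaj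
    exact (hmaj.of_two_zsmul (by positivity)).mono (two_mul_inv_pow_le hη hη' 144)
  · intro d hd
    obtain ⟨x, hx, rfl⟩ := Finset.mem_image.1 hd
    have h3 := Finset.mem_Icc.1 (hX (Finset.mem_filter.1 hx).1)
    have h4 := Finset.mem_Icc.1 (hX hx')
    constructor <;> omega
  · rw [hSc]
    refine le_trans ?_ h2
    calc η ^ 9 * (N : ℝ) = η ^ 8 * (η * N) := by ring
      _ ≤ _ := by gcongr
  · intro d hd
    obtain ⟨x, hx, rfl⟩ := Finset.mem_image.1 hd
    have hx1 := Finset.mem_filter.1 hx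
    refine (norm_le_of_large_pairSum_const hN (pow_pos hη 8) φ (hX hx1.1) x' hx1.2).trans ?_
    gcongr
    rw [← inv_pow, ← inv_pow]
    have hle := two_mul_inv_pow_le hη hη' 8
    exact hle

/-- The phases `φ x` for which `f (x + ·, y)` correlates with `e (φ x d²)` lie in major arcs for
many `x`. -/
theorem exists_many_major : ∃ k : ℕ, ∀ (N : ℕ), 1 ≤ N → ∀ (η : ℝ), 0 < η → η ≤ 1 / 2 →
    ∀ (X : Finset ℤ), X ⊆ Finset.Icc (1 : ℤ) N → η * N ≤ X.card →
    ∀ (g : ℤ → ℤ → ℂ), (∀ x y, ‖g x y‖ ≤ 1) → ∀ (φ : ℤ → UnitAddCircle),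
    (∀ x ∈ X, η * (N : ℝ) ^ 2 ≤ ∑ y ∈ Finset.Icc (1 : ℤ) (N ^ 2),
      ‖∑ d ∈ Finset.Icc (-(N : ℤ)) N, (fejer N d : ℂ) * g (x + d) y * e (d ^ 2 • φ x)‖) →
    (N : ℝ) ≤ η⁻¹ ^ k ∨ ∃ X' ⊆ X, η ^ k * N ≤ X'.card ∧ ∀ x ∈ X', IsMajor (η⁻¹ ^ k) N (φ x) := by
  obtain ⟨a, ha⟩ : ∃ a : ℕ, a = 8 * 209 := ⟨_, rfl⟩
  refine ⟨(9 + a * 7) * 145 + 1, fun N hN η hη hη' X hX hXc g hg φ h => ?_⟩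
  rw [or_iff_not_imp_left, not_le]
  intro hNη
  have hN0 : (1 : ℝ) ≤ N := by exact_mod_cast hN
  have hXne : X.Nonempty := by
    rw [← Finset.card_pos]
    have : (0 : ℝ) < X.card := lt_of_lt_of_le (by positivity) hXc
    exact_mod_cast this
  obtain ⟨y, hy⟩ := exists_slice hN X _ h
  obtain ⟨φ₀, X', hX', hX'c, hφ₀⟩ := exists_almost_constant hN hη hη' ha
    (lt_of_le_of_lt (inv_pow_le_of_le hη hη' (by omega)) hNη) X hX hXne (fun z => g z y)
    (fun z => hg z y) φ hy
  have hη2 : η ^ (9 + a * 7) * N ≤ X'.card := by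
    refine le_trans ?_ hX'c
    calc η ^ (9 + a * 7) * (N : ℝ) = η ^ (8 + a * 7) * (η * N) := by ring
      _ ≤ _ := by gcongr
  have hconst : ∀ x ∈ X', η ^ (9 + a * 7) * (N : ℝ) ^ 2 ≤ ∑ y ∈ Finset.Icc (1 : ℤ) (N ^ 2),
      ‖∑ d ∈ Finset.Icc (-(N : ℤ)) N, (fejer N d : ℂ) * g (x + d) y * e (d ^ 2 • φ₀)‖ := by
    intro x hx
    have h1 := h x (hX' hx)
    have h2 : ∀ y, ‖∑ d ∈ Finset.Icc (-(N : ℤ)) N, (fejer N d : ℂ) * g (x + d) y * e (d ^ 2 • φ x)‖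
        ≤ ‖∑ d ∈ Finset.Icc (-(N : ℤ)) N, (fejer N d : ℂ) * g (x + d) y * e (d ^ 2 • φ₀)‖
          + 7 * η ^ 4 := by
      intro y
      have h3 : ‖∑ d ∈ Finset.Icc (-(N : ℤ)) N,
          (fejer N d : ℂ) * (g (x + d) y * (e (d ^ 2 • φ x) - e (d ^ 2 • φ₀)))‖ ≤ 7 * η ^ 4 := by
        refine norm_sum_fejer_mul_le hN _ fun d hd => ?_
        rw [norm_mul]
        refine (mul_le_of_le_one_left (norm_nonneg _) (hg _ _)).trans ?_
        refine (norm_e_sub_e_le _ _).trans ?_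
        rw [← smul_sub]
        have h4 := norm_zsmul_le_abs (d ^ 2) (φ x - φ₀)
        have h5 : |((d ^ 2 : ℤ) : ℝ)| ≤ (N : ℝ) ^ 2 := by
          have h6 : |(d : ℝ)| ≤ N := by
            have : |d| ≤ N := abs_le.2 (Finset.mem_Icc.1 hd)
            exact_mod_cast this
          push_cast
          rw [abs_pow]
          gcongr
        have h7 : |((d ^ 2 : ℤ) : ℝ)| * ‖φ x - φ₀‖ ≤ (N : ℝ) ^ 2 * (η ^ 4 / (N : ℝ) ^ 2) := by
          gcongr
          exact hφ₀ x hx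
        have h8 : (N : ℝ) ^ 2 * (η ^ 4 / (N : ℝ) ^ 2) = η ^ 4 := by field_simp
        linarith
      have h9 : ∑ d ∈ Finset.Icc (-(N : ℤ)) N, (fejer N d : ℂ) * g (x + d) y * e (d ^ 2 • φ x) =
          ∑ d ∈ Finset.Icc (-(N : ℤ)) N, (fejer N d : ℂ) * g (x + d) y * e (d ^ 2 • φ₀) +
          ∑ d ∈ Finset.Icc (-(N : ℤ)) N,
            (fejer N d : ℂ) * (g (x + d) y * (e (d ^ 2 • φ x) - e (d ^ 2 • φ₀))) := by
        rw [← Finset.sum_add_distrib]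
        refine Finset.sum_congr rfl fun d _ => ?_
        ring
      rw [h9]
      exact (norm_add_le _ _).trans (by linarith)
    have h10 := h1.trans (Finset.sum_le_sum fun y _ => h2 y)
    rw [Finset.sum_add_distrib, Finset.sum_const, Int.card_Icc, nsmul_eq_mul] at h10
    have h11 : (((N : ℤ) ^ 2 + 1 - 1).toNat : ℝ) = (N : ℝ) ^ 2 := by
      have : ((N : ℤ) ^ 2 + 1 - 1) = ((N ^ 2 : ℕ) : ℤ) := by push_cast; ring
      rw [this, Int.toNat_natCast]
      push_cast
      rfl
    rw [h11] at h10
    have h12 : η ^ (9 + a * 7) + 7 * η ^ 4 ≤ η := by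
      have h13 : η ^ (9 + a * 7) ≤ η ^ 4 := pow_anti hη hη' (by omega)
      have h14 : η ^ 3 ≤ (1 / 2) ^ 3 := by gcongr
      nlinarith
    nlinarith [sq_nonneg (N : ℝ)]
  -- The slice `y` served to find `X'` and need not have a large average over it. A new slice is
  -- taken, using that the lower bound holds for each $x$ separately.
  obtain ⟨y', hy'⟩ := exists_slice hN X' _ hconst
  have hmaj := isMajor_of_constant hN (pow_pos hη (9 + a * 7)) (pow_le_half hη hη' (by omega))
    (lt_of_le_of_lt (by
      rw [← inv_pow, ← pow_mul]
      exact inv_pow_le_of_le hη hη' (by omega)) hNη) X' (hX'.trans hX) hη2 (fun z => g z y')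
      (fun z => hg z y') φ₀ hy'
  rw [← inv_pow, ← pow_mul] at hmaj
  refine ⟨X', hX', le_trans ?_ hη2, fun x hx => ?_⟩
  · gcongr ?_ * _
    exact pow_anti hη hη' (by omega)
  · refine (hmaj.of_close (θ' := φ x) ?_).mono (two_mul_inv_pow_le hη hη' _)
    rw [norm_sub_rev]
    refine (hφ₀ x hx).trans ?_
    gcongr
    exact pow_le_one₀ hη.le (by linarith)

/-! ### Gowers norms -/

/-- The sum `∑ Δ_{h₁,…,h_{s+1}} f(x)`, that is `‖f‖_{U^{s+1}}^{2^{s+1}}`, in the form of a sum of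
nonnegative real numbers. -/
noncomputable def gowersSum : ℕ → (ℤ → ℂ) → ℝ
  | 0, f => ‖∑' y, f y‖ ^ 2
  | s + 1, f => ∑' k, gowersSum s (diffFun k f)

theorem gowersSum_nonneg (s : ℕ) (f : ℤ → ℂ) : 0 ≤ gowersSum s f := by
  induction s generalizing f with
  | zero => exact sq_nonneg _
  | succ s ih => exact tsum_nonneg fun k => ih _

theorem diffFun_zero_fun (k : ℤ) : diffFun k (fun _ => 0) = fun _ => 0 := by
  funext x
  simp [diffFun]

theorem gowersSum_zero_fun (s : ℕ) : gowersSum s (fun _ => 0) = 0 := by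
  induction s with
  | zero => simp [gowersSum]
  | succ s ih => simp [gowersSum, diffFun_zero_fun, ih]

theorem finite_support_diffFun {f : ℤ → ℂ} (hf : f.support.Finite) (k : ℤ) :
    (diffFun k f).support.Finite :=
  hf.subset fun y hy => by
    rw [Function.mem_support] at hy ⊢
    exact left_ne_zero_of_mul hy

/-- The differences of the support of `f`. -/
def diffSet (f : ℤ → ℂ) : Set ℤ := Set.image2 (fun a b => b - a) f.support f.support

theorem finite_diffSet {f : ℤ → ℂ} (hf : f.support.Finite) : (diffSet f).Finite :=
  hf.image2 _ hf

theorem diffFun_eq_zero_of_notMem {f : ℤ → ℂ} {k : ℤ} (hk : k ∉ diffSet f) :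
    diffFun k f = fun _ => 0 := by
  funext y
  by_contra hy
  rw [diffFun] at hy
  refine hk ⟨y, left_ne_zero_of_mul hy, y + k, ?_, by ring⟩
  have := right_ne_zero_of_mul hy
  rw [Function.mem_support]
  intro h
  exact this (by rw [h, map_zero])

theorem finite_support_gowersSum {f : ℤ → ℂ} (hf : f.support.Finite) (s : ℕ) :
    (fun k => gowersSum s (diffFun k f)).support.Finite := by
  refine (finite_diffSet hf).subset fun k hk => ?_
  by_contra hcon
  rw [Function.mem_support, diffFun_eq_zero_of_notMem hcon, gowersSum_zero_fun] at hk
  exact hk rfl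

theorem summable_gowersSum {f : ℤ → ℂ} (hf : f.support.Finite) (s : ℕ) :
    Summable fun k => gowersSum s (diffFun k f) :=
  summable_of_hasFiniteSupport (finite_support_gowersSum hf s)

theorem gowersSum_translate (s : ℕ) (f : ℤ → ℂ) (a : ℤ) :
    gowersSum s (fun z => f (z + a)) = gowersSum s f := by
  induction s generalizing f with
  | zero =>
    simp only [gowersSum]
    rw [(Equiv.addRight a).tsum_eq f |>.symm]
    rfl
  | succ s ih =>
    simp only [gowersSum]
    refine tsum_congr fun k => ?_
    rw [← ih (diffFun k f)]
    congr 1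
    funext z
    simp only [diffFun, add_right_comm z a]

theorem gowersSum_conj (s : ℕ) (f : ℤ → ℂ) :
    gowersSum s (fun z => conj (f z)) = gowersSum s f := by
  induction s generalizing f with
  | zero =>
    simp only [gowersSum]
    rw [← Complex.conj_tsum, RCLike.norm_conj]
  | succ s ih =>
    simp only [gowersSum]
    refine tsum_congr fun k => ?_
    rw [← ih (diffFun k f)]
    congr 1
    funext z
    simp only [diffFun, map_mul]

theorem finite_support_iterDiffFun {f : ℤ → ℂ} (hf : f.support.Finite) (s : ℕ) :
    (fun p : ℤ × (Fin s → ℤ) => iterDiffFun s p.2 f p.1).support.Finite := by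
  refine (hf.prod (Set.Finite.pi' (ι := Fin s) fun _ => finite_diffSet hf)).subset ?_
  rintro ⟨y, h⟩ hy
  rw [Function.mem_support] at hy
  have h1 : f y ≠ 0 := fun h0 => hy (iterDiffFun_eq_zero h0 s h)
  refine ⟨h1, fun i => ⟨y, h1, y + h i, fun h0 => hy (iterDiffFun_eq_zero_of_add i h0), ?_⟩⟩
  ring

theorem tsum_iterDiffFun_succ {f : ℤ → ℂ} (hf : f.support.Finite) (s : ℕ) :
    ∑' p : ℤ × (Fin (s + 1) → ℤ), iterDiffFun (s + 1) p.2 f p.1 =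
      ∑' k : ℤ, ∑' p : ℤ × (Fin s → ℤ), iterDiffFun s p.2 (diffFun k f) p.1 := by
  let E : ℤ × ℤ × (Fin s → ℤ) ≃ ℤ × (Fin (s + 1) → ℤ) :=
    { toFun := fun p => (p.2.1, Fin.cons p.1 p.2.2)
      invFun := fun p => (p.2 0, p.1, Fin.tail p.2)
      left_inv := fun p => by simp
      right_inv := fun p => by simp }
  have h1 : (fun p : ℤ × ℤ × (Fin s → ℤ) =>
      iterDiffFun (s + 1) (E p).2 f (E p).1).support.Finite := by
    have h2 := (finite_support_iterDiffFun hf (s + 1)).preimage (E.injective.injOn)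
    exact h2
  rw [← E.tsum_eq, (summable_of_hasFiniteSupport h1).tsum_prod]
  refine tsum_congr fun k => tsum_congr fun p => ?_
  exact congrFun (iterDiffFun_cons s k p.2 f) p.1

theorem tsum_tsum_diffFun {f : ℤ → ℂ} (hf : f.support.Finite) :
    ∑' k, ∑' y, diffFun k f y = ((gowersSum 0 f : ℝ) : ℂ) := by
  have h1 : (fun p : ℤ × ℤ => diffFun p.1 f p.2).support.Finite := by
    refine ((finite_diffSet hf).prod hf).subset ?_
    rintro ⟨k, y⟩ hy
    rw [Function.mem_support] at hy
    refine ⟨?_, left_ne_zero_of_mul hy⟩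
    by_contra hk
    exact hy (congrFun (diffFun_eq_zero_of_notMem hk) y)
  have h2 : Summable fun p : ℤ × ℤ => diffFun p.1 f p.2 := summable_of_hasFiniteSupport h1
  rw [← Summable.tsum_comm (f := fun k y => diffFun k f y) h2]
  simp only [diffFun, gowersSum]
  have h3 : ∀ y, ∑' k, f y * conj (f (y + k)) = f y * conj (∑' z, f z) := by
    intro y
    rw [tsum_mul_left, ← Complex.conj_tsum]
    congr 2
    exact (Equiv.addLeft y).tsum_eq f
  simp only [h3]
  rw [tsum_mul_right, Complex.mul_conj']
  push_cast
  rfl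

/-- The induction starts from $\sum_{k,y}f(y)\overline{f(y+k)}=|\sum f|^2$, so index $s$ on the
right corresponds to $U^{s+1}$ and the sum is visibly nonnegative. -/
theorem tsum_iterDiffFun_eq {f : ℤ → ℂ} (hf : f.support.Finite) (s : ℕ) :
    ∑' p : ℤ × (Fin (s + 1) → ℤ), iterDiffFun (s + 1) p.2 f p.1 = ((gowersSum s f : ℝ) : ℂ) := by
  induction s generalizing f with
  | zero =>
    rw [tsum_iterDiffFun_succ hf, ← tsum_tsum_diffFun hf]
    refine tsum_congr fun k => ?_
    rw [← (Equiv.prodUnique ℤ (Fin 0 → ℤ)).tsum_eq]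
    rfl
  | succ s ih =>
    rw [tsum_iterDiffFun_succ hf, gowersSum, Complex.ofReal_tsum]
    exact tsum_congr fun k => ih (finite_support_diffFun hf k)

theorem gowersNorm_pow {f : ℤ → ℂ} (hf : f.support.Finite) (s : ℕ) :
    gowersNorm (s + 1) f ^ 2 ^ (s + 1) = gowersSum s f := by
  rw [gowersNorm, tsum_iterDiffFun_eq hf, Complex.norm_real,
    Real.norm_of_nonneg (gowersSum_nonneg s f), ← Real.rpow_natCast, ← Real.rpow_mul
    (gowersSum_nonneg s f)]
  push_cast
  rw [one_div, inv_mul_cancel₀ (by positivity), Real.rpow_one]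

/-! ### Functions supported on an interval -/

/-- `f` vanishes outside `{1, …, L}` and is bounded by `1`. -/
structure IsBddOn (L : ℕ) (f : ℤ → ℂ) : Prop where
  norm_le : ∀ y, ‖f y‖ ≤ 1
  eq_zero : ∀ y, y ∉ Finset.Icc (1 : ℤ) L → f y = 0

/-- The differences of elements of `{1, …, L}`. -/
noncomputable abbrev diffRange (L : ℕ) : Finset ℤ := Finset.Ioo (-(L : ℤ)) L

theorem card_diffRange (L : ℕ) : (diffRange L).card = 2 * L - 1 := by
  rw [Int.card_Ioo]
  omega

theorem IsBddOn.finite_support {L : ℕ} {f : ℤ → ℂ} (hf : IsBddOn L f) : f.support.Finite :=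
  (Finset.Icc (1 : ℤ) L).finite_toSet.subset fun y hy => by
    by_contra hcon
    exact hy (hf.eq_zero y hcon)

theorem IsBddOn.iterDiffFun {L : ℕ} {f : ℤ → ℂ} (hf : IsBddOn L f) (m : ℕ) (h : Fin m → ℤ) :
    IsBddOn L (iterDiffFun m h f) :=
  ⟨norm_iterDiffFun_le hf.norm_le m h, fun y hy => iterDiffFun_eq_zero (hf.eq_zero y hy) m h⟩

theorem IsBddOn.diffFun {L : ℕ} {f : ℤ → ℂ} (hf : IsBddOn L f) (k : ℤ) :
    IsBddOn L (diffFun k f) :=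
  ⟨norm_diffFun_le hf.norm_le k, fun y hy => by simp [DegreeLowering.diffFun, hf.eq_zero y hy]⟩

theorem IsBddOn.tsum_eq {L : ℕ} {f : ℤ → ℂ} (hf : IsBddOn L f) :
    ∑' y, f y = ∑ y ∈ Finset.Icc (1 : ℤ) L, f y :=
  tsum_eq_sum hf.eq_zero

theorem IsBddOn.diffFun_eq_zero {L : ℕ} {f : ℤ → ℂ} (hf : IsBddOn L f) {k : ℤ}
    (hk : k ∉ diffRange L) : DegreeLowering.diffFun k f = fun _ => 0 := by
  funext y
  rw [DegreeLowering.diffFun]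
  by_cases hy : y ∈ Finset.Icc (1 : ℤ) L
  · rw [hf.eq_zero (y + k), map_zero, mul_zero]
    rw [Finset.mem_Icc] at hy ⊢
    rw [Finset.mem_Ioo] at hk
    omega
  · rw [hf.eq_zero y hy, zero_mul]

theorem IsBddOn.gowersSum_succ {L : ℕ} {f : ℤ → ℂ} (hf : IsBddOn L f) (s : ℕ) :
    gowersSum (s + 1) f = ∑ k ∈ diffRange L, gowersSum s (DegreeLowering.diffFun k f) :=
  tsum_eq_sum fun k hk => by rw [hf.diffFun_eq_zero hk, gowersSum_zero_fun]

theorem IsBddOn.gowersSum_eq_sum_cube {L : ℕ} {f : ℤ → ℂ} (hf : IsBddOn L f) (m : ℕ) :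
    gowersSum (m + 1) f =
      ∑ h ∈ cube m (diffRange L), gowersSum 1 (DegreeLowering.iterDiffFun m h f) := by
  induction m generalizing f with
  | zero => rw [sum_cube_zero]; rfl
  | succ m ih =>
    rw [hf.gowersSum_succ, sum_cube_succ]
    refine Finset.sum_congr rfl fun k _ => ?_
    rw [ih (hf.diffFun k)]
    simp only [iterDiffFun_cons]

theorem IsBddOn.norm_sum_le {L : ℕ} {f : ℤ → ℂ} (hf : IsBddOn L f) (θ : ℤ → UnitAddCircle) :
    ‖∑ y ∈ Finset.Icc (1 : ℤ) L, f y * e (θ y)‖ ≤ L := by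
  refine (_root_.norm_sum_le _ _).trans ?_
  calc _ ≤ ∑ y ∈ Finset.Icc (1 : ℤ) L, (1 : ℝ) := by
        refine Finset.sum_le_sum fun y _ => ?_
        rw [norm_mul, norm_e, mul_one]
        exact hf.norm_le y
    _ = L := by simp

theorem IsBddOn.gowersSum_le {L : ℕ} {f : ℤ → ℂ} (hf : IsBddOn L f) (s : ℕ) :
    gowersSum s f ≤ (2 * L) ^ s * (L : ℝ) ^ 2 := by
  induction s generalizing f with
  | zero =>
    rw [gowersSum, hf.tsum_eq, pow_zero, one_mul]
    have := hf.norm_sum_le fun _ => 0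
    simp only [e_zero, mul_one] at this
    gcongr
  | succ s ih =>
    rw [hf.gowersSum_succ]
    calc _ ≤ ∑ k ∈ diffRange L, ((2 * L) ^ s * (L : ℝ) ^ 2) :=
          Finset.sum_le_sum fun k _ => ih (hf.diffFun k)
      _ = ((diffRange L).card : ℝ) * ((2 * L) ^ s * (L : ℝ) ^ 2) := by
          rw [Finset.sum_const, nsmul_eq_mul]
      _ ≤ (2 * L) * ((2 * L) ^ s * (L : ℝ) ^ 2) := by
          gcongr
          rw [card_diffRange]
          exact_mod_cast Nat.sub_le _ _
      _ = _ := by ring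

theorem isBddOn_intervalIndicator (B : ℕ) : IsBddOn B (intervalIndicator 1 B) := by
  refine ⟨fun y => ?_, fun y hy => ?_⟩
  · rw [intervalIndicator]
    refine (norm_indicator_le_norm_self _ _).trans ?_
    simp
  · rw [intervalIndicator, Set.indicator_of_notMem]
    simpa using hy

theorem diffFun_intervalIndicator {B k : ℕ} (hk : k ≤ B) :
    diffFun k (intervalIndicator 1 B) = intervalIndicator 1 (B - k : ℕ) := by
  funext y
  simp only [diffFun, intervalIndicator, Set.indicator, Set.mem_Icc]
  split_ifs <;> first | omega | simp

/-- For $0\le k\le B/2$ the derivative of the indicator of $\{1,\dots,B\}$ is that of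
$\{1,\dots,B-k\}$, of length at least $B/2$; all other $k$ are dropped by nonnegativity. -/
theorem exists_le_gowersSum_intervalIndicator (s : ℕ) : ∃ c : ℝ, 0 < c ∧ ∀ B : ℕ,
    c * (B : ℝ) ^ (s + 2) ≤ gowersSum s (intervalIndicator 1 B) := by
  induction s with
  | zero =>
    refine ⟨1, one_pos, fun B => ?_⟩
    rw [gowersSum, (isBddOn_intervalIndicator B).tsum_eq]
    have : ∑ y ∈ Finset.Icc (1 : ℤ) B, intervalIndicator 1 B y = B := by
      have h1 : ∀ y ∈ Finset.Icc (1 : ℤ) B, intervalIndicator 1 B y = 1 := fun y hy => by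
        rw [intervalIndicator, Set.indicator_of_mem]
        simpa using hy
      rw [Finset.sum_congr rfl h1]
      simp
    rw [this]
    simp
  | succ s ih =>
    obtain ⟨c, hc, h⟩ := ih
    refine ⟨c / 2 ^ (s + 3), by positivity, fun B => ?_⟩
    have h1 : ∑ k ∈ (Finset.range (B / 2 + 1)).map Nat.castEmbedding,
        gowersSum s (diffFun (k : ℤ) (intervalIndicator 1 B)) ≤
        gowersSum (s + 1) (intervalIndicator 1 B) :=
      (summable_gowersSum (isBddOn_intervalIndicator B).finite_support s).sum_le_tsum _
        fun k _ => gowersSum_nonneg _ _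
    refine le_trans ?_ h1
    rw [Finset.sum_map]
    have h2 : ∀ k ∈ Finset.range (B / 2 + 1), c * ((B : ℝ) / 2) ^ (s + 2) ≤
        gowersSum s (diffFun (Nat.castEmbedding k : ℤ) (intervalIndicator 1 B)) := by
      intro k hk
      rw [Finset.mem_range] at hk
      have hkB : k ≤ B := by omega
      rw [Nat.castEmbedding_apply, diffFun_intervalIndicator hkB]
      refine le_trans ?_ (h (B - k))
      gcongr
      rw [Nat.cast_sub hkB]
      have : ((2 * k : ℕ) : ℝ) ≤ (B : ℝ) := by exact_mod_cast (by omega : 2 * k ≤ B)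
      push_cast at this
      linarith
    refine le_trans ?_ (Finset.sum_le_sum h2)
    rw [Finset.sum_const, nsmul_eq_mul, Finset.card_range]
    have h3 : (B : ℝ) / 2 ≤ ((B / 2 + 1 : ℕ) : ℝ) := by
      have : (B : ℝ) ≤ ((2 * (B / 2 + 1) : ℕ) : ℝ) := by exact_mod_cast (by omega)
      push_cast at this ⊢
      linarith
    calc c / 2 ^ (s + 3) * (B : ℝ) ^ (s + 1 + 2) = (B : ℝ) / 2 * (c * ((B : ℝ) / 2) ^ (s + 2)) := by
          rw [div_pow]
          field_simp
          ring
      _ ≤ _ := by gcongr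

/-! ### The inverse theorem for the `U²` norm -/

open MeasureTheory AddCircle

theorem integral_e_zsmul (n : ℤ) :
    ∫ θ : UnitAddCircle, e (n • θ) ∂haarAddCircle = if n = 0 then 1 else 0 := by
  split_ifs with h
  · simp [h]
  · exact integral_eq_zero_of_add_right_eq_neg (μ := haarAddCircle)
      (fun θ => fourier_add_half_inv_index (T := (1 : ℝ)) h one_pos θ)

theorem continuous_e_zsmul (n : ℤ) : Continuous fun θ : UnitAddCircle => e (n • θ) :=
  (fourier n).continuous

theorem integrable_of_continuous {E : Type*} [NormedAddCommGroup E] {u : UnitAddCircle → E}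
    (hu : Continuous u) : Integrable u haarAddCircle :=
  hu.integrable_of_hasCompactSupport (HasCompactSupport.of_compactSpace _)

theorem integral_norm_sq_trig (S : Finset ℤ) (a : ℤ → ℂ) :
    ∫ θ : UnitAddCircle, ‖∑ k ∈ S, a k * e (k • θ)‖ ^ 2 ∂haarAddCircle = ∑ k ∈ S, ‖a k‖ ^ 2 := by
  have h1 : ((∫ θ : UnitAddCircle, ‖∑ k ∈ S, a k * e (k • θ)‖ ^ 2 ∂haarAddCircle : ℝ) : ℂ) =
      ∫ θ : UnitAddCircle, ∑ k ∈ S, ∑ l ∈ S, (a k * conj (a l)) * e ((k - l) • θ) ∂haarAddCircle := by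
    rw [← integral_complex_ofReal]
    refine integral_congr_ae (Filter.Eventually.of_forall fun θ => ?_)
    simp only
    rw [norm_sum_sq_eq]
    refine Finset.sum_congr rfl fun k _ => Finset.sum_congr rfl fun l _ => ?_
    rw [sub_smul, e_sub, map_mul]
    ring
  have hint : ∀ k l, Integrable (fun θ : UnitAddCircle => (a k * conj (a l)) * e ((k - l) • θ))
      haarAddCircle := fun k l =>
    integrable_of_continuous (continuous_const.mul (continuous_e_zsmul _))
  rw [integral_finsetSum _ fun k _ => integrable_finsetSum _ fun l _ => hint k l] at h1
  have h2 : ∀ k ∈ S, ∫ θ : UnitAddCircle, ∑ l ∈ S, (a k * conj (a l)) * e ((k - l) • θ)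
      ∂haarAddCircle = ((‖a k‖ ^ 2 : ℝ) : ℂ) := by
    intro k hk
    rw [integral_finsetSum _ fun l _ => hint k l]
    simp only [integral_const_mul, integral_e_zsmul, sub_eq_zero, mul_ite, mul_one, mul_zero]
    rw [Finset.sum_ite_eq, if_pos hk, Complex.mul_conj']
    push_cast
    rfl
  rw [Finset.sum_congr rfl h2] at h1
  exact_mod_cast h1

/-- The coefficients of $|\hat g|^2$ are the autocorrelations of $g$. This serves both in the $U^2$
inverse theorem and for opening squares of correlations. -/
theorem IsBddOn.norm_sq_fourier_eq {L : ℕ} {g : ℤ → ℂ} (hg : IsBddOn L g) (θ : UnitAddCircle) :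
    ((‖∑ y ∈ Finset.Icc (1 : ℤ) L, g y * e (y • θ)‖ ^ 2 : ℝ) : ℂ) =
      ∑ k ∈ diffRange L, (∑ y ∈ Finset.Icc (1 : ℤ) L, DegreeLowering.diffFun k g y) *
        e (k • (-θ)) := by
  rw [norm_sum_sq_eq]
  simp only [Finset.sum_mul]
  rw [Finset.sum_comm (s := diffRange L)]
  refine Finset.sum_congr rfl fun y hy => ?_
  have h1 : ∀ k ∈ diffRange L, DegreeLowering.diffFun k g y * e (k • (-θ)) =
      g y * e (y • θ) * conj (g (y + k) * e ((y + k) • θ)) := by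
    intro k _
    rw [DegreeLowering.diffFun, map_mul, ← e_neg]
    have : e (k • (-θ)) = e (y • θ) * e (-((y + k) • θ)) := by
      rw [← e_add]
      congr 1
      module
    rw [this]
    ring
  rw [Finset.sum_congr rfl h1]
  have h2 : diffRange L = Finset.Icc (1 - (L : ℤ)) (L - 1) := by
    ext k
    simp only [Finset.mem_Ioo, Finset.mem_Icc]
    omega
  rw [h2]
  simp only [add_comm y]
  rw [sum_Icc_shift (fun z => g y * e (y • θ) * conj (g z * e (z • θ)))]
  rw [Finset.mem_Icc] at hy
  refine Finset.sum_subset (Finset.Icc_subset_Icc (by omega) (by omega)) fun z _ hz => ?_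
  simp [hg.eq_zero z hz]

/-- The $U^2$ sum equals $\int|\hat g|^4\le\max|\hat g|^2\int|\hat g|^2$, and Parseval bounds the
last integral by $L$. The maximum is attained because the circle is compact. -/
theorem IsBddOn.exists_fourier {L : ℕ} {g : ℤ → ℂ} (hg : IsBddOn L g) :
    ∃ θ : UnitAddCircle,
      gowersSum 1 g ≤ L * ‖∑ y ∈ Finset.Icc (1 : ℤ) L, g y * e (y • θ)‖ ^ 2 := by
  set p : UnitAddCircle → ℝ := fun θ => ‖∑ y ∈ Finset.Icc (1 : ℤ) L, g y * e (y • θ)‖ ^ 2 with hp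
  have hpc : Continuous p := by
    refine Continuous.pow (Continuous.norm (continuous_finsetSum _ fun y _ => ?_)) 2
    exact continuous_const.mul (continuous_e_zsmul y)
  obtain ⟨θ, -, hθ⟩ := isCompact_univ.exists_isMaxOn Set.univ_nonempty hpc.continuousOn
  refine ⟨θ, ?_⟩
  have h1 : ∫ t, p t ∂haarAddCircle ≤ L := by
    rw [hp, integral_norm_sq_trig]
    calc _ ≤ ∑ y ∈ Finset.Icc (1 : ℤ) L, (1 : ℝ) :=
          Finset.sum_le_sum fun y _ => pow_le_one₀ (norm_nonneg _) (hg.norm_le y)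
      _ = L := by simp
  have h2 : ∫ t, p t ^ 2 ∂haarAddCircle = gowersSum 1 g := by
    rw [hg.gowersSum_succ]
    have h3 : ∀ k ∈ diffRange L, gowersSum 0 (DegreeLowering.diffFun k g) =
        ‖∑ y ∈ Finset.Icc (1 : ℤ) L, DegreeLowering.diffFun k g y‖ ^ 2 := fun k _ => by
      rw [gowersSum, (hg.diffFun k).tsum_eq]
    rw [Finset.sum_congr rfl h3, ← integral_norm_sq_trig, ← integral_neg_eq_self]
    congr 1
    funext t
    have h4 := hg.norm_sq_fourier_eq (-t)
    rw [neg_neg] at h4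
    rw [← h4, Complex.norm_real, Real.norm_of_nonneg (by positivity)]
  rw [← h2]
  calc ∫ t, p t ^ 2 ∂haarAddCircle ≤ ∫ t, p θ * p t ∂haarAddCircle := by
        refine integral_mono (integrable_of_continuous (hpc.pow 2))
          (integrable_of_continuous (continuous_const.mul hpc)) fun t => ?_
        simp only
        rw [pow_two]
        exact mul_le_mul_of_nonneg_right (hθ (Set.mem_univ t)) (by positivity)
    _ = p θ * ∫ t, p t ∂haarAddCircle := integral_const_mul _ _
    _ ≤ p θ * L := by
        refine mul_le_mul_of_nonneg_left h1 ?_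
        positivity
    _ = _ := by rw [mul_comm]

/-! ### Functions on cubes -/

/-- `b` does not depend on the coordinate `i`. -/
def IndepOf {m : ℕ} {A : Type*} (i : Fin m) (b : (Fin m → ℤ) → A) : Prop :=
  ∀ h a, b (Function.update h i a) = b h

theorem IndepOf.cons_succ {m : ℕ} {A : Type*} {i : Fin m} {b : (Fin (m + 1) → ℤ) → A}
    (hb : IndepOf i.succ b) (a : ℤ) : IndepOf i fun h => b (Fin.cons a h) := by
  intro h x
  simp only [Fin.cons_update]
  exact hb _ _

theorem IndepOf.cons_zero {m : ℕ} {A : Type*} {b : (Fin (m + 1) → ℤ) → A}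
    (hb : IndepOf 0 b) (a a' : ℤ) (h : Fin m → ℤ) : b (Fin.cons a h) = b (Fin.cons a' h) := by
  have := hb (Fin.cons a' h) a
  rwa [Fin.update_cons_zero] at this

theorem indepOf_zero_tail {m : ℕ} {A : Type*} (b : (Fin m → ℤ) → A) :
    IndepOf (0 : Fin (m + 1)) fun h => b (Fin.tail h) := by
  intro h a
  simp only [Fin.tail_update_zero]

theorem indepOf_succ_tail {m : ℕ} {A : Type*} {i : Fin m} {b : ℤ → (Fin m → ℤ) → A}
    (hb : ∀ a, IndepOf i (b a)) : IndepOf i.succ fun h => b (h 0) (Fin.tail h) := by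
  intro h a
  simp only [Fin.tail_update_succ]
  rw [hb, Function.update_of_ne (Fin.succ_ne_zero i).symm]

theorem IndepOf.mul_conj {m : ℕ} {i : Fin m} {b b' : (Fin m → ℤ) → ℂ} (hb : IndepOf i b)
    (hb' : IndepOf i b') : IndepOf i fun h => b h * conj (b' h) := by
  intro h a
  simp only [hb h a, hb' h a]

/-- `m`-fold complex conjugation. -/
noncomputable def conjIter : ℕ → (ℂ →+* ℂ)
  | 0 => RingHom.id ℂ
  | m + 1 => (starRingEnd ℂ).comp (conjIter m)

theorem conjIter_conj (m : ℕ) (z : ℂ) : conjIter m (conj z) = conj (conjIter m z) := by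
  induction m with
  | zero => rfl
  | succ m ih => simp [conjIter, ih]

theorem norm_conjIter (m : ℕ) (z : ℂ) : ‖conjIter m z‖ = ‖z‖ := by
  induction m with
  | zero => rfl
  | succ m ih => simp [conjIter, ih]

/-- In `Δ_{h₁,…,h_m} f(y)` every factor but `f(y + h₁ + ⋯ + h_m)` is independent of some `h_i`. -/
theorem exists_top_factor (m : ℕ) (f : ℤ → ℂ) (hf : ∀ y, ‖f y‖ ≤ 1) (y : ℤ) :
    ∃ β : Fin m → (Fin m → ℤ) → ℂ, (∀ i h, ‖β i h‖ ≤ 1) ∧ (∀ i, IndepOf i (β i)) ∧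
      ∀ h, conjIter m (iterDiffFun m h f y) = f (y + ∑ i, h i) * ∏ i, β i h := by
  induction m generalizing y with
  | zero =>
    exact ⟨fun i => i.elim0, fun i => i.elim0, fun i => i.elim0, fun h => by
      simp [iterDiffFun, conjIter]⟩
  | succ m ih =>
    choose β h1 h2 h3 using ih
    -- From $\Delta_h f(y)=\Delta_{h'}f(y)\,\overline{\Delta_{h'}f(y+h_0)}$ with $h'$ the tail: the
    -- first factor ignores $h_0$, the second contains the top vertex under one more conjugation,
    -- which the extra layer of `conjIter` undoes.
    refine ⟨Fin.cons (fun h => conj (conjIter m (iterDiffFun m (Fin.tail h) f y)))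
      fun i h => β (y + h 0) i (Fin.tail h), ?_, ?_, ?_⟩
    · intro i
      refine Fin.cases (fun h => ?_) (fun i h => ?_) i
      · simp only [Fin.cons_zero, RCLike.norm_conj, norm_conjIter]
        exact norm_iterDiffFun_le hf _ _ _
      · simp only [Fin.cons_succ]
        exact h1 _ _ _
    · intro i
      refine Fin.cases ?_ (fun i => ?_) i
      · simp only [Fin.cons_zero]
        exact indepOf_zero_tail fun h => conj (conjIter m (iterDiffFun m h f y))
      · simp only [Fin.cons_succ]
        exact indepOf_succ_tail (b := fun a h => β (y + a) i h) fun a => h2 _ _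
    · intro h
      rw [Fin.prod_univ_succ, Fin.sum_univ_succ]
      simp only [Fin.cons_zero, Fin.cons_succ]
      have h4 := h3 (y + h 0) (Fin.tail h)
      have h5 : conjIter (m + 1) (iterDiffFun (m + 1) h f y) =
          conj (conjIter m (iterDiffFun m (Fin.tail h) f y)) *
            conjIter m (iterDiffFun m (Fin.tail h) f (y + h 0)) := by
        simp [conjIter, iterDiffFun, diffFun, conjIter_conj]
      rw [h5, h4, ← add_assoc]
      simp only [Fin.tail]
      ring

/-- The multiplicative derivative `∏_ω C^{|ω|} W(h^ω)` over the cube spanned by `u` and `v`. -/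
def boxDeriv : (m : ℕ) → ((Fin m → ℤ) → ℂ) → (Fin m → ℤ) → (Fin m → ℤ) → ℂ
  | 0, W, _, _ => W ![]
  | m + 1, W, u, v =>
    boxDeriv m (fun h => W (Fin.cons (u 0) h) * conj (W (Fin.cons (v 0) h))) (Fin.tail u) (Fin.tail v)

/-- The additive derivative `∑_ω (-1)^{|ω|} φ(h^ω)` over the cube spanned by `u` and `v`. -/
def addDeriv : (m : ℕ) → ((Fin m → ℤ) → UnitAddCircle) → (Fin m → ℤ) → (Fin m → ℤ) → UnitAddCircle
  | 0, φ, _, _ => φ ![]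
  | m + 1, φ, u, v =>
    addDeriv m (fun h => φ (Fin.cons (u 0) h) - φ (Fin.cons (v 0) h)) (Fin.tail u) (Fin.tail v)

theorem norm_boxDeriv_le (m : ℕ) {W : (Fin m → ℤ) → ℂ} (hW : ∀ h, ‖W h‖ ≤ 1) (u v : Fin m → ℤ) :
    ‖boxDeriv m W u v‖ ≤ 1 := by
  induction m with
  | zero => exact hW _
  | succ m ih =>
    refine ih (fun h => ?_) _ _
    rw [norm_mul, RCLike.norm_conj]
    exact mul_le_one₀ (hW _) (norm_nonneg _) (hW _)

theorem boxDeriv_eq_zero (m : ℕ) {W : (Fin m → ℤ) → ℂ} {u : Fin m → ℤ} (hu : W u = 0)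
    (v : Fin m → ℤ) : boxDeriv m W u v = 0 := by
  induction m with
  | zero =>
    rw [boxDeriv, ← hu]
    exact congrArg W (Subsingleton.elim _ _)
  | succ m ih =>
    refine ih (u := Fin.tail u) ?_ _
    rw [Fin.cons_self_tail, hu, zero_mul]

/-- Each vertex of the box other than $u$ takes some coordinate from $v$, so its contribution does
not see that coordinate of $u$. -/
theorem exists_addDeriv_eq (m : ℕ) (φ : (Fin m → ℤ) → UnitAddCircle) (v : Fin m → ℤ) :
    ∃ ψ : Fin m → (Fin m → ℤ) → UnitAddCircle, (∀ i, IndepOf i (ψ i)) ∧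
      ∀ u, addDeriv m φ u v = φ u + ∑ i, ψ i u := by
  induction m with
  | zero =>
    refine ⟨fun i => i.elim0, fun i => i.elim0, fun u => ?_⟩
    rw [addDeriv, Finset.univ_eq_empty, Finset.sum_empty, add_zero]
    exact congrArg φ (Subsingleton.elim _ _)
  | succ m ih =>
    choose ψ h1 h2 using fun a : ℤ =>
      ih (fun h => φ (Fin.cons a h) - φ (Fin.cons (v 0) h)) (Fin.tail v)
    refine ⟨Fin.cons (fun u => -φ (Fin.cons (v 0) (Fin.tail u)))
      fun i u => ψ (u 0) i (Fin.tail u), ?_, ?_⟩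
    · intro i
      refine Fin.cases ?_ (fun i => ?_) i
      · simp only [Fin.cons_zero]
        exact indepOf_zero_tail fun h => -φ (Fin.cons (v 0) h)
      · simp only [Fin.cons_succ]
        exact indepOf_succ_tail (b := fun a h => ψ a i h) fun a => h1 _ _
    · intro u
      rw [addDeriv, h2, Fin.sum_univ_succ]
      simp only [Fin.cons_zero, Fin.cons_succ, Fin.cons_self_tail]
      abel

/-- Along $h\mapsto y+\sum h_i$ a box derivative is an ordinary iterated derivative with steps
$v_i-u_i$ based at $y+\sum u_i$, while phases combine additively. This is how $\Delta_{v-u}$ and the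
alternating sum of frequencies arise. -/
theorem boxDeriv_phase_mul (m : ℕ) (c : (Fin m → ℤ) → ℂ) (φ : (Fin m → ℤ) → UnitAddCircle)
    (K : ℤ → ℂ) (y : ℤ) (u v : Fin m → ℤ) :
    boxDeriv m (fun h => c h * e (y • φ h) * K (y + ∑ i, h i)) u v =
      boxDeriv m c u v * e (y • addDeriv m φ u v) * iterDiffFun m (v - u) K (y + ∑ i, u i) := by
  induction m generalizing K with
  | zero => simp [boxDeriv, addDeriv, iterDiffFun]
  | succ m ih =>
    have h1 := ih (fun h => c (Fin.cons (u 0) h) * conj (c (Fin.cons (v 0) h)))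
      (fun h => φ (Fin.cons (u 0) h) - φ (Fin.cons (v 0) h))
      (fun z => diffFun (v 0 - u 0) K (z + u 0)) (Fin.tail u) (Fin.tail v)
    have h2 : iterDiffFun (m + 1) (v - u) K (y + ∑ i, u i) =
        iterDiffFun m (Fin.tail v - Fin.tail u) (fun z => diffFun (v 0 - u 0) K (z + u 0))
          (y + ∑ i, Fin.tail u i) := by
      rw [iterDiffFun_translate, iterDiffFun_diffFun, Fin.sum_univ_succ]
      simp only [iterDiffFun, Pi.sub_apply]
      have h3 : Fin.tail (v - u) = Fin.tail v - Fin.tail u := rfl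
      rw [h3]
      congr 1
      simp only [Fin.tail]
      ring
    rw [h2, boxDeriv, boxDeriv, addDeriv, ← h1]
    congr 1
    funext h
    rw [Fin.sum_univ_succ, Fin.sum_univ_succ]
    simp only [Fin.cons_zero, Fin.cons_succ, diffFun, map_mul, smul_sub, e_sub]
    have h4 : y + ∑ i, h i + u 0 = y + (u 0 + ∑ i, h i) := by ring
    have h5 : y + (u 0 + ∑ i, h i) + (v 0 - u 0) = y + (v 0 + ∑ i, h i) := by ring
    rw [h4, h5]
    ring

/-! ### The box form of the Cauchy–Schwarz inequality -/

/-- The factor `b 0` is constant in the first coordinate, so Cauchy–Schwarz over the other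
coordinates removes it and doubles the first one. The remaining factors keep their independence. -/
theorem cauchy_schwarz_cube_step (m : ℕ) (I : Finset ℤ) (W : (Fin (m + 1) → ℤ) → ℂ)
    (b : Fin (m + 1) → (Fin (m + 1) → ℤ) → ℂ) (hb : ∀ i h, ‖b i h‖ ≤ 1)
    (hind : ∀ i, IndepOf i (b i)) :
    ‖∑ h ∈ cube (m + 1) I, W h * ∏ i, b i h‖ ^ 2 ≤ (I.card : ℝ) ^ m *
      (∑ p ∈ I ×ˢ I, ∑ h ∈ cube m I, (W (Fin.cons p.1 h) * conj (W (Fin.cons p.2 h))) *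
        ∏ i : Fin m, (b i.succ (Fin.cons p.1 h) * conj (b i.succ (Fin.cons p.2 h)))).re := by
  set X : (Fin m → ℤ) → ℂ := fun h =>
    ∑ a ∈ I, W (Fin.cons a h) * ∏ i : Fin m, b i.succ (Fin.cons a h) with hX
  have h1 : ∑ h ∈ cube (m + 1) I, W h * ∏ i, b i h =
      ∑ h ∈ cube m I, b 0 (Fin.cons 0 h) * X h := by
    rw [sum_cube_succ, Finset.sum_comm]
    refine Finset.sum_congr rfl fun h _ => ?_
    rw [hX, Finset.mul_sum]
    refine Finset.sum_congr rfl fun a _ => ?_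
    rw [Fin.prod_univ_succ, (hind 0).cons_zero a 0]
    ring
  have h2 := norm_sum_mul_sq_le (cube m I) (fun h => b 0 (Fin.cons 0 h)) X fun h => hb _ _
  rw [← h1, card_cube] at h2
  push_cast at h2
  refine h2.trans (le_of_eq ?_)
  congr 1
  rw [Finset.sum_comm, Complex.re_sum]
  refine Finset.sum_congr rfl fun h _ => ?_
  rw [← Complex.ofReal_re (‖X h‖ ^ 2), norm_sum_sq_eq, Finset.sum_product]
  congr 1
  refine Finset.sum_congr rfl fun a _ => Finset.sum_congr rfl fun a' _ => ?_
  rw [Finset.prod_mul_distrib, map_mul, map_prod]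
  ring

theorem sum_cube_boxDeriv_succ (m : ℕ) (I : Finset ℤ) (W : (Fin (m + 1) → ℤ) → ℂ) :
    ∑ u ∈ cube (m + 1) I, ∑ v ∈ cube (m + 1) I, boxDeriv (m + 1) W u v =
      ∑ p ∈ I ×ˢ I, ∑ u ∈ cube m I, ∑ v ∈ cube m I,
        boxDeriv m (fun h => W (Fin.cons p.1 h) * conj (W (Fin.cons p.2 h))) u v := by
  rw [sum_cube_succ, Finset.sum_product]
  refine Finset.sum_congr rfl fun a _ => ?_
  simp only [sum_cube_succ]
  rw [Finset.sum_comm]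
  refine Finset.sum_congr rfl fun a' _ => Finset.sum_congr rfl fun u _ =>
    Finset.sum_congr rfl fun v _ => ?_
  simp [boxDeriv]

/-- One coordinate is doubled at a time, with a power mean over the doubled pairs in between. At
least one coordinate is needed: with none, the claim would bound $|W|$ by its real part. -/
theorem box_cauchy_schwarz (m : ℕ) (I : Finset ℤ) (W : (Fin (m + 1) → ℤ) → ℂ)
    (b : Fin (m + 1) → (Fin (m + 1) → ℤ) → ℂ) (hb : ∀ i h, ‖b i h‖ ≤ 1)
    (hind : ∀ i, IndepOf i (b i)) :
    ‖∑ h ∈ cube (m + 1) I, W h * ∏ i, b i h‖ ^ 2 ^ (m + 1) * (I.card : ℝ) ^ (2 * (m + 1)) ≤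
      (I.card : ℝ) ^ ((m + 1) * 2 ^ (m + 1)) *
        (∑ u ∈ cube (m + 1) I, ∑ v ∈ cube (m + 1) I, boxDeriv (m + 1) W u v).re := by
  induction m with
  | zero =>
    have h1 := cauchy_schwarz_cube_step 0 I W b hb hind
    simp only [sum_cube_zero, Finset.univ_eq_empty, Finset.prod_empty, mul_one, pow_zero,
      one_mul] at h1
    rw [sum_cube_boxDeriv_succ]
    simp only [sum_cube_zero, boxDeriv]
    rw [mul_comm]
    exact mul_le_mul_of_nonneg_left h1 (by positivity)
  | succ m ih =>
    set p : ℕ := 2 ^ (m + 1) with hp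
    set n : ℝ := (I.card : ℝ) with hn
    have hp0 : p ≠ 0 := by positivity
    have h1 := cauchy_schwarz_cube_step (m + 1) I W b hb hind
    rw [sum_cube_boxDeriv_succ]
    set Z : ℤ × ℤ → ℂ := fun q => ∑ h ∈ cube (m + 1) I,
      (W (Fin.cons q.1 h) * conj (W (Fin.cons q.2 h))) *
        ∏ i : Fin (m + 1), (b i.succ (Fin.cons q.1 h) * conj (b i.succ (Fin.cons q.2 h))) with hZ
    have h2 : ∀ q, ‖Z q‖ ^ p * n ^ (2 * (m + 1)) ≤ n ^ ((m + 1) * p) *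
        (∑ u ∈ cube (m + 1) I, ∑ v ∈ cube (m + 1) I, boxDeriv (m + 1)
          (fun h => W (Fin.cons q.1 h) * conj (W (Fin.cons q.2 h))) u v).re := by
      intro q
      refine ih _ (fun i h => b i.succ (Fin.cons q.1 h) * conj (b i.succ (Fin.cons q.2 h)))
        (fun i h => ?_) fun i => ((hind i.succ).cons_succ _).mul_conj ((hind i.succ).cons_succ _)
      rw [norm_mul, RCLike.norm_conj]
      exact mul_le_one₀ (hb _ _) (norm_nonneg _) (hb _ _)
    have h3 : ‖∑ h ∈ cube (m + 1 + 1) I, W h * ∏ i, b i h‖ ^ 2 ≤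
        n ^ (m + 1) * ∑ q ∈ I ×ˢ I, ‖Z q‖ := by
      refine h1.trans ?_
      gcongr
      exact (Complex.re_le_norm _).trans (norm_sum_le _ _)
    have h4 := pow_sum_mul_card_le (I ×ˢ I) (fun q => ‖Z q‖) (fun _ _ => norm_nonneg _) hp0
    rw [Finset.card_product] at h4
    push_cast at h4
    rw [← hn] at h4
    have hpp : 2 ^ (m + 1 + 1) = 2 * p := by rw [hp]; ring
    rw [hpp, pow_mul]
    calc (‖∑ h ∈ cube (m + 1 + 1) I, W h * ∏ i, b i h‖ ^ 2) ^ p * n ^ (2 * (m + 1 + 1))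
        ≤ (n ^ (m + 1) * ∑ q ∈ I ×ˢ I, ‖Z q‖) ^ p * n ^ (2 * (m + 1 + 1)) := by gcongr
      _ = n ^ ((m + 1) * p) * n ^ (2 * (m + 1)) * ((∑ q ∈ I ×ˢ I, ‖Z q‖) ^ p * (n * n)) := by
          rw [mul_pow, ← pow_mul]; ring
      _ ≤ n ^ ((m + 1) * p) * n ^ (2 * (m + 1)) * ((n * n) ^ p * ∑ q ∈ I ×ˢ I, ‖Z q‖ ^ p) := by
          gcongr
      _ = n ^ ((m + 1) * p) * (n * n) ^ p * ∑ q ∈ I ×ˢ I, ‖Z q‖ ^ p * n ^ (2 * (m + 1)) := by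
          rw [← Finset.sum_mul]; ring
      _ ≤ n ^ ((m + 1) * p) * (n * n) ^ p * ∑ q ∈ I ×ˢ I, (n ^ ((m + 1) * p) *
          (∑ u ∈ cube (m + 1) I, ∑ v ∈ cube (m + 1) I, boxDeriv (m + 1)
            (fun h => W (Fin.cons q.1 h) * conj (W (Fin.cons q.2 h))) u v).re) := by
          exact mul_le_mul_of_nonneg_left (Finset.sum_le_sum fun q _ => h2 q) (by positivity)
      _ = _ := by
          rw [← Finset.mul_sum, Complex.re_sum]
          ring

/-! ### Interchanging the dual function with differencing -/

theorem sum_phase_shift {L : ℕ} {G : ℤ → ℂ} (hG : IsBddOn L G) (Y : Finset ℤ) (s : ℤ)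
    (hY : Finset.Icc (1 - s) (L - s) ⊆ Y) (ψ : UnitAddCircle) :
    ∑ y ∈ Y, e (y • ψ) * G (y + s) =
      e ((-s) • ψ) * ∑ y ∈ Finset.Icc (1 : ℤ) L, e (y • ψ) * G y := by
  have h1 : ∑ y ∈ Y, e (y • ψ) * G (y + s) =
      ∑ y ∈ Finset.Icc (1 - s) (L - s), e (y • ψ) * G (y + s) := by
    symm
    refine Finset.sum_subset hY fun y _ hy => ?_
    rw [hG.eq_zero, mul_zero]
    rw [Finset.mem_Icc] at hy ⊢
    omega
  have h2 := sum_Icc_shift (fun z => e ((z - s) • ψ) * G z) (1 - s) (L - s) s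
  simp only [add_sub_cancel_right, sub_add_cancel] at h2
  rw [h1, h2, Finset.mul_sum]
  refine Finset.sum_congr rfl fun y _ => ?_
  rw [← mul_assoc, ← e_add]
  congr 2
  module

theorem abs_sum_cube_le {m L : ℕ} {u : Fin m → ℤ} (hu : u ∈ cube m (diffRange L)) :
    |∑ i, u i| ≤ m * L := by
  rw [Fintype.mem_piFinset] at hu
  calc |∑ i, u i| ≤ ∑ i, |u i| := Finset.abs_sum_le_sum_abs _ _
    _ ≤ ∑ _i : Fin m, (L : ℤ) := Finset.sum_le_sum fun i _ => by
        have := Finset.mem_Ioo.1 (hu i)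
        rw [abs_le]
        omega
    _ = m * L := by simp

/-- The twisted derivative of the dual function is controlled by derivatives of its constituents. -/
theorem dual_difference_interchange (m : ℕ) {N L : ℕ} (hN : 1 ≤ N) (K : ℤ → ℤ → ℂ)
    (hK : ∀ d ∈ Finset.Icc (-(N : ℤ)) N, IsBddOn L (K d)) (F : ℤ → ℂ)
    (hF : ∀ y, F y = ∑ d ∈ Finset.Icc (-(N : ℤ)) N, (fejer N d : ℂ) * K d y)
    (c : (Fin m → ℤ) → ℂ) (φ : (Fin m → ℤ) → UnitAddCircle) :
    ‖∑ h ∈ cube m (diffRange L), ∑ y ∈ Finset.Icc (1 : ℤ) L,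
        c h * e (y • φ h) * conjIter m (iterDiffFun m h F y)‖ ^ 2 ^ m *
      (L * ((diffRange L).card : ℝ) ^ (2 * m)) ≤
    (L * ((diffRange L).card : ℝ) ^ m) ^ 2 ^ m *
      ∑ u ∈ cube m (diffRange L), ∑ v ∈ cube m (diffRange L), ‖boxDeriv m c u v‖ *
        ‖∑ d ∈ Finset.Icc (-(N : ℤ)) N, (fejer N d : ℂ) *
          ∑ y ∈ Finset.Icc (1 : ℤ) L, e (y • addDeriv m φ u v) * iterDiffFun m (v - u) (K d) y‖ := by
  -- With no differencing variable there is nothing to eliminate, and both sides agree.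
  rcases Nat.eq_zero_or_pos m with rfl | hm
  · simp only [sum_cube_zero, boxDeriv, addDeriv, iterDiffFun, conjIter]
    simp only [pow_zero, pow_one, mul_zero, mul_one, RingHom.id_apply]
    rw [mul_comm, ← norm_mul]
    refine le_of_eq ?_
    congr 2
    simp only [hF, Finset.mul_sum]
    rw [Finset.sum_comm]
    refine Finset.sum_congr rfl fun d _ => Finset.sum_congr rfl fun y _ => ?_
    ring
  obtain ⟨m, rfl⟩ : ∃ m', m = m' + 1 := ⟨m - 1, by omega⟩
  set I := diffRange L with hI
  set n : ℝ := (I.card : ℝ) with hn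
  set D := Finset.Icc (-(N : ℤ)) N with hD
  set p : ℕ := 2 ^ (m + 1) with hp
  have hp0 : p ≠ 0 := by positivity
  have hFb : ∀ y, ‖F y‖ ≤ 1 := fun y => by
    rw [hF]
    exact norm_sum_fejer_mul_le hN _ fun d hd => (hK d hd).norm_le y
  choose β hβ1 hβ2 hβ3 using exists_top_factor (m + 1) F hFb
  set W : ℤ → ℤ → (Fin (m + 1) → ℤ) → ℂ :=
    fun d y h => c h * e (y • φ h) * K d (y + ∑ i, h i) with hW
  set A : ℤ → ℤ → ℂ := fun d y => ∑ h ∈ cube (m + 1) I, W d y h * ∏ i, β y i h with hA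
  set Z := ∑ h ∈ cube (m + 1) I, ∑ y ∈ Finset.Icc (1 : ℤ) L,
    c h * e (y • φ h) * conjIter (m + 1) (iterDiffFun (m + 1) h F y) with hZ
  have h1 : Z = ∑ d ∈ D, (fejer N d : ℂ) * ∑ y ∈ Finset.Icc (1 : ℤ) L, A d y := by
    rw [hZ, Finset.sum_comm]
    simp only [Finset.mul_sum, hA]
    rw [Finset.sum_comm (s := D)]
    refine Finset.sum_congr rfl fun y _ => ?_
    rw [Finset.sum_comm (s := D)]
    refine Finset.sum_congr rfl fun h _ => ?_
    rw [hβ3, hF, Finset.sum_mul, Finset.mul_sum]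
    refine Finset.sum_congr rfl fun d _ => ?_
    ring
  set B : ℤ → ℝ := fun d => ∑ y ∈ Finset.Icc (1 : ℤ) L, ‖A d y‖ with hB
  have h2 : ‖Z‖ ^ p ≤ ∑ d ∈ D, fejer N d * B d ^ p := by
    have h3 : ‖Z‖ ≤ ∑ d ∈ D, fejer N d * B d := by
      rw [h1]
      refine (norm_sum_le _ _).trans (Finset.sum_le_sum fun d _ => ?_)
      rw [norm_mul, Complex.norm_real, Real.norm_of_nonneg (fejer_nonneg N d)]
      exact mul_le_mul_of_nonneg_left (norm_sum_le _ _) (fejer_nonneg N d)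
    -- Jensen for the probability weights `fejer N d` moves the power inside the average over $d$
    -- without loss.
    calc ‖Z‖ ^ p ≤ (∑ d ∈ D, fejer N d * B d) ^ p := by gcongr
      _ ≤ _ := Real.pow_arith_mean_le_arith_mean_pow D _ _ (fun d _ => fejer_nonneg N d)
          (sum_fejer hN) (fun d _ => Finset.sum_nonneg fun y _ => norm_nonneg _) p
  -- Large enough to contain every $y$ with $y+\sum u_i\in[1,L]$, so that the later translation of
  -- $y$ is exact.
  set Y : Finset ℤ := Finset.Icc (-((m + 1 : ℕ) * L : ℤ)) ((m + 2 : ℕ) * L) with hY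
  set Q : ℤ → ℤ → ℝ := fun d y =>
    (∑ u ∈ cube (m + 1) I, ∑ v ∈ cube (m + 1) I, boxDeriv (m + 1) (W d y) u v).re with hQ
  have h4 : ∀ d, B d ^ p * (L * n ^ (2 * (m + 1))) ≤
      (L * n ^ (m + 1)) ^ p * ∑ y ∈ Y, Q d y := by
    intro d
    have h5 := pow_sum_mul_card_le (Finset.Icc (1 : ℤ) L) (fun y => ‖A d y‖)
      (fun _ _ => norm_nonneg _) hp0
    have h6 : (Finset.Icc (1 : ℤ) L).card = L := by simp
    rw [h6] at h5
    have h7 : ∀ y, ‖A d y‖ ^ p * n ^ (2 * (m + 1)) ≤ n ^ ((m + 1) * p) * Q d y := fun y =>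
      box_cauchy_schwarz m I (W d y) (β y) (hβ1 y) (hβ2 y)
    calc B d ^ p * (L * n ^ (2 * (m + 1))) = (B d ^ p * L) * n ^ (2 * (m + 1)) := by ring
      _ ≤ (L ^ p * ∑ y ∈ Finset.Icc (1 : ℤ) L, ‖A d y‖ ^ p) * n ^ (2 * (m + 1)) := by gcongr
      _ ≤ (L ^ p * ∑ y ∈ Y, ‖A d y‖ ^ p) * n ^ (2 * (m + 1)) := by
          gcongr ((L : ℝ) ^ p * ?_) * _
          refine Finset.sum_le_sum_of_subset_of_nonneg ?_ fun _ _ _ => by positivity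
          refine Finset.Icc_subset_Icc ?_ ?_
          · have : (0 : ℤ) ≤ (m + 1 : ℕ) * L := by positivity
            omega
          · push_cast
            nlinarith [Int.natCast_nonneg m, Int.natCast_nonneg L]
      _ = L ^ p * ∑ y ∈ Y, ‖A d y‖ ^ p * n ^ (2 * (m + 1)) := by
          rw [← Finset.sum_mul]; ring
      _ ≤ L ^ p * ∑ y ∈ Y, n ^ ((m + 1) * p) * Q d y :=
          mul_le_mul_of_nonneg_left (Finset.sum_le_sum fun y _ => h7 y) (by positivity)
      _ = _ := by
          rw [← Finset.mul_sum, mul_pow, ← pow_mul]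
          ring
  have h8 : ∑ d ∈ D, fejer N d * ∑ y ∈ Y, Q d y ≤
      ∑ u ∈ cube (m + 1) I, ∑ v ∈ cube (m + 1) I, ‖boxDeriv (m + 1) c u v‖ *
        ‖∑ d ∈ D, (fejer N d : ℂ) * ∑ y ∈ Finset.Icc (1 : ℤ) L,
          e (y • addDeriv (m + 1) φ u v) * iterDiffFun (m + 1) (v - u) (K d) y‖ := by
    have h9 : ∑ d ∈ D, fejer N d * ∑ y ∈ Y, Q d y =
        (∑ u ∈ cube (m + 1) I, ∑ v ∈ cube (m + 1) I, ∑ d ∈ D, (fejer N d : ℂ) *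
          ∑ y ∈ Y, boxDeriv (m + 1) (W d y) u v).re := by
      simp only [hQ]
      have h10 : ∀ d y, ((∑ u ∈ cube (m + 1) I, ∑ v ∈ cube (m + 1) I,
          boxDeriv (m + 1) (W d y) u v).re) = Complex.reCLM (∑ u ∈ cube (m + 1) I,
            ∑ v ∈ cube (m + 1) I, boxDeriv (m + 1) (W d y) u v) := fun _ _ => rfl
      simp only [h10]
      rw [← Complex.reCLM_apply]
      have h11 : ∀ d, fejer N d * ∑ y ∈ Y, Complex.reCLM (∑ u ∈ cube (m + 1) I,
          ∑ v ∈ cube (m + 1) I, boxDeriv (m + 1) (W d y) u v) =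
          Complex.reCLM ((fejer N d : ℂ) * ∑ y ∈ Y, ∑ u ∈ cube (m + 1) I,
          ∑ v ∈ cube (m + 1) I, boxDeriv (m + 1) (W d y) u v) := by
        intro d
        rw [← map_sum, Complex.reCLM_apply, Complex.reCLM_apply, Complex.re_ofReal_mul]
      simp only [h11]
      rw [← map_sum]
      congr 1
      rw [Finset.sum_congr rfl fun u _ => Finset.sum_comm (s := cube (m + 1) I) (t := D),
        Finset.sum_comm (t := D)]
      refine Finset.sum_congr rfl fun d _ => ?_
      rw [Finset.sum_comm, Finset.mul_sum]
      refine Finset.sum_congr rfl fun u _ => ?_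
      rw [Finset.sum_comm, Finset.mul_sum]
    rw [h9]
    refine (Complex.re_le_norm _).trans ((norm_sum_le _ _).trans (Finset.sum_le_sum fun u hu =>
      (norm_sum_le _ _).trans (Finset.sum_le_sum fun v hv => ?_)))
    have h12 : ∀ d ∈ D, ∑ y ∈ Y, boxDeriv (m + 1) (W d y) u v =
        boxDeriv (m + 1) c u v * (e ((-∑ i, u i) • addDeriv (m + 1) φ u v) *
          ∑ y ∈ Finset.Icc (1 : ℤ) L, e (y • addDeriv (m + 1) φ u v) *
            iterDiffFun (m + 1) (v - u) (K d) y) := by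
      intro d hd
      rw [← sum_phase_shift ((hK d hd).iterDiffFun (m + 1) (v - u)) Y, Finset.mul_sum]
      · refine Finset.sum_congr rfl fun y _ => ?_
        rw [hW, boxDeriv_phase_mul]
        ring
      · have h13 := abs_le.1 (abs_sum_cube_le hu)
        refine Finset.Icc_subset_Icc ?_ ?_
        · omega
        · have : (((m + 2 : ℕ) : ℤ) * L) = ((m + 1 : ℕ) : ℤ) * L + L := by push_cast; ring
          omega
    -- Neither the box derivative of $c$ nor the phase from the translation depends on $d$, so
    -- cancellation in $d$ is kept inside the modulus.
    have h14 : ∑ d ∈ D, (fejer N d : ℂ) * ∑ y ∈ Y, boxDeriv (m + 1) (W d y) u v =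
        boxDeriv (m + 1) c u v * e ((-∑ i, u i) • addDeriv (m + 1) φ u v) *
          ∑ d ∈ D, (fejer N d : ℂ) * ∑ y ∈ Finset.Icc (1 : ℤ) L,
            e (y • addDeriv (m + 1) φ u v) * iterDiffFun (m + 1) (v - u) (K d) y := by
      rw [Finset.mul_sum]
      refine Finset.sum_congr rfl fun d hd => ?_
      rw [h12 d hd]
      ring
    rw [h14, norm_mul, norm_mul, norm_e, mul_one]
  calc ‖Z‖ ^ p * (L * n ^ (2 * (m + 1)))
      ≤ (∑ d ∈ D, fejer N d * B d ^ p) * (L * n ^ (2 * (m + 1))) := by gcongr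
    _ = ∑ d ∈ D, fejer N d * (B d ^ p * (L * n ^ (2 * (m + 1)))) := by
        rw [Finset.sum_mul]
        exact Finset.sum_congr rfl fun d _ => by ring
    _ ≤ ∑ d ∈ D, fejer N d * ((L * n ^ (m + 1)) ^ p * ∑ y ∈ Y, Q d y) :=
        Finset.sum_le_sum fun d _ => mul_le_mul_of_nonneg_left (h4 d) (fejer_nonneg N d)
    _ = (L * n ^ (m + 1)) ^ p * ∑ d ∈ D, fejer N d * ∑ y ∈ Y, Q d y := by
        rw [Finset.mul_sum]
        exact Finset.sum_congr rfl fun d _ => by ring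
    _ ≤ _ := by gcongr

/-! ### The dual function -/

/-- The standing assumptions on `f₀` and `f₁`. -/
structure IsAdmissible (N : ℕ) (f₀ f₁ : ℤ × ℤ → ℂ) : Prop where
  one_le : 1 ≤ N
  norm_left : ∀ p, ‖f₀ p‖ ≤ 1
  norm_right : ∀ p, ‖f₁ p‖ ≤ 1
  support_left : Function.support f₀ ⊆ Set.Icc (1 : ℤ) N ×ˢ Set.Icc (1 : ℤ) (N ^ 2)

/-- The constituent `f₀(x, y - d²) f₁(x + d, y - d²)` of the dual function. -/
def constituent (f₀ f₁ : ℤ × ℤ → ℂ) (x d y : ℤ) : ℂ :=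
  f₀ (x, y - d ^ 2) * f₁ (x + d, y - d ^ 2)

theorem fejer_eq_zero {N : ℕ} (hN : 1 ≤ N) {d : ℤ} (hd : d ∉ Finset.Icc (-(N : ℤ)) N) :
    fejer N d = 0 := by
  rw [fejer_eq, hat_eq_zero hN, mul_zero]
  rw [Finset.mem_Icc, ← abs_le, not_le] at hd
  exact hd.le

section

variable {N : ℕ} {f₀ f₁ : ℤ × ℤ → ℂ}

theorem dualFun_eq_sum (hN : 1 ≤ N) (f₀ f₁ : ℤ × ℤ → ℂ) (x y : ℤ) :
    dualFun N f₀ f₁ (x, y) =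
      ∑ d ∈ Finset.Icc (-(N : ℤ)) N, (fejer N d : ℂ) * constituent f₀ f₁ x d y := by
  rw [dualFun, tsum_eq_sum (s := Finset.Icc (-(N : ℤ)) N)]
  · simp only [constituent, mul_assoc]
  · intro d hd
    simp [fejer_eq_zero hN hd]

theorem IsAdmissible.isBddOn_mul (hf : IsAdmissible N f₀ f₁) (x z : ℤ) :
    IsBddOn (N ^ 2) fun y => f₀ (x, y) * f₁ (z, y) := by
  refine ⟨fun y => ?_, fun y hy => ?_⟩
  · rw [norm_mul]
    exact mul_le_one₀ (hf.norm_left _) (norm_nonneg _) (hf.norm_right _)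
  · have : f₀ (x, y) = 0 := by
      by_contra hcon
      have := (hf.support_left hcon).2
      rw [Finset.mem_Icc] at hy
      push_cast at hy
      exact hy this
    rw [this, zero_mul]

theorem sq_le_of_mem_Icc {d : ℤ} (hd : d ∈ Finset.Icc (-(N : ℤ)) N) : d ^ 2 ≤ (N : ℤ) ^ 2 := by
  rw [Finset.mem_Icc] at hd
  exact sq_le_sq' hd.1 hd.2

theorem IsAdmissible.isBddOn_constituent (hf : IsAdmissible N f₀ f₁) (x : ℤ) {d : ℤ}
    (hd : d ∈ Finset.Icc (-(N : ℤ)) N) : IsBddOn (2 * N ^ 2) (constituent f₀ f₁ x d) := by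
  have h := hf.isBddOn_mul x (x + d)
  have hd2 := sq_le_of_mem_Icc hd
  refine ⟨fun y => h.norm_le _, fun y hy => h.eq_zero _ ?_⟩
  rw [Finset.mem_Icc] at hy ⊢
  push_cast at hy ⊢
  have := sq_nonneg d
  omega

theorem IsAdmissible.isBddOn_dualFun (hf : IsAdmissible N f₀ f₁) (x : ℤ) :
    IsBddOn (2 * N ^ 2) fun y => dualFun N f₀ f₁ (x, y) := by
  refine ⟨fun y => ?_, fun y hy => ?_⟩
  · rw [dualFun_eq_sum hf.one_le]
    exact norm_sum_fejer_mul_le hf.one_le _ fun d hd => (hf.isBddOn_constituent x hd).norm_le y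
  · rw [dualFun_eq_sum hf.one_le]
    exact Finset.sum_eq_zero fun d hd => by
      rw [(hf.isBddOn_constituent x hd).eq_zero y hy, mul_zero]

theorem IsAdmissible.dualFun_eq_zero (hf : IsAdmissible N f₀ f₁) {x : ℤ}
    (hx : x ∉ Set.Icc (1 : ℤ) N) (y : ℤ) : dualFun N f₀ f₁ (x, y) = 0 := by
  rw [dualFun_eq_sum hf.one_le]
  refine Finset.sum_eq_zero fun d _ => ?_
  have : f₀ (x, y - d ^ 2) = 0 := by
    by_contra hcon
    exact hx (hf.support_left hcon).1
  rw [constituent, this, zero_mul, mul_zero]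

/-- Only the correlation of `f₁` with a quadratic phase matters for the derivatives of the dual
function. -/
theorem IsAdmissible.norm_sum_constituent_le (hf : IsAdmissible N f₀ f₁) (m : ℕ) (k : Fin m → ℤ)
    (x : ℤ) (ψ : UnitAddCircle) :
    ‖∑ d ∈ Finset.Icc (-(N : ℤ)) N, (fejer N d : ℂ) *
      ∑ y ∈ Finset.Icc (1 : ℤ) (2 * N ^ 2 : ℕ),
        e (y • ψ) * iterDiffFun m k (constituent f₀ f₁ x d) y‖ ≤
    ∑ y ∈ Finset.Icc (1 : ℤ) (N ^ 2), ‖∑ d ∈ Finset.Icc (-(N : ℤ)) N,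
      (fejer N d : ℂ) * iterDiffFun m k (fun y => f₁ (x + d, y)) y * e (d ^ 2 • ψ)‖ := by
  have h1 : ∀ d ∈ Finset.Icc (-(N : ℤ)) N, ∑ y ∈ Finset.Icc (1 : ℤ) (2 * N ^ 2 : ℕ),
        e (y • ψ) * iterDiffFun m k (constituent f₀ f₁ x d) y =
      e (d ^ 2 • ψ) * ∑ y ∈ Finset.Icc (1 : ℤ) (N ^ 2), e (y • ψ) *
        (iterDiffFun m k (fun y => f₀ (x, y)) y * iterDiffFun m k (fun y => f₁ (x + d, y)) y) := by
    intro d hd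
    have h2 : iterDiffFun m k (constituent f₀ f₁ x d) = fun y =>
        iterDiffFun m k (fun z => f₀ (x, z) * f₁ (x + d, z)) (y + -d ^ 2) :=
      iterDiffFun_translate m k (fun z => f₀ (x, z) * f₁ (x + d, z)) (-d ^ 2)
    -- Undoing the shift by $d^2$ in the constituent creates the quadratic phase $e(d^2\psi)$ and
    -- frees $f_0$ of $d$.
    have h3 := sum_phase_shift ((hf.isBddOn_mul x (x + d)).iterDiffFun m k)
      (Finset.Icc (1 : ℤ) (2 * N ^ 2 : ℕ)) (-d ^ 2) (by
        have := sq_le_of_mem_Icc hd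
        have := sq_nonneg d
        refine Finset.Icc_subset_Icc (by omega) ?_
        push_cast
        omega) ψ
    rw [h2, h3, neg_neg]
    simp only [iterDiffFun_mul]
    push_cast
    rfl
  rw [Finset.sum_congr rfl fun d hd => by rw [h1 d hd]]
  simp only [Finset.mul_sum]
  rw [Finset.sum_comm]
  refine (norm_sum_le _ _).trans (Finset.sum_le_sum fun y _ => ?_)
  have h4 : ∑ d ∈ Finset.Icc (-(N : ℤ)) N, (fejer N d : ℂ) * (e (d ^ 2 • ψ) * (e (y • ψ) *
      (iterDiffFun m k (fun y => f₀ (x, y)) y * iterDiffFun m k (fun y => f₁ (x + d, y)) y))) =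
      (e (y • ψ) * iterDiffFun m k (fun y => f₀ (x, y)) y) *
      ∑ d ∈ Finset.Icc (-(N : ℤ)) N,
        (fejer N d : ℂ) * iterDiffFun m k (fun y => f₁ (x + d, y)) y * e (d ^ 2 • ψ) := by
    rw [Finset.mul_sum]
    exact Finset.sum_congr rfl fun d _ => by ring
  rw [h4, norm_mul, norm_mul, norm_e, one_mul]
  exact mul_le_of_le_one_left (norm_nonneg _) (norm_iterDiffFun_le (fun y => hf.norm_left _) _ _ _)

/-- The correlation of a derivative of the dual function with a linear phase. -/
noncomputable def derivCorr (N : ℕ) (f₀ f₁ : ℤ × ℤ → ℂ) (m : ℕ) (x : ℤ) (h : Fin m → ℤ)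
    (θ : UnitAddCircle) : ℂ :=
  ∑ y ∈ Finset.Icc (1 : ℤ) (2 * N ^ 2 : ℕ),
    conjIter m (iterDiffFun m h (fun y => dualFun N f₀ f₁ (x, y)) y) * e (y • θ)

theorem one_le_card_diffRange (hN : 1 ≤ N) : (1 : ℝ) ≤ (diffRange (2 * N ^ 2)).card := by
  rw [card_diffRange]
  have : 1 ≤ N ^ 2 := Nat.one_le_pow _ _ hN
  exact_mod_cast (by omega : 1 ≤ 2 * (2 * N ^ 2) - 1)

/-- Summing the dual–difference interchange over `x`. -/
theorem IsAdmissible.le_sum_boxDeriv (hf : IsAdmissible N f₀ f₁) (m : ℕ) {η : ℝ} (hη : 0 < η)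
    (φ : ℤ → (Fin m → ℤ) → UnitAddCircle)
    (H : Finset (ℤ × (Fin m → ℤ))) (hH : H ⊆ Finset.Icc (1 : ℤ) N ×ˢ cube m (diffRange (2 * N ^ 2)))
    (hHc : η * (N * ((diffRange (2 * N ^ 2)).card : ℝ) ^ m) ≤ H.card)
    (hφ : ∀ p ∈ H, η * (2 * N ^ 2 : ℕ) ≤ ‖derivCorr N f₀ f₁ m p.1 p.2 (φ p.1 p.2)‖) :
    ∃ c : ℤ → (Fin m → ℤ) → ℂ, (∀ x h, ‖c x h‖ ≤ 1) ∧ (∀ x h, (x, h) ∉ H → c x h = 0) ∧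
      η ^ (2 * 2 ^ m) * (N * ((diffRange (2 * N ^ 2)).card : ℝ) ^ (2 * m) * (2 * N ^ 2 : ℕ)) ≤
      ∑ x ∈ Finset.Icc (1 : ℤ) N, ∑ u ∈ cube m (diffRange (2 * N ^ 2)),
        ∑ v ∈ cube m (diffRange (2 * N ^ 2)), ‖boxDeriv m (c x) u v‖ *
          ‖∑ d ∈ Finset.Icc (-(N : ℤ)) N, (fejer N d : ℂ) *
            ∑ y ∈ Finset.Icc (1 : ℤ) (2 * N ^ 2 : ℕ), e (y • addDeriv m (φ x) u v) *
              iterDiffFun m (v - u) (constituent f₀ f₁ x d) y‖ := by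
  classical
  set L : ℕ := 2 * N ^ 2 with hL
  set I := diffRange L with hI
  set n : ℝ := (I.card : ℝ) with hn
  set p : ℕ := 2 ^ m with hp
  have hp0 : p ≠ 0 := by positivity
  have hN0 : (1 : ℝ) ≤ N := by exact_mod_cast hf.one_le
  have hn0 : (1 : ℝ) ≤ n := one_le_card_diffRange hf.one_le
  have hL0 : (0 : ℝ) < L := by rw [hL]; push_cast; positivity
  choose γ hγ1 hγ2 using fun z : ℤ × (Fin m → ℤ) =>
    exists_phase (derivCorr N f₀ f₁ m z.1 z.2 (φ z.1 z.2))
  -- Besides rotating each correlation to its modulus, $c$ restricts to `H`; this forces the base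
  -- vertex $u$ of every surviving box to satisfy $(x,u)\in H$.
  set c : ℤ → (Fin m → ℤ) → ℂ := fun x h => if (x, h) ∈ H then γ (x, h) else 0 with hc
  refine ⟨c, fun x h => ?_, fun x h hxh => if_neg hxh, ?_⟩
  · simp only [hc]
    split_ifs
    · exact (hγ1 _).le
    · simp
  set Z : ℤ → ℂ := fun x => ∑ h ∈ cube m I, ∑ y ∈ Finset.Icc (1 : ℤ) L,
    c x h * e (y • φ x h) * conjIter m (iterDiffFun m h (fun y => dualFun N f₀ f₁ (x, y)) y) with hZ
  set R : ℤ → ℝ := fun x => ∑ u ∈ cube m I, ∑ v ∈ cube m I, ‖boxDeriv m (c x) u v‖ *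
    ‖∑ d ∈ Finset.Icc (-(N : ℤ)) N, (fejer N d : ℂ) *
      ∑ y ∈ Finset.Icc (1 : ℤ) L, e (y • addDeriv m (φ x) u v) *
        iterDiffFun m (v - u) (constituent f₀ f₁ x d) y‖ with hR
  have h1 : ∀ x, ‖Z x‖ ^ p * (L * n ^ (2 * m)) ≤ (L * n ^ m) ^ p * R x := fun x =>
    dual_difference_interchange m hf.one_le (constituent f₀ f₁ x)
      (fun d hd => hf.isBddOn_constituent x hd) _ (fun y => dualFun_eq_sum hf.one_le f₀ f₁ x y)
      (c x) (φ x)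
  have h2 : ∑ x ∈ Finset.Icc (1 : ℤ) N, Z x = ((∑ q ∈ H,
      ‖derivCorr N f₀ f₁ m q.1 q.2 (φ q.1 q.2)‖ : ℝ) : ℂ) := by
    push_cast
    have h3 : ∀ x, Z x = ∑ h ∈ cube m I, if (x, h) ∈ H then
        ((‖derivCorr N f₀ f₁ m x h (φ x h)‖ : ℝ) : ℂ) else 0 := by
      intro x
      refine Finset.sum_congr rfl fun h _ => ?_
      simp only [hc]
      split_ifs
      · rw [← hγ2 (x, h), derivCorr, Finset.mul_sum]
        exact Finset.sum_congr rfl fun y _ => by ring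
      · simp
    simp only [h3]
    rw [← Finset.sum_product' (f := fun x h => if (x, h) ∈ H then
        ((‖derivCorr N f₀ f₁ m x h (φ x h)‖ : ℝ) : ℂ) else 0), ← Finset.sum_filter]
    rw [Finset.filter_mem_eq_inter, Finset.inter_eq_right.2 hH]
  have h4 : η ^ 2 * (N * n ^ m * L) ≤ ∑ x ∈ Finset.Icc (1 : ℤ) N, ‖Z x‖ := by
    have h5 : (H.card : ℝ) * (η * L) ≤ ∑ q ∈ H, ‖derivCorr N f₀ f₁ m q.1 q.2 (φ q.1 q.2)‖ := by
      rw [← nsmul_eq_mul]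
      exact Finset.card_nsmul_le_sum _ _ _ hφ
    have h6 : ∑ q ∈ H, ‖derivCorr N f₀ f₁ m q.1 q.2 (φ q.1 q.2)‖ ≤
        ∑ x ∈ Finset.Icc (1 : ℤ) N, ‖Z x‖ := by
      have := norm_sum_le (Finset.Icc (1 : ℤ) N) Z
      rw [h2, Complex.norm_real, Real.norm_of_nonneg (by positivity)] at this
      exact this
    calc η ^ 2 * (N * n ^ m * L) = η * (N * n ^ m) * (η * L) := by ring
      _ ≤ H.card * (η * L) := by gcongr
      _ ≤ _ := h5.trans h6
  have h7 := pow_sum_mul_card_le (Finset.Icc (1 : ℤ) N) (fun x => ‖Z x‖)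
    (fun _ _ => norm_nonneg _) hp0
  have h8 : (Finset.Icc (1 : ℤ) N).card = N := by simp
  rw [h8] at h7
  have hpos : 0 < (N * n ^ m * L) ^ p := by positivity
  refine le_of_mul_le_mul_left ?_ hpos
  calc (N * n ^ m * L) ^ p * (η ^ (2 * p) * (N * n ^ (2 * m) * L))
      = ((η ^ 2 * (N * n ^ m * L)) ^ p * N) * (L * n ^ (2 * m)) := by
        rw [mul_pow (η ^ 2), ← pow_mul]
        ring
    _ ≤ ((∑ x ∈ Finset.Icc (1 : ℤ) N, ‖Z x‖) ^ p * N) * (L * n ^ (2 * m)) := by gcongr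
    _ ≤ (N ^ p * ∑ x ∈ Finset.Icc (1 : ℤ) N, ‖Z x‖ ^ p) * (L * n ^ (2 * m)) := by gcongr
    _ = N ^ p * ∑ x ∈ Finset.Icc (1 : ℤ) N, ‖Z x‖ ^ p * (L * n ^ (2 * m)) := by
        rw [← Finset.sum_mul]; ring
    _ ≤ N ^ p * ∑ x ∈ Finset.Icc (1 : ℤ) N, (L * n ^ m) ^ p * R x :=
        mul_le_mul_of_nonneg_left (Finset.sum_le_sum fun x _ => h1 x) (by positivity)
    _ = _ := by
        rw [← Finset.mul_sum, ← mul_assoc, ← mul_pow]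
        congr 2
        ring

end

/-! ### Structure of the frequency functions. -/

theorem exists_le_sum_of_le_sum {ι : Type*} (s : Finset ι) (f : ι → ℝ) {B c : ℝ}
    (hs : (s.card : ℝ) ≤ c) (hc : 0 < c) (hB : 0 < B) (h : c * B ≤ ∑ i ∈ s, f i) :
    ∃ i ∈ s, B ≤ f i := by
  by_contra hcon
  push Not at hcon
  rcases s.eq_empty_or_nonempty with rfl | hne
  · rw [Finset.sum_empty] at h
    nlinarith
  · have h1 := Finset.sum_lt_sum_of_nonempty hne hcon
    rw [Finset.sum_const, nsmul_eq_mul] at h1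
    nlinarith

/-- For many `(x, u)` and a fixed `v`, the derivative of the phase function over the cube spanned
by `u` and `v` lies in a major arc. -/
theorem exists_major_derivative (m : ℕ) : ∃ k : ℕ, ∀ (N : ℕ) (f₀ f₁ : ℤ × ℤ → ℂ),
    IsAdmissible N f₀ f₁ → ∀ (η : ℝ), 0 < η → η ≤ 1 / 2 →
    ∀ (φ : ℤ → (Fin m → ℤ) → UnitAddCircle) (H : Finset (ℤ × (Fin m → ℤ))),
    H ⊆ Finset.Icc (1 : ℤ) N ×ˢ cube m (diffRange (2 * N ^ 2)) →
    η * (N * ((diffRange (2 * N ^ 2)).card : ℝ) ^ m) ≤ H.card →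
    (∀ p ∈ H, η * (2 * N ^ 2 : ℕ) ≤ ‖derivCorr N f₀ f₁ m p.1 p.2 (φ p.1 p.2)‖) →
    (N : ℝ) ≤ η⁻¹ ^ k ∨ ∃ v : Fin m → ℤ, ∃ H' ⊆ H,
      η ^ k * (N * ((diffRange (2 * N ^ 2)).card : ℝ) ^ m) ≤ H'.card ∧
      ∀ p ∈ H', IsMajor (η⁻¹ ^ k) N (addDeriv m (φ p.1) p.2 v) := by
  classical
  obtain ⟨k, hk⟩ := exists_many_major
  obtain ⟨a, ha, ha0⟩ : ∃ a : ℕ, a = 2 * 2 ^ m ∧ a ≠ 0 := ⟨_, rfl, by positivity⟩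
  refine ⟨a * (4 * (k + 1)), fun N f₀ f₁ hf η hη hη' φ H hH hHc hφ => ?_⟩
  rw [or_iff_not_imp_left, not_le]
  intro hN
  obtain ⟨c, hc1, hc2, hc3⟩ := hf.le_sum_boxDeriv m hη φ H hH hHc hφ
  rw [← ha] at hc3
  set L : ℕ := 2 * N ^ 2 with hL
  set I := diffRange L with hI
  set n : ℝ := (I.card : ℝ) with hn
  have hN0 : (1 : ℝ) ≤ N := by exact_mod_cast hf.one_le
  have hn0 : (1 : ℝ) ≤ n := one_le_card_diffRange hf.one_le
  have hL1 : (L : ℝ) = 2 * (N : ℝ) ^ 2 := by rw [hL]; push_cast; ring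
  have hL0 : (0 : ℝ) < L := by rw [hL1]; positivity
  have hcube : ((cube m I).card : ℝ) = n ^ m := by rw [card_cube]; push_cast; rfl
  set ε := η ^ a with hε
  have hε0 : 0 < ε := pow_pos hη a
  have hε' : ε ≤ 1 / 2 := pow_le_half hη hη' ha0
  set η' := ε ^ 4 with hη1
  have hη0 : 0 < η' := pow_pos hε0 4
  have hη2 : η' ≤ 1 / 2 := pow_le_half hε0 hε' (by norm_num)
  set G : ℤ → (Fin m → ℤ) → (Fin m → ℤ) → ℂ := fun x u v =>
    ∑ d ∈ Finset.Icc (-(N : ℤ)) N, (fejer N d : ℂ) *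
      ∑ y ∈ Finset.Icc (1 : ℤ) L, e (y • addDeriv m (φ x) u v) *
        iterDiffFun m (v - u) (constituent f₀ f₁ x d) y with hG
  have hGL : ∀ x u v, ‖G x u v‖ ≤ L := fun x u v =>
    norm_sum_fejer_mul_le hf.one_le _ fun d hd => by
      have := ((hf.isBddOn_constituent x hd).iterDiffFun m (v - u)).norm_sum_le
        fun y => y • addDeriv m (φ x) u v
      simp only [mul_comm] at this ⊢
      exact this
  set A := Finset.Icc (1 : ℤ) N ×ˢ cube m I ×ˢ cube m I with hA
  have hAc : (A.card : ℝ) = N * n ^ (2 * m) := by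
    rw [hA, Finset.card_product, Finset.card_product]
    push_cast
    rw [hcube, Int.card_Icc, add_sub_cancel_right, Int.toNat_natCast]
    ring
  have hpop := card_popular A (fun q => ‖boxDeriv m (c q.1) q.2.1 q.2.2‖ * ‖G q.1 q.2.1 q.2.2‖)
    hL0 hε0 hε'
    (fun q _ => (mul_le_of_le_one_left (norm_nonneg _) (norm_boxDeriv_le m (hc1 _) _ _)).trans
      (hGL _ _ _))
    (by
      rw [hAc, hA, Finset.sum_product]
      simp only [Finset.sum_product]
      rw [mul_assoc]
      exact hc3)
  set T := A.filter fun q =>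
    ε ^ 2 * L ≤ ‖boxDeriv m (c q.1) q.2.1 q.2.2‖ * ‖G q.1 q.2.1 q.2.2‖ with hT
  have hTmem : ∀ q ∈ T, (q.1, q.2.1) ∈ H ∧ ε ^ 2 * L ≤ ‖G q.1 q.2.1 q.2.2‖ := by
    intro q hq
    have hq2 := (Finset.mem_filter.1 hq).2
    constructor
    · by_contra hcon
      rw [boxDeriv_eq_zero m (hc2 _ _ hcon), norm_zero, zero_mul] at hq2
      have : 0 < ε ^ 2 * L := by positivity
      linarith
    · exact hq2.trans (mul_le_of_le_one_left (norm_nonneg _) (norm_boxDeriv_le m (hc1 _) _ _))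
  -- Grouping by box: for a fixed $(u,v)$ the function $\Delta_{v-u}f_1(z,\cdot)$ depends only on
  -- $z=x+d$, as the comparison of different $x$ requires.
  set X : (Fin m → ℤ) × (Fin m → ℤ) → Finset ℤ := fun w =>
    (Finset.Icc (1 : ℤ) N).filter fun x => (x, w) ∈ T with hX
  have hTsum : (T.card : ℝ) = ∑ w ∈ cube m I ×ˢ cube m I, ((X w).card : ℝ) := by
    have h1 : T = A.filter fun q => q ∈ T := by
      rw [Finset.filter_mem_eq_inter, Finset.inter_eq_right.2 (Finset.filter_subset _ _)]
    rw [h1, Finset.card_filter, hA, Finset.sum_product_right]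
    push_cast
    refine Finset.sum_congr rfl fun w _ => ?_
    simp only [hX, Finset.card_filter]
    push_cast
    rfl
  have hpop2 := card_popular (cube m I ×ˢ cube m I) (fun w => ((X w).card : ℝ))
    (by linarith : (0 : ℝ) < N) (pow_pos hε0 2) (pow_le_half hε0 hε' (by norm_num))
    (fun w _ => by
      have : (X w).card ≤ (Finset.Icc (1 : ℤ) N).card := Finset.card_filter_le _ _
      rw [Int.card_Icc] at this
      have h2 : (X w).card ≤ N := by simpa using this
      exact_mod_cast h2)
    (by
      rw [← hTsum, Finset.card_product]
      push_cast
      rw [hcube]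
      refine le_trans (le_of_eq ?_) hpop
      rw [hAc]
      ring)
  rw [← pow_mul] at hpop2
  set P := (cube m I ×ˢ cube m I).filter fun w => ε ^ (2 * 2) * N ≤ ((X w).card : ℝ) with hP
  set M : (Fin m → ℤ) → (Fin m → ℤ) → Finset ℤ := fun u v => (Finset.Icc (1 : ℤ) N).filter fun x =>
    (x, u) ∈ H ∧ IsMajor (η'⁻¹ ^ k) N (addDeriv m (φ x) u v) with hM
  have hNk : η'⁻¹ ^ k < N := by
    refine lt_of_le_of_lt ?_ hN
    rw [hη1, hε, ← inv_pow, ← inv_pow, ← pow_mul, ← pow_mul]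
    exact inv_pow_le_of_le hη hη' (Nat.mul_le_mul_left _ (by omega))
  have hkey : ∀ w ∈ P, η' ^ k * N ≤ ((M w.1 w.2).card : ℝ) := by
    intro w hw
    have hXw : ∀ x ∈ X w, (x, w.1) ∈ H ∧ ε ^ 2 * L ≤ ‖G x w.1 w.2‖ := fun x hx =>
      hTmem _ (Finset.mem_filter.1 hx).2
    rcases hk N hf.one_le η' hη0 hη2 (X w) (Finset.filter_subset _ _) (Finset.mem_filter.1 hw).2
      (fun z y => iterDiffFun m (w.2 - w.1) (fun y => f₁ (z, y)) y)
      (fun z y => norm_iterDiffFun_le (fun y => hf.norm_right _) _ _ _)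
      (fun x => addDeriv m (φ x) w.1 w.2) (fun x hx => by
        refine le_trans ?_ (hf.norm_sum_constituent_le m (w.2 - w.1) x (addDeriv m (φ x) w.1 w.2))
        refine le_trans ?_ (hXw x hx).2
        rw [hL1]
        have h3 : η' ≤ ε ^ 2 := pow_anti hε0 hε' (by norm_num)
        have h4 : 0 ≤ (N : ℝ) ^ 2 := by positivity
        nlinarith [pow_pos hε0 2]) with h1 | ⟨X', hX', hX'c, hX'm⟩
    · exact absurd h1 (not_le.2 hNk)
    · refine hX'c.trans ?_
      refine Nat.cast_le.2 (Finset.card_le_card fun x hx => ?_)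
      rw [hM, Finset.mem_filter]
      exact ⟨(Finset.mem_filter.1 (hX' hx)).1, (hXw x (hX' hx)).1, hX'm x hx⟩
  have hsum : (n ^ m) * (η' ^ (k + 1) * (N * n ^ m)) ≤
      ∑ v ∈ cube m I, ∑ u ∈ cube m I, ((M u v).card : ℝ) := by
    rw [← Finset.sum_product_right' (f := fun u v => ((M u v).card : ℝ))]
    calc (n ^ m) * (η' ^ (k + 1) * (N * n ^ m)) =
          (ε ^ (2 * 2) * ((cube m I ×ˢ cube m I).card : ℝ)) * (η' ^ k * N) := by
          rw [Finset.card_product]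
          push_cast
          rw [hcube, hη1]
          ring
      _ ≤ P.card * (η' ^ k * N) := by gcongr
      _ ≤ ∑ w ∈ P, ((M w.1 w.2).card : ℝ) := by
          rw [← nsmul_eq_mul]
          exact Finset.card_nsmul_le_sum _ _ _ hkey
      _ ≤ _ := Finset.sum_le_sum_of_subset_of_nonneg (Finset.filter_subset _ _)
          fun _ _ _ => by positivity
  -- Only $v$ is fixed; $u$ remains free, since it is the argument of the frequency function to be
  -- described.
  obtain ⟨v, -, hv⟩ := exists_le_sum_of_le_sum (cube m I) _ hcube.le (by positivity)
    (by positivity) hsum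
  have hexp : η' ^ (k + 1) = η ^ (a * (4 * (k + 1))) := by
    rw [hη1, hε, ← pow_mul, ← pow_mul]
  refine ⟨v, H.filter fun q => IsMajor (η'⁻¹ ^ k) N (addDeriv m (φ q.1) q.2 v),
    Finset.filter_subset _ _, ?_, fun q hq => ?_⟩
  · rw [← hexp]
    refine hv.trans (le_of_eq ?_)
    have h5 : H.filter (fun q => IsMajor (η'⁻¹ ^ k) N (addDeriv m (φ q.1) q.2 v)) =
        (Finset.Icc (1 : ℤ) N ×ˢ cube m I).filter fun q => q ∈ H ∧
          IsMajor (η'⁻¹ ^ k) N (addDeriv m (φ q.1) q.2 v) := by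
      rw [← Finset.filter_filter, Finset.filter_mem_eq_inter, Finset.inter_eq_right.2 hH]
    rw [h5, Finset.card_filter, Finset.sum_product_right]
    push_cast
    refine Finset.sum_congr rfl fun u _ => ?_
    simp only [hM, Finset.card_filter]
    push_cast
    rfl
  · refine (Finset.mem_filter.1 hq).2.mono ?_
    rw [hη1, hε, ← inv_pow, ← inv_pow, ← pow_mul, ← pow_mul]
    exact inv_pow_le_of_le hη hη' (Nat.mul_le_mul_left _ (by omega))

theorem IsAdmissible.norm_derivCorr_sub_le {N : ℕ} {f₀ f₁ : ℤ × ℤ → ℂ}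
    (hf : IsAdmissible N f₀ f₁) (m : ℕ) (x : ℤ) (h : Fin m → ℤ) (θ θ' : UnitAddCircle) {ρ : ℝ}
    (hθ : ‖θ - θ'‖ ≤ ρ / (N : ℝ) ^ 2) :
    ‖derivCorr N f₀ f₁ m x h θ‖ ≤ ‖derivCorr N f₀ f₁ m x h θ'‖ + 14 * ρ * (2 * N ^ 2 : ℕ) := by
  have hN0 : (1 : ℝ) ≤ N := by exact_mod_cast hf.one_le
  have h1 : ‖derivCorr N f₀ f₁ m x h θ - derivCorr N f₀ f₁ m x h θ'‖ ≤
      14 * ρ * (2 * N ^ 2 : ℕ) := by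
    rw [derivCorr, derivCorr, ← Finset.sum_sub_distrib]
    refine (norm_sum_le _ _).trans ?_
    calc _ ≤ ∑ y ∈ Finset.Icc (1 : ℤ) (2 * N ^ 2 : ℕ), 14 * ρ := by
          refine Finset.sum_le_sum fun y hy => ?_
          rw [← mul_sub, norm_mul, norm_conjIter]
          refine (mul_le_of_le_one_left (norm_nonneg _)
            (((hf.isBddOn_dualFun x).iterDiffFun m h).norm_le y)).trans ?_
          refine (norm_e_sub_e_le _ _).trans ?_
          rw [← smul_sub]
          have h2 := norm_zsmul_le_abs y (θ - θ')
          rw [Finset.mem_Icc] at hy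
          have h3 : |(y : ℝ)| ≤ 2 * (N : ℝ) ^ 2 := by
            rw [abs_of_nonneg (by exact_mod_cast (by omega : (0 : ℤ) ≤ y))]
            exact_mod_cast hy.2
          have h4 : |(y : ℝ)| * ‖θ - θ'‖ ≤ 2 * (N : ℝ) ^ 2 * (ρ / (N : ℝ) ^ 2) := by gcongr
          have h5 : 2 * (N : ℝ) ^ 2 * (ρ / (N : ℝ) ^ 2) = 2 * ρ := by field_simp
          linarith
      _ = _ := by
          rw [Finset.sum_const, nsmul_eq_mul, Int.card_Icc, add_sub_cancel_right,
            Int.toNat_natCast, mul_comm]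
  have := norm_sub_norm_le (derivCorr N f₀ f₁ m x h θ) (derivCorr N f₀ f₁ m x h θ')
  linarith

/-- Up to a constant in a major arc, the phase functions may be taken to be sums of functions
independent of one of the differencing parameters. -/
theorem exists_lower_order_phase (m : ℕ) : ∃ k : ℕ, ∀ (N : ℕ) (f₀ f₁ : ℤ × ℤ → ℂ),
    IsAdmissible N f₀ f₁ → ∀ (η : ℝ), 0 < η → η ≤ 1 / 2 →
    ∀ (φ : ℤ → (Fin m → ℤ) → UnitAddCircle) (H : Finset (ℤ × (Fin m → ℤ))),
    H ⊆ Finset.Icc (1 : ℤ) N ×ˢ cube m (diffRange (2 * N ^ 2)) →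
    η * (N * ((diffRange (2 * N ^ 2)).card : ℝ) ^ m) ≤ H.card →
    (∀ p ∈ H, η * (2 * N ^ 2 : ℕ) ≤ ‖derivCorr N f₀ f₁ m p.1 p.2 (φ p.1 p.2)‖) →
    (N : ℝ) ≤ η⁻¹ ^ k ∨ ∃ α, IsMajor (η⁻¹ ^ k) N α ∧
      ∃ ψ : ℤ → Fin m → (Fin m → ℤ) → UnitAddCircle, (∀ x i, IndepOf i (ψ x i)) ∧
      η ^ k * (N * ((diffRange (2 * N ^ 2)).card : ℝ) ^ m * ((2 * N ^ 2 : ℕ) : ℝ) ^ 2) ≤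
        ∑ x ∈ Finset.Icc (1 : ℤ) N, ∑ h ∈ cube m (diffRange (2 * N ^ 2)),
          ‖derivCorr N f₀ f₁ m x h (α + ∑ i, ψ x i h)‖ ^ 2 := by
  classical
  obtain ⟨k, hk⟩ := exists_major_derivative m
  refine ⟨(k + 6) * 8 + 4, fun N f₀ f₁ hf η hη hη' φ H hH hHc hφ => ?_⟩
  rw [or_iff_not_imp_left, not_le]
  intro hN
  have hN0 : (1 : ℝ) ≤ N := by exact_mod_cast hf.one_le
  rcases hk N f₀ f₁ hf η hη hη' φ H hH hHc hφ with h1 | ⟨v, H', hH', hH'c, hmaj⟩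
  · exact absurd h1 (not_le.2 (lt_of_le_of_lt (inv_pow_le_of_le hη hη' (by omega)) hN))
  -- The extra 6 makes $K^{-1}\le\eta^6$, the mesh requested from the net.
  set K := η⁻¹ ^ (k + 6) with hK
  have hK2 : 2 ≤ K := by
    have h3 : 2 * η⁻¹ ^ 0 ≤ η⁻¹ ^ (k + 6) :=
      (two_mul_inv_pow_le hη hη' 0).trans (inv_pow_le_of_le hη hη' (by omega))
    rwa [pow_zero, mul_one] at h3
  have hmaj' : ∀ p ∈ H', IsMajor K N (addDeriv m (φ p.1) p.2 v) := fun p hp =>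
    (hmaj p hp).mono (inv_pow_le_of_le hη hη' (by omega))
  obtain ⟨A, hA, hA'⟩ := exists_major_net (ρ := η ^ 6) hK2
    (by rw [hK, ← inv_pow, inv_inv]; exact pow_anti hη hη' (by omega)) hf.one_le
  have hn0 : (1 : ℝ) ≤ (diffRange (2 * N ^ 2)).card := one_le_card_diffRange hf.one_le
  have hH'ne : H'.Nonempty := by
    rw [← Finset.card_pos]
    have : (0 : ℝ) < H'.card := lt_of_lt_of_le (by positivity) hH'c
    exact_mod_cast this
  have hex : ∀ p : ℤ × (Fin m → ℤ), ∃ α, p ∈ H' →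
      α ∈ A ∧ ‖addDeriv m (φ p.1) p.2 v - α‖ ≤ η ^ 6 / (N : ℝ) ^ 2 := by
    intro p
    by_cases hp : p ∈ H'
    · obtain ⟨α, h3, h4⟩ := hA' _ (hmaj' p hp)
      exact ⟨α, fun _ => ⟨h3, h4⟩⟩
    · exact ⟨0, fun h => absurd h hp⟩
  choose f hf' using hex
  obtain ⟨α, -, hα⟩ := exists_large_fiber H' A f (fun x hx => (hf' x hx).1)
    (by positivity : (0 : ℝ) < K ^ 7) hA hH'ne
  set H'' := H'.filter fun p => f p = α with hH''
  have hclose : ∀ p ∈ H'', ‖addDeriv m (φ p.1) p.2 v - α‖ ≤ η ^ 6 / (N : ℝ) ^ 2 := by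
    intro p hp
    obtain ⟨h3, h4⟩ := Finset.mem_filter.1 hp
    have := (hf' p h3).2
    rwa [h4] at this
  have hcard : η ^ ((k + 6) * 8) * (N * ((diffRange (2 * N ^ 2)).card : ℝ) ^ m) ≤ H''.card := by
    refine le_trans ?_ hα
    calc η ^ ((k + 6) * 8) * (N * ((diffRange (2 * N ^ 2)).card : ℝ) ^ m)
        ≤ η ^ ((k + 6) * 7 + k) * (N * ((diffRange (2 * N ^ 2)).card : ℝ) ^ m) := by
          gcongr ?_ * _
          exact pow_anti hη hη' (by omega)
      _ = (K ^ 7)⁻¹ * (η ^ k * (N * ((diffRange (2 * N ^ 2)).card : ℝ) ^ m)) := by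
          rw [hK, ← inv_pow, ← inv_pow, inv_inv]
          ring
      _ ≤ _ := by gcongr
  have hH''ne : H''.Nonempty := by
    rw [← Finset.card_pos]
    have : (0 : ℝ) < H''.card := lt_of_lt_of_le (by positivity) hcard
    exact_mod_cast this
  choose ψ hψ1 hψ2 using fun x => exists_addDeriv_eq m (φ x) v
  refine ⟨α, ?_, fun x i h => -ψ x i h, fun x i h a => congrArg Neg.neg (hψ1 x i h a), ?_⟩
  · obtain ⟨p, hp⟩ := hH''ne
    refine ((hmaj' p (Finset.mem_filter.1 hp).1).of_close ((hclose p hp).trans ?_)).mono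
      ((two_mul_inv_pow_le hη hη' (k + 6)).trans (inv_pow_le_of_le hη hη' (by omega)))
    gcongr
    exact pow_le_one₀ hη.le (by linarith)
  · have hlow : ∀ p ∈ H'', η ^ 4 * ((2 * N ^ 2 : ℕ) : ℝ) ^ 2 ≤
        ‖derivCorr N f₀ f₁ m p.1 p.2 (α + ∑ i, -ψ p.1 i p.2)‖ ^ 2 := by
      intro p hp
      have h3 := hφ p (hH' (Finset.mem_filter.1 hp).1)
      have h4 := hclose p hp
      rw [hψ2] at h4
      have h5 : φ p.1 p.2 - (α + ∑ i, -ψ p.1 i p.2) = φ p.1 p.2 + ∑ i, ψ p.1 i p.2 - α := by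
        rw [Finset.sum_neg_distrib]
        abel
      have h6 := hf.norm_derivCorr_sub_le m p.1 p.2 (φ p.1 p.2) (α + ∑ i, -ψ p.1 i p.2)
        (by rw [h5]; exact h4)
      -- Moving the frequency by $\eta^6/N^2$ costs $14\eta^6$ relative to the trivial bound,
      -- leaving a correlation of size $\eta^2$.
      have h7 : η ^ 2 + 14 * η ^ 6 ≤ η := by
        have h8 : η ^ 5 ≤ (1 / 2) ^ 5 := by gcongr
        nlinarith
      have h9 : (0 : ℝ) ≤ (2 * N ^ 2 : ℕ) := by positivity
      calc η ^ 4 * ((2 * N ^ 2 : ℕ) : ℝ) ^ 2 = (η ^ 2 * (2 * N ^ 2 : ℕ)) ^ 2 := by ring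
        _ ≤ _ := by
          gcongr
          nlinarith
    rw [← Finset.sum_product' (f := fun x h =>
      ‖derivCorr N f₀ f₁ m x h (α + ∑ i, -ψ x i h)‖ ^ 2)]
    calc η ^ ((k + 6) * 8 + 4) *
          (N * ((diffRange (2 * N ^ 2)).card : ℝ) ^ m * ((2 * N ^ 2 : ℕ) : ℝ) ^ 2)
        = (η ^ ((k + 6) * 8) * (N * ((diffRange (2 * N ^ 2)).card : ℝ) ^ m)) *
          (η ^ 4 * ((2 * N ^ 2 : ℕ) : ℝ) ^ 2) := by ring
      _ ≤ H''.card * (η ^ 4 * ((2 * N ^ 2 : ℕ) : ℝ) ^ 2) := by gcongr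
      _ ≤ ∑ p ∈ H'', ‖derivCorr N f₀ f₁ m p.1 p.2 (α + ∑ i, -ψ p.1 i p.2)‖ ^ 2 := by
          rw [← nsmul_eq_mul]
          exact Finset.card_nsmul_le_sum _ _ _ hlow
      _ ≤ _ := Finset.sum_le_sum_of_subset_of_nonneg
          (((Finset.filter_subset _ _).trans hH').trans hH) fun _ _ _ => by positivity

/-! ### Removing lower order phases -/

/-- For a fixed first coordinate the differences are distinct, so each inner sum is part of the full
nonnegative sum over $k$. -/
theorem sum_gowersSum_diffFun_le {G : ℤ → ℂ} (hG : G.support.Finite) (m : ℕ) (I : Finset ℤ) :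
    ∑ q ∈ I ×ˢ I, gowersSum m (diffFun (q.2 - q.1) G) ≤ I.card * gowersSum (m + 1) G := by
  rw [Finset.sum_product, ← nsmul_eq_mul, ← Finset.sum_const]
  refine Finset.sum_le_sum fun a _ => ?_
  have h1 : Summable fun a' => gowersSum m (diffFun (a' - a) G) :=
    (Equiv.subRight a).summable_iff.2 (summable_gowersSum hG m)
  refine (h1.sum_le_tsum I fun _ _ => gowersSum_nonneg _ _).trans (le_of_eq ?_)
  exact (Equiv.subRight a).tsum_eq fun k => gowersSum m (diffFun k G)

theorem exists_finset_support_shift {G : ℤ → ℂ} (hG : G.support.Finite) (m : ℕ) (I : Finset ℤ) :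
    ∃ T : Finset ℤ, I ⊆ T ∧ ∀ t ∉ T, ∀ a ∈ I, ∀ h ∈ cube m I, G (t + (a + ∑ i, h i)) = 0 := by
  classical
  refine ⟨I ∪ (I ×ˢ cube m I).biUnion fun q =>
    hG.toFinset.image fun z => z - (q.1 + ∑ i, q.2 i), Finset.subset_union_left, ?_⟩
  intro t ht a ha h hh
  by_contra hcon
  refine ht (Finset.mem_union_right _ (Finset.mem_biUnion.2 ⟨(a, h), Finset.mem_product.2 ⟨ha, hh⟩,
    Finset.mem_image.2 ⟨t + (a + ∑ i, h i), ?_, by ring⟩⟩))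
  simpa using hcon

/-- The cut-off of `b 0` confines $t$ to `I`, which keeps Cauchy–Schwarz over $(h,t)$ affordable.
Once squared, the sum is nonnegative and $t$ is released to all integers; this matters because no
cut-off is left when the last `b` has gone. -/
theorem cauchy_schwarz_line_step {G : ℤ → ℂ} (hG : G.support.Finite) (m : ℕ) (I : Finset ℤ)
    (c : (Fin (m + 1) → ℤ) → ℂ) (b : Fin (m + 1) → ℤ → (Fin (m + 1) → ℤ) → ℂ)
    (hb : ∀ i t h, ‖b i t h‖ ≤ 1) (hind : ∀ i t, IndepOf i (b i t))
    (hb0 : ∀ i t h, t ∉ I → b i t h = 0) :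
    ‖∑ h ∈ cube (m + 1) I, ∑' t, G (t + ∑ i, h i) * c h * ∏ i, b i t h‖ ^ 2 ≤
      (I.card : ℝ) ^ (m + 1) * ∑ q ∈ I ×ˢ I, ‖∑ h ∈ cube m I, ∑' t,
        diffFun (q.2 - q.1) G (t + ∑ i, h i + q.1) *
          (c (Fin.cons q.1 h) * conj (c (Fin.cons q.2 h))) *
          ∏ i : Fin m, (b i.succ t (Fin.cons q.1 h) * conj (b i.succ t (Fin.cons q.2 h)))‖ := by
  obtain ⟨T, hIT, hT⟩ := exists_finset_support_shift hG m I
  set X : (Fin m → ℤ) → ℤ → ℂ := fun h t => ∑ a ∈ I, G (t + (a + ∑ i, h i)) * c (Fin.cons a h) *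
    ∏ i : Fin m, b i.succ t (Fin.cons a h) with hX
  have h1 : ∑ h ∈ cube (m + 1) I, ∑' t, G (t + ∑ i, h i) * c h * ∏ i, b i t h =
      ∑ z ∈ cube m I ×ˢ I, b 0 z.2 (Fin.cons 0 z.1) * X z.1 z.2 := by
    have h2 : ∀ h : Fin (m + 1) → ℤ, ∑' t, G (t + ∑ i, h i) * c h * ∏ i, b i t h =
        ∑ t ∈ I, G (t + ∑ i, h i) * c h * ∏ i, b i t h := by
      intro h
      refine tsum_eq_sum fun t ht => ?_
      rw [Fin.prod_univ_succ, hb0 0 t h ht, zero_mul, mul_zero]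
    simp only [h2]
    rw [sum_cube_succ, Finset.sum_comm, Finset.sum_product]
    refine Finset.sum_congr rfl fun h _ => ?_
    rw [Finset.sum_comm]
    refine Finset.sum_congr rfl fun t _ => ?_
    rw [hX, Finset.mul_sum]
    refine Finset.sum_congr rfl fun a _ => ?_
    rw [Fin.prod_univ_succ, Fin.sum_univ_succ, (hind 0 t).cons_zero a 0]
    simp only [Fin.cons_zero, Fin.cons_succ]
    ring
  have h3 := norm_sum_mul_sq_le (cube m I ×ˢ I) (fun z => b 0 z.2 (Fin.cons 0 z.1))
    (fun z => X z.1 z.2) fun z => hb _ _ _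
  rw [← h1, Finset.card_product, card_cube, ← pow_succ] at h3
  push_cast at h3
  refine h3.trans ?_
  gcongr
  have h4 : ∑ z ∈ cube m I ×ˢ I, ‖X z.1 z.2‖ ^ 2 ≤ ∑ h ∈ cube m I, ∑ t ∈ T, ‖X h t‖ ^ 2 := by
    rw [Finset.sum_product]
    exact Finset.sum_le_sum fun h _ =>
      Finset.sum_le_sum_of_subset_of_nonneg hIT fun _ _ _ => by positivity
  refine h4.trans ?_
  have h5 : ((∑ h ∈ cube m I, ∑ t ∈ T, ‖X h t‖ ^ 2 : ℝ) : ℂ) =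
      ∑ q ∈ I ×ˢ I, ∑ h ∈ cube m I, ∑' t,
        diffFun (q.2 - q.1) G (t + ∑ i, h i + q.1) *
          (c (Fin.cons q.1 h) * conj (c (Fin.cons q.2 h))) *
          ∏ i : Fin m, (b i.succ t (Fin.cons q.1 h) * conj (b i.succ t (Fin.cons q.2 h))) := by
    push_cast
    rw [Finset.sum_comm (s := I ×ˢ I)]
    refine Finset.sum_congr rfl fun h hh => ?_
    have h6 : ∀ q ∈ I ×ˢ I, ∑' t, diffFun (q.2 - q.1) G (t + ∑ i, h i + q.1) *
          (c (Fin.cons q.1 h) * conj (c (Fin.cons q.2 h))) *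
          ∏ i : Fin m, (b i.succ t (Fin.cons q.1 h) * conj (b i.succ t (Fin.cons q.2 h))) =
        ∑ t ∈ T, diffFun (q.2 - q.1) G (t + ∑ i, h i + q.1) *
          (c (Fin.cons q.1 h) * conj (c (Fin.cons q.2 h))) *
          ∏ i : Fin m, (b i.succ t (Fin.cons q.1 h) * conj (b i.succ t (Fin.cons q.2 h))) := by
      intro q hq
      refine tsum_eq_sum fun t ht => ?_
      have h7 := hT t ht q.1 (Finset.mem_product.1 hq).1 h hh
      have h8 : t + ∑ i, h i + q.1 = t + (q.1 + ∑ i, h i) := by ring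
      rw [diffFun, h8, h7]
      simp
    rw [Finset.sum_congr rfl h6, Finset.sum_comm]
    refine Finset.sum_congr rfl fun t _ => ?_
    rw [← Complex.ofReal_pow, norm_sum_sq_eq, Finset.sum_product]
    refine Finset.sum_congr rfl fun a _ => Finset.sum_congr rfl fun a' _ => ?_
    have h8 : t + ∑ i, h i + a = t + (a + ∑ i, h i) := by ring
    have h9 : t + (a + ∑ i, h i) + (a' - a) = t + (a' + ∑ i, h i) := by ring
    simp only [diffFun, h8, h9]
    rw [Finset.prod_mul_distrib, map_mul, map_mul, map_prod]
    ring
  calc ∑ h ∈ cube m I, ∑ t ∈ T, ‖X h t‖ ^ 2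
      = ‖((∑ h ∈ cube m I, ∑ t ∈ T, ‖X h t‖ ^ 2 : ℝ) : ℂ)‖ := by
        rw [Complex.norm_real, Real.norm_of_nonneg (by positivity)]
    _ ≤ _ := by
        rw [h5]
        exact norm_sum_le _ _

/-- The Gowers norm `U^{m+1}` controls averages of `G(t + h₁ + ⋯ + h_m)` against functions each of
which is independent of one of the variables. -/
theorem gowers_cauchy_schwarz (m : ℕ) {G : ℤ → ℂ} (hG : G.support.Finite) (I : Finset ℤ)
    (c : (Fin m → ℤ) → ℂ) (hc : ∀ h, ‖c h‖ ≤ 1) (b : Fin m → ℤ → (Fin m → ℤ) → ℂ)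
    (hb : ∀ i t h, ‖b i t h‖ ≤ 1) (hind : ∀ i t, IndepOf i (b i t))
    (hb0 : ∀ i t h, t ∉ I → b i t h = 0) :
    ‖∑ h ∈ cube m I, ∑' t, G (t + ∑ i, h i) * c h * ∏ i, b i t h‖ ^ 2 ^ (m + 1) *
      (I.card : ℝ) ^ (m + 2) ≤ (I.card : ℝ) ^ ((m + 1) * 2 ^ (m + 1)) * gowersSum m G := by
  induction m generalizing G with
  | zero =>
    simp only [sum_cube_zero, Finset.univ_eq_empty, Finset.sum_empty, add_zero, Finset.prod_empty,
      mul_one, gowersSum]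
    rw [tsum_mul_right, mul_comm]
    refine mul_le_mul_of_nonneg_left ?_ (by positivity)
    rw [zero_add, pow_one, norm_mul]
    gcongr
    exact mul_le_of_le_one_right (norm_nonneg _) (hc _)
  | succ m ih =>
    set p : ℕ := 2 ^ (m + 1) with hp
    set n : ℝ := (I.card : ℝ) with hn
    have hp0 : p ≠ 0 := by positivity
    have hn0 : 0 ≤ n := by positivity
    have h1 := cauchy_schwarz_line_step hG m I c b hb hind hb0
    set Z : ℤ × ℤ → ℂ := fun q => ∑ h ∈ cube m I, ∑' t,
        diffFun (q.2 - q.1) G (t + ∑ i, h i + q.1) *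
          (c (Fin.cons q.1 h) * conj (c (Fin.cons q.2 h))) *
          ∏ i : Fin m, (b i.succ t (Fin.cons q.1 h) * conj (b i.succ t (Fin.cons q.2 h))) with hZ
    have h2 : ∀ q, ‖Z q‖ ^ p * n ^ (m + 2) ≤
        n ^ ((m + 1) * p) * gowersSum m (diffFun (q.2 - q.1) G) := by
      intro q
      rw [← gowersSum_translate m (diffFun (q.2 - q.1) G) q.1]
      refine ih (G := fun z => diffFun (q.2 - q.1) G (z + q.1)) ?_
        (fun h => c (Fin.cons q.1 h) * conj (c (Fin.cons q.2 h))) (fun h => ?_)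
        (fun i t h => b i.succ t (Fin.cons q.1 h) * conj (b i.succ t (Fin.cons q.2 h)))
        (fun i t h => ?_) (fun i t => ?_) (fun i t h ht => ?_)
      · exact (finite_support_diffFun hG _).preimage (add_left_injective q.1).injOn
      · rw [norm_mul, RCLike.norm_conj]
        exact mul_le_one₀ (hc _) (norm_nonneg _) (hc _)
      · rw [norm_mul, RCLike.norm_conj]
        exact mul_le_one₀ (hb _ _ _) (norm_nonneg _) (hb _ _ _)
      · exact ((hind i.succ t).cons_succ _).mul_conj ((hind i.succ t).cons_succ _)
      · rw [hb0 _ _ _ ht, zero_mul]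
    have h3 := pow_sum_mul_card_le (I ×ˢ I) (fun q => ‖Z q‖) (fun _ _ => norm_nonneg _) hp0
    rw [Finset.card_product] at h3
    push_cast at h3
    rw [← hn] at h3
    have h4 := sum_gowersSum_diffFun_le hG m I
    rw [← hn] at h4
    -- Below, one factor $n$ is added to match the $n^2$ pairs and cancelled at the end, which
    -- requires $n\ne 0$.
    rcases hn0.eq_or_lt with hn1 | hn1
    · rw [← hn1, zero_pow (by omega), zero_pow (by positivity), mul_zero, zero_mul]
    have hpp : 2 ^ (m + 1 + 1) = 2 * p := by rw [hp]; ring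
    rw [hpp, pow_mul]
    refine le_of_mul_le_mul_left ?_ hn1
    calc n * ((‖∑ h ∈ cube (m + 1) I, ∑' t, G (t + ∑ i, h i) * c h * ∏ i, b i t h‖ ^ 2) ^ p *
          n ^ (m + 1 + 2))
        ≤ n * ((n ^ (m + 1) * ∑ q ∈ I ×ˢ I, ‖Z q‖) ^ p * n ^ (m + 1 + 2)) := by gcongr
      _ = n ^ ((m + 1) * p) * n ^ (m + 2) * ((∑ q ∈ I ×ˢ I, ‖Z q‖) ^ p * (n * n)) := by
          rw [mul_pow, ← pow_mul]; ring
      _ ≤ n ^ ((m + 1) * p) * n ^ (m + 2) * ((n * n) ^ p * ∑ q ∈ I ×ˢ I, ‖Z q‖ ^ p) := by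
          gcongr
      _ = n ^ ((m + 1) * p) * (n * n) ^ p * ∑ q ∈ I ×ˢ I, ‖Z q‖ ^ p * n ^ (m + 2) := by
          rw [← Finset.sum_mul]; ring
      _ ≤ n ^ ((m + 1) * p) * (n * n) ^ p * ∑ q ∈ I ×ˢ I,
          n ^ ((m + 1) * p) * gowersSum m (diffFun (q.2 - q.1) G) :=
          mul_le_mul_of_nonneg_left (Finset.sum_le_sum fun q _ => h2 q) (by positivity)
      _ ≤ n ^ ((m + 1) * p) * (n * n) ^ p * (n ^ ((m + 1) * p) * (n * gowersSum (m + 1) G)) := by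
          rw [← Finset.mul_sum]
          gcongr
      _ = _ := by ring

/-- A derivative of `f` twisted by phases of lower order is controlled by a Gowers norm. -/
theorem norm_sum_twisted_le (m : ℕ) {L : ℕ} {E : ℤ → ℂ} (hE : IsBddOn L E) (y k : ℤ)
    (α : UnitAddCircle) (ψ : Fin (m + 1) → (Fin (m + 1) → ℤ) → UnitAddCircle)
    (hψ : ∀ i, IndepOf i (ψ i)) :
    ‖∑ h ∈ cube (m + 1) (diffRange L), conjIter (m + 1) (iterDiffFun (m + 1) h E y) *
        e (k • (-(α + ∑ i, ψ i h)))‖ ^ 2 ^ (m + 1) * ((diffRange L).card : ℝ) ^ (m + 2) ≤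
      ((diffRange L).card : ℝ) ^ ((m + 1) * 2 ^ (m + 1)) * gowersSum m E := by
  classical
  set I := diffRange L with hI
  choose β hβ1 hβ2 hβ3 using fun z => exists_top_factor m E hE.norm_le z
  -- The first differencing variable plays the part of the base point $t$. Everything free of it,
  -- including $\psi_0$, goes into $c$; each other $\psi_i$ joins the factor of $\Delta_h E(y+t)$
  -- that ignores the same coordinate.
  set c : (Fin m → ℤ) → ℂ := fun h => e (k • (-α)) * e (k • (-ψ 0 (Fin.cons 0 h))) *
    conj (conjIter m (iterDiffFun m h E y)) with hc
  set b : Fin m → ℤ → (Fin m → ℤ) → ℂ := fun i t h =>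
    (if t ∈ I then 1 else 0) * (e (k • (-ψ i.succ (Fin.cons t h))) * β (y + t) i h) with hb
  have hfin : (fun z => E (z + y)).support.Finite :=
    hE.finite_support.preimage (add_left_injective y).injOn
  have key := gowers_cauchy_schwarz m hfin I c (fun h => ?_) b (fun i t h => ?_) (fun i t => ?_)
    (fun i t h ht => ?_)
  · rw [gowersSum_translate] at key
    convert! key using 4
    rw [sum_cube_succ, Finset.sum_comm]
    refine Finset.sum_congr rfl fun h _ => ?_
    have hterm : ∀ t, E (t + ∑ i, h i + y) * c h * ∏ i, b i t h =
        (∏ _i : Fin m, if t ∈ I then (1 : ℂ) else 0) *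
        (conjIter (m + 1) (iterDiffFun (m + 1) (Fin.cons t h : Fin (m + 1) → ℤ) E y) *
          e (k • (-(α + ∑ i, ψ i (Fin.cons t h))))) := by
      intro t
      have h1 : conjIter (m + 1) (iterDiffFun (m + 1) (Fin.cons t h : Fin (m + 1) → ℤ) E y) =
          conj (conjIter m (iterDiffFun m h E y)) * conjIter m (iterDiffFun m h E (y + t)) := by
        simp [conjIter, iterDiffFun, diffFun, conjIter_conj]
      have h2 : e (k • (-(α + ∑ i, ψ i (Fin.cons t h)))) =
          e (k • (-α)) * e (k • (-ψ 0 (Fin.cons 0 h))) *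
            ∏ i : Fin m, e (k • (-ψ i.succ (Fin.cons t h))) := by
        rw [← e_sum, ← e_add, ← e_add, Fin.sum_univ_succ, (hψ 0).cons_zero t 0, ← Finset.smul_sum,
          Finset.sum_neg_distrib]
        congr 1
        module
      have h3 : t + ∑ i, h i + y = y + t + ∑ i, h i := by ring
      rw [h1, h2, hβ3 (y + t), h3]
      simp only [hb, hc, Finset.prod_mul_distrib]
      ring
    rw [tsum_eq_sum (s := I)]
    · refine Finset.sum_congr rfl fun t ht => ?_
      rw [hterm]
      simp [ht]
    · intro t ht
      rw [hterm]
      have h4 : iterDiffFun (m + 1) (Fin.cons t h : Fin (m + 1) → ℤ) E y = 0 := by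
        rw [iterDiffFun_cons, hE.diffFun_eq_zero ht]
        exact iterDiffFun_eq_zero rfl _ _
      rw [h4, map_zero, zero_mul, mul_zero]
  · simp only [hc, norm_mul, norm_e, one_mul, RCLike.norm_conj, norm_conjIter]
    exact (hE.iterDiffFun m h).norm_le y
  · simp only [hb, norm_mul, norm_e, one_mul]
    refine mul_le_one₀ ?_ (norm_nonneg _) (hβ1 _ _ _)
    split_ifs <;> simp
  · intro h a
    simp only [hb]
    have h5 := (hψ i.succ).cons_succ t h a
    rw [hβ2 _ _ h a]
    simp only at h5
    rw [h5]
  · simp [hb, ht]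

/-! ### Degree lowering -/

theorem gowersSum_conjIter (m s : ℕ) (f : ℤ → ℂ) :
    gowersSum s (fun y => conjIter m (f y)) = gowersSum s f := by
  induction m with
  | zero => rfl
  | succ m ih =>
    rw [← ih, ← gowersSum_conj s fun y => conjIter m (f y)]
    rfl

theorem diffFun_conjIter (m : ℕ) (k : ℤ) (f : ℤ → ℂ) :
    diffFun k (fun y => conjIter m (f y)) = fun y => conjIter m (diffFun k f y) := by
  funext y
  simp only [diffFun, map_mul, conjIter_conj]

theorem IsBddOn.conjIter {L : ℕ} {f : ℤ → ℂ} (hf : IsBddOn L f) (m : ℕ) :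
    IsBddOn L fun y => conjIter m (f y) :=
  ⟨fun y => (norm_conjIter m _).trans_le (hf.norm_le y), fun y hy => by
    rw [hf.eq_zero y hy, map_zero]⟩

section

variable {N : ℕ} {f₀ f₁ : ℤ × ℤ → ℂ}

theorem IsAdmissible.norm_derivCorr_le (hf : IsAdmissible N f₀ f₁) (m : ℕ) (x : ℤ)
    (h : Fin m → ℤ) (θ : UnitAddCircle) :
    ‖derivCorr N f₀ f₁ m x h θ‖ ≤ (2 * N ^ 2 : ℕ) :=
  (((hf.isBddOn_dualFun x).iterDiffFun m h).conjIter m).norm_sum_le fun y => y • θ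

theorem card_diffRange_le (N : ℕ) : ((diffRange (2 * N ^ 2)).card : ℝ) ≤ 4 * (N : ℝ) ^ 2 := by
  rw [card_diffRange]
  calc ((2 * (2 * N ^ 2) - 1 : ℕ) : ℝ) ≤ ((4 * N ^ 2 : ℕ) : ℝ) := by
        exact_mod_cast (by omega)
    _ = _ := by push_cast; ring

theorem sq_le_card_diffRange (hN : 1 ≤ N) : (N : ℝ) ^ 2 ≤ (diffRange (2 * N ^ 2)).card := by
  rw [card_diffRange]
  have : 1 ≤ N ^ 2 := Nat.one_le_pow _ _ hN
  exact_mod_cast (by omega : N ^ 2 ≤ 2 * (2 * N ^ 2) - 1)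

/-- If the dual function has large Gowers norm, then many of its derivatives correlate with a
linear phase. -/
theorem IsAdmissible.exists_many_derivCorr (hf : IsAdmissible N f₀ f₁) (m : ℕ) {δ : ℝ}
    (hδ : 0 < δ) (hδ' : δ ≤ 1 / 2)
    (h : δ * (N * ((N : ℝ) ^ 2) ^ (m + 3)) ≤
      ∑ x ∈ Finset.Icc (1 : ℤ) N, gowersSum (m + 1) fun y => dualFun N f₀ f₁ (x, y)) :
    ∃ (φ : ℤ → (Fin m → ℤ) → UnitAddCircle) (H : Finset (ℤ × (Fin m → ℤ))),
      H ⊆ Finset.Icc (1 : ℤ) N ×ˢ cube m (diffRange (2 * N ^ 2)) ∧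
      (δ ^ (2 * m + 4)) ^ 2 * (N * ((diffRange (2 * N ^ 2)).card : ℝ) ^ m) ≤ H.card ∧
      ∀ p ∈ H, (δ ^ (2 * m + 4)) ^ 2 * (2 * N ^ 2 : ℕ) ≤
        ‖derivCorr N f₀ f₁ m p.1 p.2 (φ p.1 p.2)‖ := by
  classical
  have hN0 : (0 : ℝ) < N := by exact_mod_cast hf.one_le
  set L : ℕ := 2 * N ^ 2 with hL
  have hLN : (L : ℝ) = 2 * (N : ℝ) ^ 2 := by rw [hL]; push_cast; ring
  have hL0 : (0 : ℝ) < L := by rw [hLN]; positivity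
  set n : ℝ := ((diffRange L).card : ℝ) with hn
  have hn4 : n ≤ 4 * (N : ℝ) ^ 2 := card_diffRange_le N
  have hn0 : 0 ≤ n := Nat.cast_nonneg _
  choose φ hφ using fun (x : ℤ) (h : Fin m → ℤ) =>
    (((hf.isBddOn_dualFun x).iterDiffFun m h).conjIter m).exists_fourier
  -- Beyond one power of $\delta$, the remaining $2m+3$ halves absorb $4^m$ from `card_diffRange_le`
  -- and $2^3$ from $L^3=(2N^2)^3$.
  set ε : ℝ := δ ^ (2 * m + 4) with hε
  have hε0 : 0 < ε := by positivity
  have hε2 : ε ≤ 1 / 2 := pow_le_half hδ hδ' (by omega)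
  set A := Finset.Icc (1 : ℤ) N ×ˢ cube m (diffRange L) with hA
  have hAc : (A.card : ℝ) = N * n ^ m := by
    rw [hA, Finset.card_product, card_cube, Int.card_Icc]
    push_cast
    simp [hn]
  set D : ℤ × (Fin m → ℤ) → ℝ := fun p => ‖derivCorr N f₀ f₁ m p.1 p.2 (φ p.1 p.2)‖ with hD
  have hsum : δ * (N * ((N : ℝ) ^ 2) ^ (m + 3)) ≤ L * ∑ p ∈ A, D p ^ 2 := by
    refine h.trans ?_
    rw [hA, Finset.sum_product, Finset.mul_sum]
    refine Finset.sum_le_sum fun x _ => ?_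
    rw [(hf.isBddOn_dualFun x).gowersSum_eq_sum_cube, Finset.mul_sum]
    refine Finset.sum_le_sum fun h _ => ?_
    rw [← gowersSum_conjIter m]
    exact hφ x h
  have hbig : ε * A.card * (L : ℝ) ^ 2 ≤ ∑ p ∈ A, D p ^ 2 := by
    refine le_of_mul_le_mul_left (le_trans ?_ hsum) hL0
    have h1 : δ ^ (2 * m + 3) ≤ (1 / 2) ^ (2 * m + 3) := by gcongr
    calc (L : ℝ) * (ε * A.card * (L : ℝ) ^ 2)
        = δ ^ (2 * m + 3) * (δ * N * n ^ m * (2 * (N : ℝ) ^ 2) ^ 3) := by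
          rw [hAc, hε, hLN]; ring
      _ ≤ (1 / 2) ^ (2 * m + 3) * (δ * N * (4 * (N : ℝ) ^ 2) ^ m * (2 * (N : ℝ) ^ 2) ^ 3) := by
          gcongr
      _ = (1 / 2 : ℝ) ^ (2 * m) * 4 ^ m * (δ * (N * ((N : ℝ) ^ 2) ^ (m + 3))) := by
          rw [mul_pow 4]; ring
      _ = δ * (N * ((N : ℝ) ^ 2) ^ (m + 3)) := by
          rw [pow_mul, ← mul_pow]; norm_num
  have hcard := card_popular A (fun p => D p ^ 2) (B := (L : ℝ) ^ 2) (by positivity) hε0 hε2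
    (fun p _ => by
      have := hf.norm_derivCorr_le m p.1 p.2 (φ p.1 p.2)
      simp only [hD]
      gcongr) hbig
  refine ⟨φ, A.filter fun p => ε ^ 2 * (L : ℝ) ^ 2 ≤ D p ^ 2, Finset.filter_subset _ A, ?_,
    fun p hp => ?_⟩
  · rwa [hAc] at hcard
  · have h1 := (Finset.mem_filter.1 hp).2
    rw [← mul_pow] at h1
    have h2 := le_of_sq_le_sq h1 (norm_nonneg _)
    refine le_trans ?_ h2
    gcongr
    exact pow_le_of_le_one hε0.le (by linarith) (by norm_num)

/-- The phases of lower order can be removed at the cost of passing to a Gowers norm of lower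
degree. -/
theorem IsAdmissible.le_sum_gowersSum (hf : IsAdmissible N f₀ f₁) (m : ℕ) {κ : ℝ} (hκ : 0 < κ)
    (hκ' : κ ≤ 1 / 2) (α : UnitAddCircle)
    (ψ : ℤ → Fin (m + 1) → (Fin (m + 1) → ℤ) → UnitAddCircle) (hψ : ∀ x i, IndepOf i (ψ x i))
    (h : κ * (N * ((diffRange (2 * N ^ 2)).card : ℝ) ^ (m + 1) * ((2 * N ^ 2 : ℕ) : ℝ) ^ 2) ≤
      ∑ x ∈ Finset.Icc (1 : ℤ) N, ∑ h ∈ cube (m + 1) (diffRange (2 * N ^ 2)),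
        ‖derivCorr N f₀ f₁ (m + 1) x h (α + ∑ i, ψ x i h)‖ ^ 2) :
    κ ^ (2 ^ (m + 2)) * (N * ((N : ℝ) ^ 2) ^ (m + 3)) ≤
      ∑ x ∈ Finset.Icc (1 : ℤ) N, gowersSum (m + 1) fun y => dualFun N f₀ f₁ (x, y) := by
  classical
  have hN0 : (0 : ℝ) < N := by exact_mod_cast hf.one_le
  set L : ℕ := 2 * N ^ 2 with hL
  have hLN : (L : ℝ) = 2 * (N : ℝ) ^ 2 := by rw [hL]; push_cast; ring
  have hL0 : (0 : ℝ) < L := by rw [hLN]; positivity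
  set I := diffRange L with hI
  set n : ℝ := (I.card : ℝ) with hn
  have hn4 : n ≤ 2 * L := by rw [hLN]; linarith [card_diffRange_le N]
  have hnN : (N : ℝ) ^ 2 ≤ n := sq_le_card_diffRange hf.one_le
  have hn0 : 0 < n := lt_of_lt_of_le (by positivity) hnN
  set p : ℕ := 2 ^ (m + 1) with hp
  set F : ℤ → ℤ → ℂ := fun x y => dualFun N f₀ f₁ (x, y) with hF
  have hFb : ∀ x, IsBddOn L (F x) := hf.isBddOn_dualFun
  -- Opening the square introduces a further derivative $\Delta_k F_x$. For fixed $x$, $k$ and $y$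
  -- the frequency enters only as a phase in $h$, of the kind that Cauchy–Schwarz removes.
  set Z : ℤ × ℤ × ℤ → ℂ := fun q => ∑ h ∈ cube (m + 1) I,
    conjIter (m + 1) (iterDiffFun (m + 1) h (diffFun q.2.1 (F q.1)) q.2.2) *
      e (q.2.1 • (-(α + ∑ i, ψ q.1 i h))) with hZ
  set Q := Finset.Icc (1 : ℤ) N ×ˢ I ×ˢ Finset.Icc (1 : ℤ) L with hQ
  have hQc : (Q.card : ℝ) = N * n * L := by
    rw [hQ, Finset.card_product, Finset.card_product, Int.card_Icc, Int.card_Icc]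
    push_cast
    simp [hn, mul_assoc]
  have h1 : κ * (N * n ^ (m + 1) * (L : ℝ) ^ 2) ≤ ∑ q ∈ Q, ‖Z q‖ := by
    refine h.trans ?_
    have h2 : ((∑ x ∈ Finset.Icc (1 : ℤ) N, ∑ h ∈ cube (m + 1) I,
        ‖derivCorr N f₀ f₁ (m + 1) x h (α + ∑ i, ψ x i h)‖ ^ 2 : ℝ) : ℂ) = ∑ q ∈ Q, Z q := by
      rw [hQ, Finset.sum_product, Complex.ofReal_sum]
      refine Finset.sum_congr rfl fun x _ => ?_
      rw [Finset.sum_product, Complex.ofReal_sum]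
      simp only [hZ]
      rw [Finset.sum_congr rfl fun k _ => Finset.sum_comm, Finset.sum_comm]
      refine Finset.sum_congr rfl fun h _ => ?_
      rw [derivCorr, (((hFb x).iterDiffFun (m + 1) h).conjIter (m + 1)).norm_sq_fourier_eq]
      refine Finset.sum_congr rfl fun k _ => ?_
      rw [Finset.sum_mul, diffFun_conjIter]
      simp only [iterDiffFun_diffFun]
    calc _ = ‖((∑ x ∈ Finset.Icc (1 : ℤ) N, ∑ h ∈ cube (m + 1) I,
          ‖derivCorr N f₀ f₁ (m + 1) x h (α + ∑ i, ψ x i h)‖ ^ 2 : ℝ) : ℂ)‖ := by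
          rw [Complex.norm_real, Real.norm_of_nonneg (by positivity)]
      _ ≤ _ := by rw [h2]; exact norm_sum_le _ _
  have h3 := pow_sum_mul_card_le Q (fun q => ‖Z q‖) (fun q _ => norm_nonneg _)
    (p := p) (by positivity)
  have h4 : (∑ q ∈ Q, ‖Z q‖ ^ p) * n ^ (m + 2) ≤
      n ^ ((m + 1) * p) * (L * ∑ x ∈ Finset.Icc (1 : ℤ) N, gowersSum (m + 1) (F x)) := by
    rw [Finset.sum_mul]
    calc ∑ q ∈ Q, ‖Z q‖ ^ p * n ^ (m + 2)
        ≤ ∑ q ∈ Q, n ^ ((m + 1) * p) * gowersSum m (diffFun q.2.1 (F q.1)) :=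
          Finset.sum_le_sum fun q _ =>
            norm_sum_twisted_le m ((hFb q.1).diffFun q.2.1) q.2.2 q.2.1 α _ (hψ q.1)
      _ = _ := by
          rw [← Finset.mul_sum, hQ, Finset.sum_product]
          congr 1
          rw [Finset.mul_sum]
          refine Finset.sum_congr rfl fun x _ => ?_
          rw [Finset.sum_product, (hFb x).gowersSum_succ, Finset.mul_sum]
          refine Finset.sum_congr rfl fun k _ => ?_
          simp
  set S := ∑ x ∈ Finset.Icc (1 : ℤ) N, gowersSum (m + 1) (F x) with hS
  rw [hQc] at h3
  -- One of the two factors $L$ is replaced by $n/2$, as $n\le 2L$; the halves so produced are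
  -- absorbed by doubling the exponent of $\kappa$.
  have hκp : κ ^ 2 ≤ κ / 2 := by nlinarith
  have h5 : (κ / 2) ^ p * (N * n ^ (m + 3)) ≤ S := by
    set c : ℝ := (N * n * L) ^ p * n ^ ((m + 1) * p) * L with hc
    have hc0 : 0 < c := by positivity
    refine le_of_mul_le_mul_left ?_ hc0
    calc c * ((κ / 2) ^ p * (N * n ^ (m + 3)))
        = (κ * (N * n ^ (m + 1) * (L * (n / 2)))) ^ p * (N * n * L) * n ^ (m + 2) := by
          rw [hc, pow_mul, ← mul_pow]
          have : (κ * (N * n ^ (m + 1) * (L * (n / 2)))) ^ p =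
            (N * n * L * n ^ (m + 1)) ^ p * (κ / 2) ^ p := by
            rw [← mul_pow]; congr 1; ring
          rw [this]
          ring
      _ ≤ (κ * (N * n ^ (m + 1) * (L * L))) ^ p * (N * n * L) * n ^ (m + 2) := by
          gcongr
          linarith
      _ ≤ (∑ q ∈ Q, ‖Z q‖) ^ p * (N * n * L) * n ^ (m + 2) := by
          gcongr
          rwa [← sq (L : ℝ)]
      _ ≤ ((N * n * L) ^ p * ∑ q ∈ Q, ‖Z q‖ ^ p) * n ^ (m + 2) := by gcongr
      _ = (N * n * L) ^ p * ((∑ q ∈ Q, ‖Z q‖ ^ p) * n ^ (m + 2)) := by ring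
      _ ≤ (N * n * L) ^ p * (n ^ ((m + 1) * p) * (L * S)) := by gcongr
      _ = c * S := by rw [hc]; ring
  calc κ ^ (2 ^ (m + 2)) * (N * ((N : ℝ) ^ 2) ^ (m + 3))
      = (κ ^ 2) ^ p * (N * ((N : ℝ) ^ 2) ^ (m + 3)) := by
        rw [← pow_mul κ, hp, ← pow_succ']
    _ ≤ (κ / 2) ^ p * (N * n ^ (m + 3)) := by gcongr
    _ ≤ S := h5

/-- The quantity bounded below in the conclusion of degree lowering. -/
noncomputable def quadCorr (N : ℕ) (f₁ : ℤ × ℤ → ℂ) (α : UnitAddCircle) : ℝ :=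
  ∑ x ∈ Finset.Icc (1 : ℤ) N, ∑ y ∈ Finset.Icc (1 : ℤ) (N ^ 2),
    ‖∑ d ∈ Finset.Icc (-(N : ℤ)) N, (fejer N d : ℂ) * f₁ (x + d, y) * e (d ^ 2 • α)‖

/-- Without derivatives the correlation is a Fourier coefficient of $F_x$ at $\alpha$. One factor of
its square is bounded trivially, the other by the correlation of $f_1$ with $e(\alpha d^2)$. -/
theorem IsAdmissible.le_quadCorr (hf : IsAdmissible N f₀ f₁) {κ : ℝ} (hκ : 0 < κ)
    (α : UnitAddCircle) (ψ : ℤ → Fin 0 → (Fin 0 → ℤ) → UnitAddCircle)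
    (h : κ * (N * ((diffRange (2 * N ^ 2)).card : ℝ) ^ 0 * ((2 * N ^ 2 : ℕ) : ℝ) ^ 2) ≤
      ∑ x ∈ Finset.Icc (1 : ℤ) N, ∑ h ∈ cube 0 (diffRange (2 * N ^ 2)),
        ‖derivCorr N f₀ f₁ 0 x h (α + ∑ i, ψ x i h)‖ ^ 2) :
    κ * (N * (N : ℝ) ^ 2) ≤ quadCorr N f₁ α := by
  have hN0 : (0 : ℝ) < N := by exact_mod_cast hf.one_le
  have hL0 : (0 : ℝ) < (2 * N ^ 2 : ℕ) := by push_cast; positivity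
  have h1 : ∀ x, ‖derivCorr N f₀ f₁ 0 x ![] α‖ ≤ ∑ y ∈ Finset.Icc (1 : ℤ) (N ^ 2),
      ‖∑ d ∈ Finset.Icc (-(N : ℤ)) N, (fejer N d : ℂ) * f₁ (x + d, y) * e (d ^ 2 • α)‖ := by
    intro x
    refine le_trans (le_of_eq ?_) (hf.norm_sum_constituent_le 0 ![] x α)
    congr 1
    simp only [derivCorr, iterDiffFun, conjIter, RingHom.id_apply, dualFun_eq_sum hf.one_le,
      Finset.sum_mul, Finset.mul_sum]
    rw [Finset.sum_comm]
    exact Finset.sum_congr rfl fun d _ => Finset.sum_congr rfl fun y _ => by ring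
  simp only [sum_cube_zero, Finset.univ_eq_empty, Finset.sum_empty, add_zero, pow_zero,
    mul_one] at h
  have h2 : (2 * N ^ 2 : ℕ) * (κ * (N * (2 * N ^ 2 : ℕ))) ≤ (2 * N ^ 2 : ℕ) * quadCorr N f₁ α := by
    calc _ = κ * (N * ((2 * N ^ 2 : ℕ) : ℝ) ^ 2) := by ring
      _ ≤ _ := h
      _ ≤ _ := by
        rw [quadCorr, Finset.mul_sum]
        refine Finset.sum_le_sum fun x _ => ?_
        rw [sq]
        exact mul_le_mul (hf.norm_derivCorr_le 0 x ![] α) (h1 x) (norm_nonneg _) hL0.le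
  have h3 := le_of_mul_le_mul_left h2 hL0
  refine le_trans ?_ h3
  push_cast
  have : (0 : ℝ) ≤ κ * (N * (N : ℝ) ^ 2) := by positivity
  linarith

end

/-- Degree lowering for the sums `∑_x ‖F_x‖_{U^{m+2}}^{2^{m+2}}` with unnormalised averages. -/
theorem degree_lowering (m : ℕ) : ∃ k : ℕ, ∀ (N : ℕ) (f₀ f₁ : ℤ × ℤ → ℂ),
    IsAdmissible N f₀ f₁ → ∀ (δ : ℝ), 0 < δ → δ ≤ 1 / 2 →
    δ * (N * ((N : ℝ) ^ 2) ^ (m + 3)) ≤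
      ∑ x ∈ Finset.Icc (1 : ℤ) N, gowersSum (m + 1) (fun y => dualFun N f₀ f₁ (x, y)) →
    (N : ℝ) ≤ δ⁻¹ ^ k ∨ ∃ α, IsMajor (δ⁻¹ ^ k) N α ∧
      δ ^ k * (N * (N : ℝ) ^ 2) ≤ quadCorr N f₁ α := by
  induction m with
  | zero =>
    obtain ⟨k, hk⟩ := exists_lower_order_phase 0
    refine ⟨8 * k, fun N f₀ f₁ hf δ hδ hδ' h => ?_⟩
    obtain ⟨φ, H, hH, hHc, hφ⟩ := hf.exists_many_derivCorr 0 hδ hδ' h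
    rw [← pow_mul] at hHc hφ
    have h0 := hk N f₀ f₁ hf _ (by positivity) (pow_le_half hδ hδ' (by norm_num)) φ H hH hHc hφ
    rw [← inv_pow, ← pow_mul, ← pow_mul] at h0
    refine h0.imp_right fun ⟨α, hα, ψ, _, hψ⟩ => ⟨α, hα, ?_⟩
    exact hf.le_quadCorr (by positivity) α ψ hψ
  | succ m ih =>
    obtain ⟨k', hk'⟩ := ih
    obtain ⟨k, hk⟩ := exists_lower_order_phase (m + 1)
    set a : ℕ := (2 * (m + 1) + 4) * 2 with ha
    refine ⟨a * (k + 1) + a * (k + 1) * 2 ^ (m + 2) * k', fun N f₀ f₁ hf δ hδ hδ' h => ?_⟩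
    obtain ⟨φ, H, hH, hHc, hφ⟩ := hf.exists_many_derivCorr (m + 1) hδ hδ' h
    rw [← pow_mul] at hHc hφ
    -- That this $\alpha$ lies in a major arc is not needed here: only the lower-order form of the
    -- phases is used, and the final frequency comes from the base case.
    rcases hk N f₀ f₁ hf _ (by positivity) (pow_le_half hδ hδ' (by omega)) φ H hH hHc hφ with
      h0 | ⟨α, _, ψ, hψ, h1⟩
    · left
      rw [← inv_pow, ← pow_mul] at h0
      refine h0.trans (inv_pow_le_of_le hδ hδ' ?_)
      rw [← ha]
      exact (Nat.mul_le_mul_left a k.le_succ).trans (Nat.le_add_right _ _)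
    -- The exponent $k+1$ in place of $k$ ensures $\kappa\le 1/2$ even when $k=0$.
    · have h2 := hf.le_sum_gowersSum m (κ := (δ ^ a) ^ (k + 1)) (by positivity)
        (by rw [← pow_mul]; exact pow_le_half hδ hδ' (by positivity)) α ψ hψ
        (le_trans (by
          gcongr ?_ * _
          rw [← pow_mul, ← pow_mul]
          exact pow_anti hδ hδ' (by nlinarith)) h1)
      have h3 := hk' N f₀ f₁ hf _ (by positivity) (by
        rw [← pow_mul, ← pow_mul]
        exact pow_le_half hδ hδ' (by positivity)) h2
      have hle : a * (k + 1) * 2 ^ (m + 2) * k' ≤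
        a * (k + 1) + a * (k + 1) * 2 ^ (m + 2) * k' := Nat.le_add_left _ _
      simp only [← inv_pow, ← pow_mul] at h3
      refine h3.imp (fun h4 => h4.trans (inv_pow_le_of_le hδ hδ' hle)) fun ⟨α, hα, h4⟩ =>
        ⟨α, hα.mono (inv_pow_le_of_le hδ hδ' hle), le_trans ?_ h4⟩
      gcongr ?_ * _
      exact pow_anti hδ hδ' hle

end DegreeLowering

/-! ### Return to normalised averages. -/

theorem lemma4p5 (s : ℕ) (hs : 2 ≤ s) :
    ∃ (C : ℝ) (k : ℕ), 0 < C ∧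
      ∀ (N : ℕ), 1 ≤ N → ∀ (f₀ f₁ : ℤ × ℤ → ℂ),
        (∀ p, ‖f₀ p‖ ≤ 1) → (∀ p, ‖f₁ p‖ ≤ 1) →
        Function.support f₀ ⊆ Set.Icc (1 : ℤ) N ×ˢ Set.Icc (1 : ℤ) (N ^ 2) →
        Function.support f₁ ⊆ Set.Icc (-N : ℤ) (2 * N) ×ˢ Set.Icc (1 : ℤ) (N ^ 2) →
        (∀ p, ‖DegreeLowering.dualFun N f₀ f₁ p‖ ≤ 1) ∧
        Function.support (DegreeLowering.dualFun N f₀ f₁) ⊆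
          Set.Icc (1 : ℤ) N ×ˢ Set.Icc (1 : ℤ) (2 * N ^ 2) ∧
        ∀ (δ : ℝ), 0 < δ →
          δ * DegreeLowering.gowersNorm s
                (DegreeLowering.intervalIndicator 1 (2 * N ^ 2)) ^ 2 ^ s ≤
            𝔼 x ∈ Finset.Icc (1 : ℤ) N,
              DegreeLowering.gowersNorm s
                (fun y => DegreeLowering.dualFun N f₀ f₁ (x, y)) ^ 2 ^ s →
          (N : ℝ) ≤ C * δ⁻¹ ^ k ∨
          ∃ (α : UnitAddCircle) (q : ℕ), 1 ≤ q ∧ (q : ℝ) ≤ C * δ⁻¹ ^ k ∧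
            ‖q • α‖ ≤ C * δ⁻¹ ^ k / (N : ℝ) ^ 2 ∧
            C⁻¹ * δ ^ k ≤
              𝔼 x ∈ Finset.Icc (1 : ℤ) N, 𝔼 y ∈ Finset.Icc (1 : ℤ) (N ^ 2),
                ‖∑' d : ℤ, (DegreeLowering.fejer N d : ℂ) * f₁ (x + d, y) *
                  DegreeLowering.e (d ^ 2 • α)‖ := by
  obtain ⟨m, rfl⟩ := Nat.exists_eq_add_of_le' hs
  obtain ⟨c, hc, hcB⟩ := DegreeLowering.exists_le_gowersSum_intervalIndicator (m + 1)
  obtain ⟨k, hk⟩ := DegreeLowering.degree_lowering m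
  -- The trivial upper bound for the Gowers sums of $F_x$ forces $\delta c\le 4^{m+2}$, so
  -- $c_0\delta\le 1/2$ holds automatically and large $\delta$ needs no separate treatment. Applying
  -- degree lowering to $c_0\delta$ then gives $C=c_0^{-k}$.
  set c₀ : ℝ := c / (2 * 4 ^ (m + 2)) with hc₀
  have hc₀0 : 0 < c₀ := by positivity
  refine ⟨c₀⁻¹ ^ k, k, by positivity, fun N hN f₀ f₁ h0 h1 hs0 _ => ?_⟩
  have hf : DegreeLowering.IsAdmissible N f₀ f₁ := ⟨hN, h0, h1, hs0⟩
  have hN0 : (0 : ℝ) < N := by exact_mod_cast hN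
  refine ⟨fun p => (hf.isBddOn_dualFun p.1).norm_le p.2, fun p hp => ⟨?_, ?_⟩,
    fun δ hδ hFδ => ?_⟩
  · by_contra hcon
    exact hp (hf.dualFun_eq_zero hcon p.2)
  · by_contra hcon
    refine hp ((hf.isBddOn_dualFun p.1).eq_zero p.2 ?_)
    rw [Finset.mem_Icc]
    push_cast
    exact hcon
  have hind : c * ((N : ℝ) ^ 2) ^ (m + 3) ≤
      DegreeLowering.gowersSum (m + 1) (DegreeLowering.intervalIndicator 1 (2 * N ^ 2)) := by
    have h2 := hcB (2 * N ^ 2)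
    push_cast at h2
    refine le_trans ?_ h2
    gcongr
    linarith [sq_nonneg (N : ℝ)]
  have hbdd : DegreeLowering.IsBddOn (2 * N ^ 2)
      (DegreeLowering.intervalIndicator 1 (2 * N ^ 2)) := by
    have h2 := DegreeLowering.isBddOn_intervalIndicator (2 * N ^ 2)
    push_cast at h2
    exact h2
  rw [DegreeLowering.gowersNorm_pow hbdd.finite_support (m + 1), Finset.expect_eq_sum_div_card,
    Finset.sum_congr rfl fun x _ =>
      DegreeLowering.gowersNorm_pow (hf.isBddOn_dualFun x).finite_support (m + 1),
    Int.card_Icc, add_sub_cancel_right, Int.toNat_natCast, le_div_iff₀ hN0] at hFδ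
  have hlow : δ * c * (N * ((N : ℝ) ^ 2) ^ (m + 3)) ≤ ∑ x ∈ Finset.Icc (1 : ℤ) N,
      DegreeLowering.gowersSum (m + 1) fun y => DegreeLowering.dualFun N f₀ f₁ (x, y) := by
    refine le_trans ?_ hFδ
    calc _ = δ * (c * ((N : ℝ) ^ 2) ^ (m + 3)) * N := by ring
      _ ≤ _ := by gcongr
  have hupp : (∑ x ∈ Finset.Icc (1 : ℤ) N,
      DegreeLowering.gowersSum (m + 1) fun y => DegreeLowering.dualFun N f₀ f₁ (x, y)) ≤
      4 ^ (m + 2) * (N * ((N : ℝ) ^ 2) ^ (m + 3)) := by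
    calc _ ≤ ∑ x ∈ Finset.Icc (1 : ℤ) N,
          (2 * (2 * N ^ 2 : ℕ)) ^ (m + 1) * ((2 * N ^ 2 : ℕ) : ℝ) ^ 2 :=
          Finset.sum_le_sum fun x _ => (hf.isBddOn_dualFun x).gowersSum_le (m + 1)
      _ = N * ((4 * (N : ℝ) ^ 2) ^ (m + 1) * (2 * (N : ℝ) ^ 2) ^ 2) := by
          rw [Finset.sum_const, Int.card_Icc, add_sub_cancel_right, Int.toNat_natCast,
            nsmul_eq_mul]
          push_cast
          ring
      _ = _ := by rw [mul_pow 4]; ring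
  have hδc : δ * c ≤ 4 ^ (m + 2) := le_of_mul_le_mul_right (hlow.trans hupp) (by positivity)
  have hδ' : c₀ * δ ≤ 1 / 2 := by
    rw [hc₀, div_mul_eq_mul_div, div_le_iff₀ (by positivity)]
    linarith
  have hδc₀ : c₀ * δ ≤ δ * c := by
    rw [mul_comm c₀]
    gcongr
    refine div_le_self hc.le ?_
    linarith [one_le_pow₀ (n := m + 2) (by norm_num : (1 : ℝ) ≤ 4)]
  have hmain := hk N f₀ f₁ hf (c₀ * δ) (by positivity) hδ'
    (le_trans (by gcongr) hlow)
  rw [mul_inv, mul_pow, mul_pow] at hmain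
  refine hmain.imp_right fun ⟨α, ⟨q, hq, hqK, hqα⟩, hα⟩ => ⟨α, q, hq, hqK, hqα, ?_⟩
  have hd : ∀ x y, ∑' d : ℤ, (DegreeLowering.fejer N d : ℂ) * f₁ (x + d, y) *
      DegreeLowering.e (d ^ 2 • α) = ∑ d ∈ Finset.Icc (-(N : ℤ)) N,
        (DegreeLowering.fejer N d : ℂ) * f₁ (x + d, y) * DegreeLowering.e (d ^ 2 • α) :=
    fun x y => tsum_eq_sum fun d hd => by simp [DegreeLowering.fejer_eq_zero hN hd]
  have hcard : ((Finset.Icc (1 : ℤ) (N ^ 2)).card : ℝ) = (N : ℝ) ^ 2 := by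
    rw [Int.card_Icc, add_sub_cancel_right]
    exact_mod_cast congrArg (Nat.cast : ℕ → ℝ) (Int.toNat_natCast (N ^ 2))
  simp only [hd, Finset.expect_eq_sum_div_card, hcard, ← Finset.sum_div]
  rw [Int.card_Icc, add_sub_cancel_right, Int.toNat_natCast, div_div, le_div_iff₀ (by positivity),
    inv_pow, inv_inv, mul_comm ((N : ℝ) ^ 2)]
  exact hα
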